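/- Let $(X,d)$ be a metric space that is geometrically doubling: there is $N\in\mathbb N$ such that every open ball $B(x,r)$ can be covered by at most $N$ open balls of radius $r/2$. Let $\mu$ be a Borel measure on $X$ that is upper doubling, i.e. there is a dominating function $\lambda:X\times(0,\infty)\to(0,\infty)$ such that $r\mapsto\lambda(x,r)$ is non-decreasing for each $x$, $\lambda(x,2r)\le C_\lambda\lambda(x,r)$ and $\mu(B(x,r))\le\lambda(x,r)$ for all $x\in X$, $r>0$, and $\lambda(x,r)\le C\lambda(y,r)$ whenever $d(x,y)\le r$. Functions take values in $\mathbb R$ or in $\mathbb C$. A Calderón–Zygmund kernel is a function $K\in L^1_{\rm loc}(X\times X\setminus\{x=y\})$ for which there are constants $C,c>0$ and $0<\delta\le1$ such that $$|K(x,y)|\le C\min\Big\{\frac1{\lambda(x,d(x,y))},\frac1{\lambda(y,d(x,y))}\Big\}\qquad(x\ne y),$$ $$|K(x,y)-K(x',y)|+|K(y,x)-K(y,x')|\le C\,\frac{d(x,x')^\delta}{d(x,y)^\delta\,\lambda(x,d(x,y))}\qquad\text{if } x\neq y,\ x'\ne y,\ d(x,x')\le c\,d(x,y).$$ Let $T$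 be a Calderón–Zygmund operator that is bounded on $L^2(\mu)$: a bounded linear operator $T:L^2(\mu)\to L^2(\mu)$ such that, for some such kernel $K$ and every $f\in L^\infty(\mu)$ with bounded support, $Tf(x)=\int_X K(x,y)f(y)\,d\mu(y)$ for $\mu$-almost every $x\notin\operatorname{supp}f$. For $f\in L^\infty(\mu)$, $Tf$ is defined modulo additive constants as usual: a function $g$ represents $Tf$ if for every ball $B=B(x_0,r)$ there is a constant $c_B$ such that, for $\mu$-almost every $x\in B$, $$g(x)=T(f\chi_{2B})(x)+\int_{X\setminus 2B}\big(K(x,y)-K(x_0,y)\big)f(y)\,d\mu(y)+c_B ,$$ the integral being absolutely convergent for every $x\in B$; here $\rho B=B(x_0,\rho r)$. Fix $\rho>1$. For balls $B=B(x_B,r_B)\subset Q=B(x_Q,r_Q)$ let $K_{B,Q}=1+\int_{r_B\le d(x,x_B)\le r_Q}\frac{d\mu(x)}{\lambda(x_B,d(x,x_B))}$. A function $g$ that is integrable on balls belongs to $\mathrm{RBMO}(\mu)$ if there are a constant $A\ge0$ and, for every ball $B$, a number $g_B$ such that $\int_B|g-g_B|\,d\mu\le A\,\mu(\rho B)$ for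 all balls $B$ and $|g_B-g_{Q}|\le A\,K_{B,Q}$ for all balls $B\subset Q$; $\|g\|_{\mathrm{RBMO}(\mu)}$ is the infimum of such $A$. Then: (1) $T$ is bounded from $L^\infty(\mu)$ into $\mathrm{RBMO}(\mu)$: for every $\rho>1$ there is a constant $C$ such that for every $f\in L^\infty(\mu)$, $Tf$ exists (modulo constants), and every representative $g$ of it belongs to $\mathrm{RBMO}(\mu)$ with $\|g\|_{\mathrm{RBMO}(\mu)}\le C\|f\|_{L^\infty(\mu)}$. Moreover, for $f\in L^2(\mu)\cap L^\infty(\mu)$, the $L^2$-function $Tf$ itself belongs to $\mathrm{RBMO}(\mu)$ with $\|Tf\|_{\mathrm{RBMO}(\mu)}\le C\|f\|_{L^\infty(\mu)}$. (2) Consequently, $T$ is bounded on $L^p(\mu)$ for all $1<p<\infty$: for each such $p$ there is a bounded linear operator on $L^p(\mu)$ that agrees with $T$ on $L^2(\mu)\cap L^p(\mu)$. -/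

import Mathlib

open MeasureTheory Metric Set
open scoped ENNReal

noncomputable section

namespace NonHomogeneous

/-- There is `N` such that every open ball of radius `r` is covered by at most `N` open balls
of radius `r / 2`. -/
def GeometricallyDoubling (X : Type*) [MetricSpace X] : Prop :=
  ∃ N : ℕ, ∀ (x : X) (r : ℝ), 0 < r →
    ∃ s : Finset X, s.card ≤ N ∧ ball x r ⊆ ⋃ y ∈ s, ball y (r / 2)

/-- `lam` is a dominating function for `μ`, so that `μ` is upper doubling. Only the values
`lam x r` with `0 < r` matter. -/
structure IsDominating {X : Type*} [MetricSpace X] [MeasurableSpace X]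
    (μ : Measure X) (lam : X → ℝ → ℝ) : Prop where
  pos : ∀ x r, 0 < r → 0 < lam x r
  mono : ∀ x, MonotoneOn (lam x) (Ioi 0)
  doubling : ∃ C : ℝ, 0 < C ∧ ∀ x r, 0 < r → lam x (2 * r) ≤ C * lam x r
  measure_ball_le : ∀ x r, 0 < r → μ (ball x r) ≤ ENNReal.ofReal (lam x r)
  comparable : ∃ C : ℝ, 0 < C ∧ ∀ x y r, 0 < r → dist x y ≤ r → lam x r ≤ C * lam y r

/-- The coefficient `K_{B,Q}` for `B = ball xB rB` and `Q` a ball of radius `rQ`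
(it does not depend on the centre of `Q`). -/
def coeffK {X : Type*} [MetricSpace X] [MeasurableSpace X]
    (μ : Measure X) (lam : X → ℝ → ℝ) (xB : X) (rB rQ : ℝ) : ℝ :=
  1 + ∫ x in {x | rB ≤ dist x xB ∧ dist x xB ≤ rQ}, 1 / lam xB (dist x xB) ∂μ

/-- Calderón–Zygmund kernels. The values of `K` on the diagonal play no role. -/
structure IsCZKernel {X 𝕜 : Type*} [MetricSpace X] [MeasurableSpace X] [RCLike 𝕜]
    (μ : Measure X) (lam : X → ℝ → ℝ) (K : X → X → 𝕜) : Prop where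
  locallyIntegrableOn :
    LocallyIntegrableOn (fun p : X × X => K p.1 p.2) {p | p.1 ≠ p.2} (μ.prod μ)
  size : ∃ C : ℝ, ∀ x y, x ≠ y →
    ‖K x y‖ ≤ C * min (1 / lam x (dist x y)) (1 / lam y (dist x y))
  smooth : ∃ δ C c : ℝ, 0 < δ ∧ δ ≤ 1 ∧ 0 < c ∧
    ∀ x x' y, x ≠ y → x' ≠ y → dist x x' ≤ c * dist x y →
      ‖K x y - K x' y‖ + ‖K y x - K y x'‖
        ≤ C * (dist x x' ^ δ / (dist x y ^ δ * lam x (dist x y)))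

/-- The `L²`-bounded linear operator `T` is a Calderón–Zygmund operator with kernel `K`: for `f`
bounded with bounded support, `T f (x) = ∫ K(x,y) f(y) dμ(y)` for almost every `x ∉ supp f`. -/
structure IsCZOperator {X 𝕜 : Type*} [MetricSpace X] [MeasurableSpace X] [RCLike 𝕜]
    (μ : Measure X) (lam : X → ℝ → ℝ) (K : X → X → 𝕜) (T : Lp 𝕜 2 μ →L[𝕜] Lp 𝕜 2 μ) : Prop where
  kernel : IsCZKernel μ lam K
  repr : ∀ (f : X → 𝕜) (hf : MemLp f 2 μ), MemLp f ∞ μ →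
    Bornology.IsBounded (Function.support f) →
      ∀ᵐ x ∂μ, x ∉ tsupport f → T (hf.toLp f) x = ∫ y, K x y * f y ∂μ

/-- `g` is a representative of `T f`, which for a general `f ∈ L^∞(μ)` is defined modulo additive
constants: for every ball `B = ball x₀ r` there is a constant `c` such that, for almost every
`x ∈ B`,
`g x = T (f χ_{2B}) (x) + ∫_{X ∖ 2B} (K(x,y) - K(x₀,y)) f(y) dμ(y) + c`,
the integral being absolutely convergent. -/
def RepresentsModConst {X 𝕜 : Type*} [MetricSpace X] [MeasurableSpace X] [RCLike 𝕜]
    {μ : Measure X} (K : X → X → 𝕜) (T : Lp 𝕜 2 μ →L[𝕜] Lp 𝕜 2 μ) (f g : X → 𝕜) : Prop :=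
  ∀ (x₀ : X) (r : ℝ), 0 < r →
    (∀ x ∈ ball x₀ r,
      IntegrableOn (fun y => (K x y - K x₀ y) * f y) (ball x₀ (2 * r))ᶜ μ) ∧
    ∃ F : Lp 𝕜 2 μ, F =ᵐ[μ] (ball x₀ (2 * r)).indicator f ∧
      ∃ c : 𝕜, ∀ᵐ x ∂μ, x ∈ ball x₀ r →
        g x = T F x + ∫ y in (ball x₀ (2 * r))ᶜ, (K x y - K x₀ y) * f y ∂μ + c

/-- The constant `A` is admissible in the definition of the `RBMO` norm of `f`; `m x r` is the
number `f_B` attached to the ball `B = ball x r`. -/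
def RBMOBound {X 𝕜 : Type*} [MetricSpace X] [MeasurableSpace X] [RCLike 𝕜]
    (μ : Measure X) (lam : X → ℝ → ℝ) (ρ : ℝ) (f : X → 𝕜) (A : ℝ) : Prop :=
  ∃ m : X → ℝ → 𝕜,
    (∀ x r, 0 < r → ∫ y in ball x r, ‖f y - m x r‖ ∂μ ≤ A * μ.real (ball x (ρ * r))) ∧
    (∀ x r x' r', 0 < r → 0 < r' → ball x r ⊆ ball x' r' →
      ‖m x r - m x' r'‖ ≤ A * coeffK μ lam x r r')

/-- `f ∈ RBMO(μ)` (with parameter `ρ > 1`): `f` is integrable on balls and some constant is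
admissible. -/
def MemRBMO {X 𝕜 : Type*} [MetricSpace X] [MeasurableSpace X] [RCLike 𝕜]
    (μ : Measure X) (lam : X → ℝ → ℝ) (ρ : ℝ) (f : X → 𝕜) : Prop :=
  (∀ x r, IntegrableOn f (ball x r) μ) ∧ ∃ A : ℝ, 0 ≤ A ∧ RBMOBound μ lam ρ f A

/-- The `RBMO` norm: the infimum of the admissible constants. -/
def rbmoNorm {X 𝕜 : Type*} [MetricSpace X] [MeasurableSpace X] [RCLike 𝕜]
    (μ : Measure X) (lam : X → ℝ → ℝ) (ρ : ℝ) (f : X → 𝕜) : ℝ :=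
  sInf {A : ℝ | 0 ≤ A ∧ RBMOBound μ lam ρ f A}

end NonHomogeneous

end

noncomputable section

namespace NonHomogeneous

open Filter Topology

section

variable {X 𝕜 : Type*} [MetricSpace X]

/-! Everything rests on one decomposition. On a ball B with centre x, T f at z is T(f χ_{2B})(z),
plus the integral of (K(z,y) - K(x,y)) f(y) over the complement of 2B, plus a constant. The first
term is governed by boundedness on L², the second by smoothness of K and a geometric sum over dyadic
annuli (`lintegral_tail_le`). The constants of two balls differ by an integral of truncated kernels,
`cutDiff`, which is additive along chains of balls.

For (1), the local expressions of two balls differ on the overlap by exactly `cutDiff`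
(`CZOperator.localRepr_sub_localRepr`), so they patch to a representative g. Every representative
comes with numbers m_B whose differences are `cutDiff`, and these serve as the numbers g_B of the
RBMO condition. The oscillation bound is `CZOperator.lintegral_ball_localRepr_le`. The bound on
differences is `norm_cutDiff_le`: by |K| ≤ A/λ, the integral of the kernel between two scales is
dominated by K_{B,Q}. For f in L² ∩ L^∞ the L² function T f is itself a representative.

For (2), no interpolation from RBMO is used: the same decomposition gives a good-λ inequality
(`CZOperator.good_lambda`) comparing {|T f| > 2t} with {|T f| > t} and with a level set of a maximal
function of |f|². Around almost every relevant point one takes the largest scale 128^k at which {|T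
f| > t} still fills a fixed fraction of the ball, and then the first doubling ball above it. That
doubling ball contains a point where |T f| ≤ t and the local part is small, so its constant is at
most about t. The scales in between are not doubling, so the kernel integrals over them sum
geometrically (`lintegral_annulus_chain_le`), and the constant at scale 128^k is about t as well.
Only the local part can then push |T f| beyond 2t, and the weak L² bound followed by a Vitali
covering finishes. Doubling balls exist at large scales by upper doubling, and at arbitrarily small
scales almost everywhere by geometric doubling.

Integrating the good-λ inequality gives L^p bounds for p > 2 (`lintegral_rpow_le_of_good_lambda`).
For p < 2 one passes to the adjoint, which is an operator of the same kind with kernel the conjugate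
of K(y,x) (`CZOperator.adjoint`), and density extends T to L^p. -/

theorem mem_compl_ball_iff {x y : X} {r : ℝ} : y ∈ (ball x r)ᶜ ↔ r ≤ dist x y := by
  rw [mem_compl_iff, mem_ball, not_lt, dist_comm]

/-! ### Geometric doubling -/

theorem exists_cover_of_halving {N : ℕ}
    (h : ∀ (x : X) (r : ℝ), 0 < r →
      ∃ s : Finset X, s.card ≤ N ∧ ball x r ⊆ ⋃ y ∈ s, ball y (r / 2))
    (n : ℕ) (x : X) {r : ℝ} (hr : 0 < r) :
    ∃ s : Finset X, s.card ≤ N ^ n ∧ ball x r ⊆ ⋃ y ∈ s, ball y (r / 2 ^ n) := by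
  classical
  induction n with
  | zero => exact ⟨{x}, by simp, by simp⟩
  | succ n ih =>
    obtain ⟨s, hs, hxs⟩ := ih
    choose t ht htc using fun y : X => h y (r / 2 ^ n) (by positivity)
    refine ⟨s.biUnion t, ?_, ?_⟩
    · calc (s.biUnion t).card ≤ ∑ y ∈ s, (t y).card := Finset.card_biUnion_le
        _ ≤ ∑ _y ∈ s, N := Finset.sum_le_sum fun y _ => ht y
        _ = s.card * N := by simp
        _ ≤ N ^ (n + 1) := by rw [pow_succ]; exact Nat.mul_le_mul_right _ hs
    · intro z hz
      obtain ⟨y, hy, hzy⟩ := mem_iUnion₂.1 (hxs hz)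
      obtain ⟨w, hw, hzw⟩ := mem_iUnion₂.1 (htc y hzy)
      refine mem_iUnion₂.2 ⟨w, Finset.mem_biUnion.2 ⟨y, hy, hw⟩, ?_⟩
      rwa [pow_succ, ← div_div]

/-- Centres of iterated halving covers of the balls of integer radius about one point form a
countable dense set. -/
theorem GeometricallyDoubling.secondCountableTopology (h : GeometricallyDoubling X) :
    SecondCountableTopology X := by
  obtain ⟨N, hN⟩ := h
  rcases isEmpty_or_nonempty X with hX | ⟨⟨o⟩⟩
  · infer_instance
  choose s _ hs using fun (n m : ℕ) => exists_cover_of_halving hN n o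
    (r := (m : ℝ) + 1) (by positivity)
  have : TopologicalSpace.SeparableSpace X := by
    refine ⟨⟨⋃ n, ⋃ m, (s n m : Set X), countable_iUnion fun n => countable_iUnion fun m =>
      (s n m).countable_toSet, ?_⟩⟩
    rw [Metric.dense_iff]
    intro x r hr
    obtain ⟨m, hm⟩ := exists_nat_gt (dist x o)
    obtain ⟨n, hn⟩ := pow_unbounded_of_one_lt (((m : ℝ) + 1) / r) one_lt_two
    obtain ⟨y, hy, hxy⟩ := mem_iUnion₂.1 (hs n m (mem_ball.2 (by linarith) : x ∈ ball o _))
    refine ⟨y, ?_, mem_iUnion₂.2 ⟨n, m, hy⟩⟩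
    rw [mem_ball, dist_comm]
    refine (mem_ball.1 hxy).trans ?_
    rw [div_lt_iff₀ (by positivity)]
    rw [div_lt_iff₀ hr] at hn
    linarith
  exact UniformSpace.secondCountable_of_separable X

/-! ### Dominating functions -/

variable [MeasurableSpace X]

/-- `lam` is a dominating function for `μ` and both its doubling constant and its comparability
constant are at most `C`. -/
structure UpperDoubling (μ : Measure X) (lam : X → ℝ → ℝ) (C : ℝ) : Prop where
  one_le : 1 ≤ C
  pos : ∀ x {r}, 0 < r → 0 < lam x r
  mono : ∀ x, MonotoneOn (lam x) (Ioi 0)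
  doubling : ∀ x {r}, 0 < r → lam x (2 * r) ≤ C * lam x r
  measure_ball_le : ∀ x {r}, 0 < r → μ (ball x r) ≤ ENNReal.ofReal (lam x r)
  comparable : ∀ x y {r}, 0 < r → dist x y ≤ r → lam x r ≤ C * lam y r

theorem IsDominating.exists_upperDoubling {μ : Measure X} {lam : X → ℝ → ℝ}
    (h : IsDominating μ lam) : ∃ C, UpperDoubling μ lam C := by
  obtain ⟨C₁, -, h₁⟩ := h.doubling
  obtain ⟨C₂, -, h₂⟩ := h.comparable
  refine ⟨max 1 (max C₁ C₂), le_max_left _ _, fun x r => h.pos x r, h.mono, fun x r hr => ?_,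
    fun x r => h.measure_ball_le x r, fun x y r hr hxy => ?_⟩
  · exact (h₁ x r hr).trans (mul_le_mul_of_nonneg_right
      ((le_max_left _ _).trans (le_max_right _ _)) (h.pos x r hr).le)
  · exact (h₂ x y r hr hxy).trans (mul_le_mul_of_nonneg_right
      ((le_max_right _ _).trans (le_max_right _ _)) (h.pos y r hr).le)

namespace UpperDoubling

variable {μ : Measure X} {lam : X → ℝ → ℝ} {C : ℝ} (h : UpperDoubling μ lam C)
include h

theorem C_pos : 0 < C := zero_lt_one.trans_le h.one_le

theorem lam_le_lam (x : X) {r s : ℝ} (hr : 0 < r) (hrs : r ≤ s) : lam x r ≤ lam x s :=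
  h.mono x hr (hr.trans_le hrs) hrs

theorem lam_two_pow_mul_le (n : ℕ) (x : X) {r : ℝ} (hr : 0 < r) :
    lam x (2 ^ n * r) ≤ C ^ n * lam x r := by
  induction n with
  | zero => simp
  | succ n ih =>
    calc lam x (2 ^ (n + 1) * r) = lam x (2 * (2 ^ n * r)) := by ring_nf
      _ ≤ C * lam x (2 ^ n * r) := h.doubling x (by positivity)
      _ ≤ C * (C ^ n * lam x r) := mul_le_mul_of_nonneg_left ih h.C_pos.le
      _ = C ^ (n + 1) * lam x r := by ring

theorem lam_le_pow_mul (n : ℕ) (x : X) {r s : ℝ} (hs : 0 < s) (hr : 0 < r) (hrs : s ≤ 2 ^ n * r) :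
    lam x s ≤ C ^ n * lam x r :=
  (h.lam_le_lam x hs hrs).trans (h.lam_two_pow_mul_le n x hr)

/-- Enlarging to the common radius 2^n r makes the two centres comparable there, at the price of one
extra factor C. -/
theorem lam_le_pow_mul' (n : ℕ) (x y : X) {r s : ℝ} (hs : 0 < s) (hr : 0 < r)
    (hrs : s ≤ 2 ^ n * r) (hxy : dist x y ≤ 2 ^ n * r) : lam x s ≤ C ^ (n + 1) * lam y r := by
  calc lam x s ≤ lam x (2 ^ n * r) := h.lam_le_lam x hs hrs
    _ ≤ C * lam y (2 ^ n * r) := h.comparable x y (by positivity) hxy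
    _ ≤ C * (C ^ n * lam y r) := mul_le_mul_of_nonneg_left (h.lam_two_pow_mul_le n y hr) h.C_pos.le
    _ = C ^ (n + 1) * lam y r := by ring

theorem measure_ball_lt_top (x : X) (r : ℝ) : μ (ball x r) < ∞ := by
  rcases le_or_gt r 0 with hr | hr
  · simp [ball_eq_empty.2 hr]
  · exact (h.measure_ball_le x hr).trans_lt ENNReal.ofReal_lt_top

theorem isLocallyFiniteMeasure : IsLocallyFiniteMeasure μ :=
  ⟨fun x => ⟨ball x 1, ball_mem_nhds x one_pos, h.measure_ball_lt_top x 1⟩⟩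

theorem measure_lt_top_of_isBounded {s : Set X} (hs : Bornology.IsBounded s) : μ s < ∞ := by
  rcases s.eq_empty_or_nonempty with rfl | ⟨x, hx⟩
  · simp
  obtain ⟨r, hr⟩ := (isBounded_iff_subset_ball x).1 hs
  exact (measure_mono hr).trans_lt (h.measure_ball_lt_top x r)

end UpperDoubling

/-- The `L¹` mass of `f` on the ball of centre `x` and radius `s ≥ r` is at most
`a * lam x s`. -/
def AvgBound [ENorm 𝕜] (μ : Measure X) (lam : X → ℝ → ℝ) (f : X → 𝕜) (x : X) (r a : ℝ) : Prop :=
  ∀ s, r ≤ s → ∫⁻ y in ball x s, ‖f y‖ₑ ∂μ ≤ ENNReal.ofReal (a * lam x s)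

theorem AvgBound.of_le [ENorm 𝕜] {μ : Measure X} {lam : X → ℝ → ℝ} {f : X → 𝕜} {x : X}
    {r r' a : ℝ} (hf : AvgBound μ lam f x r a) (hr : r ≤ r') : AvgBound μ lam f x r' a :=
  fun s hs => hf s (hr.trans hs)

/-- The constant in the bound for the tail integrals. -/
def tailConst (C δ : ℝ) : ℝ := C / (1 - 2 ^ (-δ))

theorem tailConst_nonneg {C δ : ℝ} (hC : 0 ≤ C) (hδ : 0 < δ) : 0 ≤ tailConst C δ := by
  have : (2 : ℝ) ^ (-δ) < 1 := Real.rpow_lt_one_of_one_lt_of_neg one_lt_two (by linarith)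
  exact div_nonneg hC (by linarith)

/-! ### Annular and tail integrals against 1/λ. -/

section Tail

variable {μ : Measure X} {lam : X → ℝ → ℝ} {C : ℝ} [ENorm 𝕜] {f : X → 𝕜} {x : X} {r a : ℝ}

/-- On the annulus 1/λ is at most 1/λ(x,r), while the mass of f is at most a λ(x, 2^n r) ≤ a C^n
λ(x,r), so λ cancels. -/
theorem lintegral_annulus_le [OpensMeasurableSpace X] (h : UpperDoubling μ lam C) (hr : 0 < r)
    (hf : AvgBound μ lam f x r a) (ha : 0 ≤ a) (n : ℕ) {R : ℝ} (hR : R ≤ 2 ^ n * r) :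
    ∫⁻ y in {y | r ≤ dist x y ∧ dist x y < R}, ENNReal.ofReal (1 / lam x (dist x y)) * ‖f y‖ₑ ∂μ
      ≤ ENNReal.ofReal (a * C ^ n) := by
  have hm : MeasurableSet {y | r ≤ dist x y ∧ dist x y < R} :=
    (measurableSet_le measurable_const (continuous_const.dist continuous_id).measurable).inter
      (measurableSet_lt (continuous_const.dist continuous_id).measurable measurable_const)
  have hl := h.pos x hr
  calc _ ≤ ∫⁻ y in {y | r ≤ dist x y ∧ dist x y < R}, ENNReal.ofReal (1 / lam x r) * ‖f y‖ₑ ∂μ := by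
        refine setLIntegral_mono' hm fun y hy => ?_
        gcongr
        exact h.lam_le_lam x hr hy.1
    _ = ENNReal.ofReal (1 / lam x r) * ∫⁻ y in {y | r ≤ dist x y ∧ dist x y < R}, ‖f y‖ₑ ∂μ :=
        lintegral_const_mul' _ _ ENNReal.ofReal_ne_top
    _ ≤ ENNReal.ofReal (1 / lam x r) * ENNReal.ofReal (a * (C ^ n * lam x r)) := by
        gcongr
        calc _ ≤ ∫⁻ y in ball x (2 ^ n * r), ‖f y‖ₑ ∂μ := by
              refine lintegral_mono_set fun y hy => ?_
              rw [mem_ball, dist_comm]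
              exact hy.2.trans_le hR
          _ ≤ _ := hf _ (le_mul_of_one_le_left hr.le (one_le_pow₀ one_le_two))
          _ ≤ _ := by
              gcongr
              exact h.lam_two_pow_mul_le n x hr
    _ = ENNReal.ofReal (a * C ^ n) := by
        rw [← ENNReal.ofReal_mul (by positivity)]
        congr 1
        field_simp

/-- On the j-th dyadic annulus the factor (r/d)^δ is at most 2^{-jδ} and the rest integrates to at
most a C, which leaves a geometric series. -/
theorem lintegral_tail_le [OpensMeasurableSpace X] (h : UpperDoubling μ lam C) (hr : 0 < r)
    (hf : AvgBound μ lam f x r a) (ha : 0 ≤ a) {δ : ℝ} (hδ : 0 < δ) :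
    ∫⁻ y in (ball x r)ᶜ, ENNReal.ofReal ((r / dist x y) ^ δ / lam x (dist x y)) * ‖f y‖ₑ ∂μ
      ≤ ENNReal.ofReal (a * tailConst C δ) := by
  set E : ℕ → Set X := fun j => {y | 2 ^ j * r ≤ dist x y ∧ dist x y < 2 ^ (j + 1) * r} with hE
  have hEm : ∀ j, MeasurableSet (E j) := fun j =>
    (measurableSet_le measurable_const (continuous_const.dist continuous_id).measurable).inter
      (measurableSet_lt (continuous_const.dist continuous_id).measurable measurable_const)
  have hq0 : (0 : ℝ) < 2 ^ (-δ) := by positivity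
  have hq1 : (2 : ℝ) ^ (-δ) < 1 := Real.rpow_lt_one_of_one_lt_of_neg one_lt_two (by linarith)
  have hcover : (ball x r)ᶜ ⊆ ⋃ j, E j := by
    intro y hy
    rw [mem_compl_iff, mem_ball, not_lt, dist_comm] at hy
    obtain ⟨n, hn, hn'⟩ := exists_nat_pow_near ((one_le_div hr).2 hy) one_lt_two
    refine mem_iUnion.2 ⟨n, ?_, ?_⟩
    · rwa [le_div_iff₀ hr] at hn
    · rwa [div_lt_iff₀ hr] at hn'
  have hpiece : ∀ j, ∫⁻ y in E j, ENNReal.ofReal ((r / dist x y) ^ δ / lam x (dist x y)) * ‖f y‖ₑ ∂μ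
      ≤ ENNReal.ofReal (a * C * (2 ^ (-δ)) ^ j) := by
    intro j
    have hrj : 0 < 2 ^ j * r := by positivity
    calc _ ≤ ∫⁻ y in E j, ENNReal.ofReal ((2 ^ (-δ)) ^ j) *
          (ENNReal.ofReal (1 / lam x (dist x y)) * ‖f y‖ₑ) ∂μ := by
          refine setLIntegral_mono' (hEm j) fun y hy => ?_
          rw [← mul_assoc, ← ENNReal.ofReal_mul (by positivity)]
          have hd : 0 < dist x y := hrj.trans_le hy.1
          have hl := h.pos x hd
          gcongr
          rw [mul_one_div]
          gcongr
          have : ((2 : ℝ) ^ (-δ)) ^ j = (1 / 2 ^ j) ^ δ := by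
            rw [one_div, Real.inv_rpow (by positivity), ← Real.rpow_natCast, ← Real.rpow_natCast,
              ← Real.rpow_mul (by norm_num), ← Real.rpow_mul (by norm_num),
              ← Real.rpow_neg (by norm_num)]
            congr 1
            ring
          rw [this]
          refine Real.rpow_le_rpow (by positivity) ?_ hδ.le
          rw [div_le_div_iff₀ hd (by positivity)]
          linarith [hy.1]
      _ = ENNReal.ofReal ((2 ^ (-δ)) ^ j) *
          ∫⁻ y in E j, ENNReal.ofReal (1 / lam x (dist x y)) * ‖f y‖ₑ ∂μ :=
          lintegral_const_mul' _ _ ENNReal.ofReal_ne_top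
      _ ≤ ENNReal.ofReal ((2 ^ (-δ)) ^ j) * ENNReal.ofReal (a * C ^ 1) := by
          gcongr
          refine lintegral_annulus_le h hrj (hf.of_le (le_mul_of_one_le_left hr.le
            (one_le_pow₀ one_le_two))) ha 1 (le_of_eq ?_)
          ring
      _ = _ := by
          rw [← ENNReal.ofReal_mul (by positivity)]
          congr 1
          ring
  have hgeom := (hasSum_geometric_of_lt_one hq0.le hq1).mul_left (a * C)
  have hC := h.C_pos
  calc _ ≤ ∫⁻ y in ⋃ j, E j,
        ENNReal.ofReal ((r / dist x y) ^ δ / lam x (dist x y)) * ‖f y‖ₑ ∂μ :=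
        lintegral_mono_set hcover
    _ ≤ ∑' j, ∫⁻ y in E j,
        ENNReal.ofReal ((r / dist x y) ^ δ / lam x (dist x y)) * ‖f y‖ₑ ∂μ :=
        lintegral_iUnion_le _ _
    _ ≤ ∑' j : ℕ, ENNReal.ofReal (a * C * (2 ^ (-δ)) ^ j) := ENNReal.tsum_le_tsum hpiece
    _ = ENNReal.ofReal (∑' j : ℕ, a * C * (2 ^ (-δ)) ^ j) :=
        (ENNReal.ofReal_tsum_of_nonneg (fun j => by positivity) hgeom.summable).symm
    _ = _ := by
        rw [hgeom.tsum_eq, tailConst]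
        congr 1
        ring

end Tail

/-! ### Square integrability of 1/λ away from the centre. -/

section Square

variable {μ : Measure X} {lam : X → ℝ → ℝ} {C : ℝ}

/-- This is a weak L¹ bound for 1/λ. Inside a large ball the set is bounded, so some y in it has
more than half the supremal distance D to x. The set then lies in the ball of radius 2 d(x,y), of
measure at most λ(x, 2d(x,y)) ≤ C v. -/
theorem UpperDoubling.measure_lam_lt_le (h : UpperDoubling μ lam C) (x : X) {r : ℝ} (hr : 0 < r)
    (v : ℝ) : μ {y | r ≤ dist x y ∧ lam x (dist x y) < v} ≤ ENNReal.ofReal (C * v) := by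
  set E := {y | r ≤ dist x y ∧ lam x (dist x y) < v}
  have hE : E = ⋃ n : ℕ, E ∩ ball x n := by
    rw [← inter_iUnion, iUnion_ball_nat, inter_univ]
  have hmono : Monotone fun n : ℕ => E ∩ ball x n := fun n m hnm =>
    inter_subset_inter_right _ (ball_subset_ball (by exact_mod_cast hnm))
  rw [hE, hmono.measure_iUnion]
  refine iSup_le fun n => ?_
  rcases (E ∩ ball x n).eq_empty_or_nonempty with he | hne
  · simp [he]
  set D := sSup ((fun y => dist x y) '' (E ∩ ball x n)) with hD
  have hbdd : BddAbove ((fun y => dist x y) '' (E ∩ ball x n)) := by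
    refine ⟨n, ?_⟩
    rintro _ ⟨y, hy, rfl⟩
    simpa [dist_comm] using (mem_ball.1 hy.2).le
  have hDpos : 0 < D := by
    obtain ⟨y, hy⟩ := hne
    exact (hr.trans_le hy.1.1).trans_le (le_csSup hbdd ⟨y, hy, rfl⟩)
  obtain ⟨_, ⟨y, hy, rfl⟩, hyD⟩ := exists_lt_of_lt_csSup (hne.image _) (half_lt_self hDpos)
  have hd : 0 < dist x y := hr.trans_le hy.1.1
  calc μ (E ∩ ball x n) ≤ μ (ball x (2 * dist x y)) := by
        refine measure_mono fun z hz => ?_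
        rw [mem_ball, dist_comm]
        have : dist x z ≤ D := le_csSup hbdd ⟨z, hz, rfl⟩
        simp only at hyD
        linarith
    _ ≤ ENNReal.ofReal (lam x (2 * dist x y)) := h.measure_ball_le x (by positivity)
    _ ≤ ENNReal.ofReal (C * v) := by
        refine ENNReal.ofReal_le_ofReal ((h.doubling x hd).trans ?_)
        exact mul_le_mul_of_nonneg_left hy.1.2.le h.C_pos.le

/-- Monotonicity of λ is known only for positive radii; the cut-off at r makes the function monotone
on the whole line, hence Borel. -/
theorem UpperDoubling.measurable_lam_max (h : UpperDoubling μ lam C) [OpensMeasurableSpace X]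
    (x : X) {r : ℝ} (hr : 0 < r) : Measurable fun y => lam x (max r (dist x y)) := by
  have : Monotone fun s => lam x (max r s) := fun s t hst =>
    h.lam_le_lam x (lt_max_of_lt_left hr) (max_le_max_left _ hst)
  exact this.measurable.comp (continuous_const.dist continuous_id).measurable

/-- Layer-cake formula: the distribution function of 1/λ is at most C/t and vanishes for t ≥
1/λ(x,r), so t times it is bounded on a bounded interval. -/
theorem UpperDoubling.lintegral_inv_lam_sq_lt_top (h : UpperDoubling μ lam C)
    [OpensMeasurableSpace X] (x : X) {r : ℝ} (hr : 0 < r) :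
    ∫⁻ y in (ball x r)ᶜ, ENNReal.ofReal ((1 / lam x (dist x y)) ^ (2 : ℝ)) ∂μ < ∞ := by
  have hm : MeasurableSet (ball x r)ᶜ := measurableSet_ball.compl
  have hlr := h.pos x hr
  have e : ∀ y ∈ (ball x r)ᶜ, max r (dist x y) = dist x y := fun y hy => by
    rw [mem_compl_iff, mem_ball, not_lt, dist_comm] at hy
    exact max_eq_right hy
  have hpos : ∀ y, 0 < lam x (max r (dist x y)) := fun y => h.pos x (lt_max_of_lt_left hr)
  calc ∫⁻ y in (ball x r)ᶜ, ENNReal.ofReal ((1 / lam x (dist x y)) ^ (2 : ℝ)) ∂μ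
      = ∫⁻ y in (ball x r)ᶜ, ENNReal.ofReal ((1 / lam x (max r (dist x y))) ^ (2 : ℝ)) ∂μ :=
        setLIntegral_congr_fun hm fun y hy => by simp only [e y hy]
    _ = ENNReal.ofReal 2 * ∫⁻ t in Ioi 0,
        μ.restrict (ball x r)ᶜ {y | t < 1 / lam x (max r (dist x y))} *
          ENNReal.ofReal (t ^ ((2 : ℝ) - 1)) := by
        refine lintegral_rpow_eq_lintegral_meas_lt_mul _ (ae_of_all _ fun y => ?_) ?_ two_pos
        · exact (div_pos one_pos (hpos y)).le
        · exact (measurable_const.div (h.measurable_lam_max x hr)).aemeasurable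
    _ ≤ ENNReal.ofReal 2 * ∫⁻ t in Ioi 0,
        (Iio (1 / lam x r)).indicator (fun _ => ENNReal.ofReal C) t := by
        gcongr ENNReal.ofReal 2 * ?_
        refine setLIntegral_mono' (measurableSet_Ioi : MeasurableSet (Ioi (0 : ℝ))) fun t ht => ?_
        have ht : 0 < t := ht
        rcases lt_or_ge t (1 / lam x r) with htr | htr
        · rw [indicator_of_mem (show t ∈ Iio _ from htr)]
          have : μ.restrict (ball x r)ᶜ {y | t < 1 / lam x (max r (dist x y))}
              ≤ ENNReal.ofReal (C * (1 / t)) := by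
            rw [Measure.restrict_apply' hm]
            refine (measure_mono fun y hy => ?_).trans (h.measure_lam_lt_le x hr _)
            have h1 := hy.1
            rw [mem_ofPred_eq, e y hy.2, lt_one_div ht (e y hy.2 ▸ hpos y)] at h1
            have h2 := hy.2
            rw [mem_compl_iff, mem_ball, not_lt, dist_comm] at h2
            exact ⟨h2, h1⟩
          calc _ ≤ ENNReal.ofReal (C * (1 / t)) * ENNReal.ofReal (t ^ ((2 : ℝ) - 1)) := by gcongr
            _ = ENNReal.ofReal C := by
              rw [← ENNReal.ofReal_mul' (by positivity)]
              norm_num [ht.ne', mul_assoc]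
        · have : {y | t < 1 / lam x (max r (dist x y))} = ∅ := by
            refine eq_empty_of_forall_notMem fun y hy => ?_
            have : 1 / lam x (max r (dist x y)) ≤ 1 / lam x r :=
              one_div_le_one_div_of_le hlr (h.lam_le_lam x hr (le_max_left _ _))
            exact absurd hy (not_lt.2 (this.trans htr))
          rw [this]
          simp
    _ < ∞ := by
        refine ENNReal.mul_lt_top ENNReal.ofReal_lt_top ?_
        have hI : MeasurableSet (Iio (1 / lam x r)) := measurableSet_Iio
        rw [lintegral_indicator_const hI, Measure.restrict_apply hI, inter_comm, Ioi_inter_Iio, Real.volume_Ioo]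
        exact ENNReal.mul_lt_top ENNReal.ofReal_lt_top ENNReal.ofReal_lt_top

end Square

end

section

/-! ### Convergence lemmas -/

theorem tendsto_eLpNorm_sub_of_dominated {α E : Type*} [MeasurableSpace α] {μ : Measure α}
    [NormedAddCommGroup E] {p : ℝ≥0∞} (hp0 : p ≠ 0) (hp : p ≠ ∞) {F : ℕ → α → E} {f : α → E}
    (hF : ∀ n, AEStronglyMeasurable (F n) μ) (hf : MemLp f p μ)
    (hle : ∀ n x, ‖F n x‖ ≤ ‖f x‖) (hlim : ∀ x, Tendsto (fun n => F n x) atTop (𝓝 (f x))) :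
    Tendsto (fun n => eLpNorm (F n - f) p μ) atTop (𝓝 0) := by
  have hp' : 0 < p.toReal := ENNReal.toReal_pos hp0 hp
  have key : Tendsto (fun n => ∫⁻ x, ‖(F n - f) x‖ₑ ^ p.toReal ∂μ) atTop
      (𝓝 (∫⁻ _x, 0 ∂μ)) := by
    refine tendsto_lintegral_of_dominated_convergence'
      (fun x => (2 * ‖f x‖ₑ) ^ p.toReal) (fun n => ?_) (fun n => ?_) ?_ (ae_of_all _ fun x => ?_)
    · exact ((hF n).sub hf.1).enorm.pow_const _
    · refine ae_of_all _ fun x => ENNReal.rpow_le_rpow ?_ hp'.le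
      rw [Pi.sub_apply, two_mul]
      exact (enorm_sub_le).trans (add_le_add_left (enorm_le_iff_norm_le.2 (hle n x)) _)
    · have : ∀ x, (2 * ‖f x‖ₑ) ^ p.toReal = 2 ^ p.toReal * ‖f x‖ₑ ^ p.toReal := fun x =>
        ENNReal.mul_rpow_of_nonneg _ _ hp'.le
      simp_rw [this]
      rw [lintegral_const_mul' _ _ (by simp)]
      exact ENNReal.mul_ne_top (by simp)
        ((eLpNorm_lt_top_iff_lintegral_rpow_enorm_lt_top hp0 hp).1 hf.2).ne
    · have h0 : Tendsto (fun n => ‖(F n - f) x‖ₑ) atTop (𝓝 0) := by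
        have := ((hlim x).sub_const (f x)).enorm
        simpa using this
      simpa [ENNReal.zero_rpow_of_pos hp'] using h0.ennrpow_const p.toReal
  have := key.ennrpow_const (1 / p.toReal)
  simp only [lintegral_zero, ENNReal.zero_rpow_of_pos (one_div_pos.2 hp')] at this
  refine this.congr fun n => ?_
  rw [eLpNorm_eq_lintegral_rpow_enorm_toReal hp0 hp]

theorem exists_subseq_tendsto_ae {α 𝕜 : Type*} [MeasurableSpace α] {μ : Measure α} [RCLike 𝕜]
    (T : Lp 𝕜 2 μ →L[𝕜] Lp 𝕜 2 μ) {F : ℕ → α → 𝕜} {f : α → 𝕜} (hF : ∀ n, MemLp (F n) 2 μ)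
    (hf : MemLp f 2 μ) (hle : ∀ n x, ‖F n x‖ ≤ ‖f x‖)
    (hlim : ∀ x, Tendsto (fun n => F n x) atTop (𝓝 (f x))) :
    ∃ ns : ℕ → ℕ, StrictMono ns ∧
      ∀ᵐ x ∂μ, Tendsto (fun i => T ((hF (ns i)).toLp _) x) atTop (𝓝 (T (hf.toLp f) x)) := by
  have h1 : Tendsto (fun n => (hF n).toLp (F n)) atTop (𝓝 (hf.toLp f)) := by
    rw [Lp.tendsto_Lp_iff_tendsto_eLpNorm'']
    exact tendsto_eLpNorm_sub_of_dominated two_ne_zero ENNReal.ofNat_ne_top (fun n => (hF n).1)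
      hf hle hlim
  exact (tendstoInMeasure_of_tendsto_Lp ((T.continuous.tendsto _).comp h1)).exists_seq_tendsto_ae

/-! ### Kernels -/

variable {X 𝕜 : Type*} [MetricSpace X] [RCLike 𝕜]

/-- Size and smoothness estimates of a Calderón–Zygmund kernel, normalised so that the smoothness
estimate holds for `2 * dist x x' ≤ dist x y`. -/
structure StandardKernel (lam : X → ℝ → ℝ) (K : X → X → 𝕜) (A δ : ℝ) : Prop where
  nonneg : 0 ≤ A
  exponent_pos : 0 < δ
  size : ∀ {x y}, x ≠ y → ‖K x y‖ ≤ A / lam x (dist x y)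
  size_right : ∀ {x y}, x ≠ y → ‖K x y‖ ≤ A / lam y (dist x y)
  smooth : ∀ {x x' y}, x ≠ y → 2 * dist x x' ≤ dist x y →
    ‖K x y - K x' y‖ ≤ A * ((dist x x' / dist x y) ^ δ / lam x (dist x y))
  smooth_right : ∀ {x x' y}, x ≠ y → 2 * dist x x' ≤ dist x y →
    ‖K y x - K y x'‖ ≤ A * ((dist x x' / dist x y) ^ δ / lam x (dist x y))

/-- The left and right estimates trade places, which is why the structure records size and
smoothness in both variables. -/
theorem StandardKernel.swap_star {lam : X → ℝ → ℝ} {K : X → X → 𝕜} {A δ : ℝ}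
    (h : StandardKernel lam K A δ) :
    StandardKernel lam (fun x y => starRingEnd 𝕜 (K y x)) A δ where
  nonneg := h.nonneg
  exponent_pos := h.exponent_pos
  size hxy := by
    rw [RCLike.norm_conj, dist_comm]
    exact h.size_right hxy.symm
  size_right hxy := by
    rw [RCLike.norm_conj, dist_comm]
    exact h.size hxy.symm
  smooth hxy hd := by
    rw [← map_sub, RCLike.norm_conj]
    exact h.smooth_right hxy hd
  smooth_right hxy hd := by
    rw [← map_sub, RCLike.norm_conj]
    exact h.smooth hxy hd

/-- Smoothness in the second variable is a local Hölder bound. It makes every section K(x,·)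
measurable, where joint measurability would only give almost every x. -/
theorem StandardKernel.continuousOn {lam : X → ℝ → ℝ} {K : X → X → 𝕜} {A δ : ℝ}
    (hK : StandardKernel lam K A δ) (x : X) :
    ContinuousOn (K x) {x}ᶜ := by
  intro y hy
  have hyx : y ≠ x := hy
  have hd := dist_pos.2 hyx
  refine ContinuousAt.continuousWithinAt ?_
  rw [ContinuousAt, tendsto_iff_norm_sub_tendsto_zero]
  have hbound : ∀ᶠ z in 𝓝 y, ‖K x z - K x y‖ ≤
      A * ((dist y z / dist y x) ^ δ / lam y (dist y x)) := by
    filter_upwards [ball_mem_nhds y (half_pos hd)] with z hz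
    rw [norm_sub_rev]
    refine hK.smooth_right hyx ?_
    rw [mem_ball, dist_comm] at hz
    linarith
  refine squeeze_zero' (Eventually.of_forall fun z => norm_nonneg _) hbound ?_
  have : Tendsto (fun z => A * ((dist y z / dist y x) ^ δ / lam y (dist y x))) (𝓝 y)
      (𝓝 (A * ((dist y y / dist y x) ^ δ / lam y (dist y x)))) := by
    have h1 : Tendsto (fun z => dist y z / dist y x) (𝓝 y) (𝓝 (dist y y / dist y x)) :=
      ((continuous_const.dist continuous_id).tendsto y).div_const _
    exact ((h1.rpow_const (Or.inr hK.exponent_pos.le)).div_const _).const_mul _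
  simpa [Real.zero_rpow hK.exponent_pos.ne'] using this

variable [MeasurableSpace X]

/-- Beyond the range d(x,x') ≤ c d(x,y), smoothness follows from size: the quotient d(x,x')/d(x,y)
is at least c, and λ at (x', d(x',y)) is comparable to λ at (x, d(x,y)) because d(x',y) ≥ d(x,y)/2.
-/
theorem IsCZKernel.exists_standardKernel {μ : Measure X} {lam : X → ℝ → ℝ} {C : ℝ}
    (hl : UpperDoubling μ lam C) {K : X → X → 𝕜} (hK : IsCZKernel μ lam K) :
    ∃ A δ, StandardKernel lam K A δ := by
  obtain ⟨C₀, h₀⟩ := hK.size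
  obtain ⟨δ, C₁, c, hδ, -, hc, h₁⟩ := hK.smooth
  set A₀ := max C₀ 0
  set A₁ := max C₁ 0
  have hA₀ : 0 ≤ A₀ := le_max_right _ _
  have hA₁ : 0 ≤ A₁ := le_max_right _ _
  have size₁ : ∀ x y, x ≠ y → ‖K x y‖ ≤ A₀ / lam x (dist x y) := fun x y hxy => by
    have p1 := hl.pos x (dist_pos.2 hxy)
    have p2 := hl.pos y (dist_pos.2 hxy)
    calc _ ≤ C₀ * min (1 / lam x (dist x y)) (1 / lam y (dist x y)) := h₀ x y hxy
      _ ≤ A₀ * (1 / lam x (dist x y)) :=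
        mul_le_mul (le_max_left _ _) (min_le_left _ _) (by positivity) hA₀
      _ = _ := mul_one_div _ _
  have size₂ : ∀ x y, x ≠ y → ‖K x y‖ ≤ A₀ / lam y (dist x y) := fun x y hxy => by
    have p1 := hl.pos x (dist_pos.2 hxy)
    have p2 := hl.pos y (dist_pos.2 hxy)
    calc _ ≤ C₀ * min (1 / lam x (dist x y)) (1 / lam y (dist x y)) := h₀ x y hxy
      _ ≤ A₀ * (1 / lam y (dist x y)) :=
        mul_le_mul (le_max_left _ _) (min_le_right _ _) (by positivity) hA₀
      _ = _ := mul_one_div _ _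
  -- The last summand serves the range c d(x,y) < d(x,x') ≤ d(x,y)/2, where the two size bounds are
  -- added.
  set A := A₀ + A₁ + A₀ * (1 + C ^ 2) / c ^ δ with hA
  have hA0' : A₀ ≤ A := by
    have : 0 ≤ A₀ * (1 + C ^ 2) / c ^ δ := by positivity
    linarith
  have hA1' : A₁ ≤ A := by
    have : 0 ≤ A₀ * (1 + C ^ 2) / c ^ δ := by positivity
    linarith
  have hA2' : A₀ * (1 + C ^ 2) / c ^ δ ≤ A := by linarith
  have smooth : ∀ x x' y, x ≠ y → 2 * dist x x' ≤ dist x y →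
      ‖K x y - K x' y‖ ≤ A * ((dist x x' / dist x y) ^ δ / lam x (dist x y)) ∧
      ‖K y x - K y x'‖ ≤ A * ((dist x x' / dist x y) ^ δ / lam x (dist x y)) := by
    intro x x' y hxy hd
    have hd0 := dist_pos.2 hxy
    have p1 := hl.pos x hd0
    have htri := dist_triangle x x' y
    have hd0' : 0 < dist x' y := by linarith
    have hxy' := dist_pos.1 hd0'
    have p2 := hl.pos x' hd0'
    rcases le_or_gt (dist x x') (c * dist x y) with hcase | hcase
    · have := h₁ x x' y hxy hxy' hcase
      have h2 : C₁ * (dist x x' ^ δ / (dist x y ^ δ * lam x (dist x y))) ≤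
          A * ((dist x x' / dist x y) ^ δ / lam x (dist x y)) := by
        rw [Real.div_rpow dist_nonneg dist_nonneg, div_div]
        exact mul_le_mul_of_nonneg_right ((le_max_left _ _).trans hA1') (by positivity)
      constructor
      · linarith [norm_nonneg (K y x - K y x')]
      · linarith [norm_nonneg (K x y - K x' y)]
    · have hlam : lam x (dist x y) ≤ C ^ 2 * lam x' (dist x' y) :=
        hl.lam_le_pow_mul' 1 x x' hd0 hd0' (by linarith) (by linarith)
      have hx' : A₀ / lam x' (dist x' y) ≤ A₀ * C ^ 2 / lam x (dist x y) := by
        rw [div_le_div_iff₀ p2 p1]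
        nlinarith
      have hq : c ^ δ ≤ (dist x x' / dist x y) ^ δ := by
        refine Real.rpow_le_rpow hc.le ?_ hδ.le
        rw [le_div_iff₀ hd0]
        exact hcase.le
      have hfin : A₀ / lam x (dist x y) + A₀ * C ^ 2 / lam x (dist x y) ≤
          A * ((dist x x' / dist x y) ^ δ / lam x (dist x y)) := by
        calc _ = A₀ * (1 + C ^ 2) / c ^ δ * (c ^ δ / lam x (dist x y)) := by
              field_simp
          _ ≤ _ := by gcongr
      constructor
      · calc _ ≤ ‖K x y‖ + ‖K x' y‖ := norm_sub_le _ _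
          _ ≤ _ := (add_le_add (size₁ x y hxy) ((size₁ x' y hxy').trans hx')).trans hfin
      · calc _ ≤ ‖K y x‖ + ‖K y x'‖ := norm_sub_le _ _
          _ ≤ A₀ / lam x (dist x y) + A₀ / lam x' (dist x' y) := by
            have s1 := size₂ y x hxy.symm
            have s2 := size₂ y x' hxy'.symm
            rw [dist_comm] at s1 s2
            exact add_le_add s1 s2
          _ ≤ _ := (add_le_add le_rfl hx').trans hfin
  refine ⟨A, δ, hA₀.trans hA0', hδ, fun {x y} hxy => ?_, fun {x y} hxy => ?_,
    fun {x x' y} hxy hd => (smooth x x' y hxy hd).1,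
    fun {x x' y} hxy hd => (smooth x x' y hxy hd).2⟩
  · have p1 := hl.pos x (dist_pos.2 hxy)
    exact (size₁ x y hxy).trans (by gcongr)
  · have p2 := hl.pos y (dist_pos.2 hxy)
    exact (size₂ x y hxy).trans (by gcongr)

section Kernel

variable {μ : Measure X} {lam : X → ℝ → ℝ} {C A δ : ℝ} {K : X → X → 𝕜}


variable [BorelSpace X]

theorem StandardKernel.aestronglyMeasurable (hK : StandardKernel lam K A δ) (x : X) {s : Set X}
    (hs : MeasurableSet s) (hx : x ∉ s) : AEStronglyMeasurable (K x) (μ.restrict s) :=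
  ((hK.continuousOn x).mono fun y hy => by rintro rfl; exact hx hy).aestronglyMeasurable hs

/-- The size bound reduces this to square integrability of 1/λ. It makes K(x,·) f integrable off a
ball for every f in L², not only for bounded f of bounded support. -/
theorem StandardKernel.memLp_two (hl : UpperDoubling μ lam C) (hK : StandardKernel lam K A δ)
    (x : X) {r : ℝ} (hr : 0 < r) : MemLp (K x) 2 (μ.restrict (ball x r)ᶜ) := by
  refine ⟨hK.aestronglyMeasurable x measurableSet_ball.compl (by simpa using hr), ?_⟩
  rw [eLpNorm_lt_top_iff_lintegral_rpow_enorm_lt_top two_ne_zero ENNReal.ofNat_ne_top]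
  calc _ ≤ ∫⁻ y in (ball x r)ᶜ, ENNReal.ofReal (A ^ (2 : ℝ)) *
        ENNReal.ofReal ((1 / lam x (dist x y)) ^ (2 : ℝ)) ∂μ := by
        refine setLIntegral_mono' measurableSet_ball.compl fun y hy => ?_
        rw [mem_compl_ball_iff] at hy
        have hp := hl.pos x (hr.trans_le hy)
        have hA := hK.nonneg
        rw [← ENNReal.ofReal_mul (by positivity), ← Real.mul_rpow hA (by positivity), mul_one_div,
          ENNReal.toReal_ofNat, ← ofReal_norm, ENNReal.ofReal_rpow_of_nonneg (norm_nonneg _)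
          zero_le_two]
        gcongr
        exact hK.size (dist_pos.1 (hr.trans_le hy))
    _ < ∞ := by
        rw [lintegral_const_mul' _ _ ENNReal.ofReal_ne_top]
        exact ENNReal.mul_lt_top ENNReal.ofReal_lt_top (hl.lintegral_inv_lam_sq_lt_top x hr)

theorem StandardKernel.integrableOn_mul (hl : UpperDoubling μ lam C)
    (hK : StandardKernel lam K A δ) {f : X → 𝕜} (hf : MemLp f 2 μ) (x : X) {r : ℝ} (hr : 0 < r) :
    IntegrableOn (fun y => K x y * f y) (ball x r)ᶜ μ :=
  (hK.memLp_two hl x hr).integrable_mul (hf.restrict _)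

theorem StandardKernel.integrable_mul_of_notMem_tsupport (hl : UpperDoubling μ lam C)
    (hK : StandardKernel lam K A δ) {f : X → 𝕜} (hf : MemLp f 2 μ) {x : X} (hx : x ∉ tsupport f) :
    Integrable (fun y => K x y * f y) μ := by
  obtain ⟨r, hr, hball⟩ := Metric.isOpen_iff.1 (isClosed_tsupport f).isOpen_compl x hx
  refine (hK.integrableOn_mul hl hf x hr).integrable_of_forall_notMem_eq_zero fun y hy => ?_
  rw [mem_compl_iff, not_not] at hy
  rw [image_eq_zero_of_notMem_tsupport (hball hy), mul_zero]

end Kernel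

/-! ### Operators -/

/-- A bounded operator on `L²(μ)` associated with a standard kernel. -/
structure CZOperator (μ : Measure X) (lam : X → ℝ → ℝ) (K : X → X → 𝕜) (A δ : ℝ)
    (T : Lp 𝕜 2 μ →L[𝕜] Lp 𝕜 2 μ) : Prop where
  kernel : StandardKernel lam K A δ
  repr_bounded : ∀ (f : X → 𝕜) (hf : MemLp f 2 μ), MemLp f ∞ μ →
    Bornology.IsBounded (Function.support f) →
      ∀ᵐ x ∂μ, x ∉ tsupport f → T (hf.toLp f) x = ∫ y, K x y * f y ∂μ

section Operator

variable {μ : Measure X} {lam : X → ℝ → ℝ} {C A δ : ℝ} {K : X → X → 𝕜}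
  {T : Lp 𝕜 2 μ →L[𝕜] Lp 𝕜 2 μ} [BorelSpace X]

/-- Truncations of f in height and support converge to f in L², so along a subsequence their images
converge almost everywhere; the kernel integrals converge by domination, since K(x,·) f is
integrable when x is off the support. -/
theorem CZOperator.repr (hl : UpperDoubling μ lam C) (hT : CZOperator μ lam K A δ T)
    {f : X → 𝕜} (hf : MemLp f 2 μ) :
    ∀ᵐ x ∂μ, x ∉ tsupport f → T (hf.toLp f) x = ∫ y, K x y * f y ∂μ := by
  classical
  rcases isEmpty_or_nonempty X with hX | ⟨⟨o⟩⟩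
  · exact ae_of_all _ fun x => isEmptyElim x
  -- The measurable version g only defines the truncation sets. The function cut off is f itself, so
  -- the supports stay inside that of f.
  obtain ⟨g, hgm, hfg⟩ := hf.1
  set S : ℕ → Set X := fun n => {y | ‖g y‖ ≤ n} ∩ ball o n
  have hSm : ∀ n, MeasurableSet (S n) := fun n =>
    (measurableSet_le hgm.norm.measurable measurable_const).inter measurableSet_ball
  have hle : ∀ n x, ‖(S n).indicator f x‖ ≤ ‖f x‖ := fun n x => norm_indicator_le_norm_self _ _
  have hlim : ∀ x, Tendsto (fun n => (S n).indicator f x) atTop (𝓝 (f x)) := by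
    intro x
    obtain ⟨N, hN⟩ := exists_nat_gt (max ‖g x‖ (dist x o))
    refine tendsto_const_nhds.congr' ?_
    filter_upwards [eventually_ge_atTop N] with n hn
    have hn : (N : ℝ) ≤ n := by exact_mod_cast hn
    rw [indicator_of_mem]
    exact ⟨(le_max_left _ _).trans (hN.le.trans hn), ((le_max_right _ _).trans_lt hN).trans_le hn⟩
  have hF : ∀ n, MemLp ((S n).indicator f) 2 μ := fun n => hf.indicator (hSm n)
  have hF' : ∀ n, MemLp ((S n).indicator f) ∞ μ := fun n => by
    refine memLp_top_of_bound (hF n).1 n ?_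
    filter_upwards [hfg] with x hx
    by_cases hxS : x ∈ S n
    · rw [indicator_of_mem hxS, hx]
      exact hxS.1
    · rw [indicator_of_notMem hxS, norm_zero]
      positivity
  have hb : ∀ n, Bornology.IsBounded (Function.support ((S n).indicator f)) := fun n =>
    isBounded_ball.subset ((support_indicator_subset).trans inter_subset_right)
  obtain ⟨ns, hns, hae⟩ := exists_subseq_tendsto_ae T hF hf hle hlim
  filter_upwards [hae, ae_all_iff.2 fun n => hT.repr_bounded _ (hF n) (hF' n) (hb n)]
    with x hx hrepr hxf
  refine tendsto_nhds_unique hx ?_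
  have hsub : ∀ n, x ∉ tsupport ((S n).indicator f) := fun n hx' =>
    hxf (closure_mono (fun y hy => by
      rw [Function.mem_support] at hy ⊢
      exact fun h0 => hy (by rw [indicator_apply, h0, ite_self])) hx')
  simp_rw [hrepr _ (hsub _)]
  have hint := hT.kernel.integrable_mul_of_notMem_tsupport hl hf hxf
  refine Tendsto.comp (y := atTop) (g := fun n => ∫ y, K x y * (S n).indicator f y ∂μ) ?_
    hns.tendsto_atTop
  refine tendsto_integral_of_dominated_convergence _ (fun n => ?_) hint.norm
    (fun n => ae_of_all _ fun y => ?_) (ae_of_all _ fun y => (hlim y).const_mul _)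
  · have : (fun y => K x y * (S n).indicator f y) = (S n).indicator fun y => K x y * f y := by
      ext y
      simp only [indicator_apply, mul_ite, mul_zero]
    rw [this]
    exact (hint.indicator (hSm n)).1
  · rw [norm_mul, norm_mul]
    exact mul_le_mul_of_nonneg_left (hle n y) (norm_nonneg _)

end Operator

end

section

/-! ### The adjoint operator and its kernel. -/

section Adjoint

variable {X 𝕜 : Type*} [MetricSpace X] [RCLike 𝕜] [MeasurableSpace X] [BorelSpace X]
  [SecondCountableTopology X] {μ : Measure X} {lam : X → ℝ → ℝ} {C A δ : ℝ} {K : X → X → 𝕜}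
  {T : Lp 𝕜 2 μ →L[𝕜] Lp 𝕜 2 μ}

omit [BorelSpace X] [SecondCountableTopology X] in
-- All the λ(y, ε) with y in a bounded set are comparable to λ(o, ε) for one fixed point o, so A/λ
-- is uniformly bounded.
theorem StandardKernel.exists_bound_of_separated (hl : UpperDoubling μ lam C)
    (hK : StandardKernel lam K A δ) {V : Set X} (hV : Bornology.IsBounded V) {ε : ℝ} (hε : 0 < ε) :
    ∃ M, ∀ y ∈ V, ∀ x, ε ≤ dist y x → ‖K y x‖ ≤ M := by
  rcases V.eq_empty_or_nonempty with rfl | ⟨o, -⟩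
  · exact ⟨0, by simp⟩
  obtain ⟨R, hR⟩ := (isBounded_iff_subset_closedBall o).1 hV
  obtain ⟨m, hm⟩ := pow_unbounded_of_one_lt (R / ε) one_lt_two
  rw [div_lt_iff₀ hε] at hm
  refine ⟨A * C ^ (m + 1) / lam o ε, fun y hy x hyx => ?_⟩
  have hd : 0 < dist y x := hε.trans_le hyx
  have p1 := hl.pos y hd
  have p2 := hl.pos o hε
  have hC := hl.C_pos
  have hA := hK.nonneg
  refine (hK.size (dist_pos.1 hd)).trans ?_
  have h1 : lam o ε ≤ C ^ (m + 1) * lam y ε := by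
    refine hl.lam_le_pow_mul' m o y hε hε (le_mul_of_one_le_left hε.le
      (one_le_pow₀ one_le_two)) ?_
    rw [dist_comm]
    exact (mem_closedBall.1 (hR hy)).trans hm.le
  have h2 := hl.lam_le_lam y hε hyx
  rw [div_le_div_iff₀ p1 p2, mul_assoc]
  gcongr
  exact h1.trans (by gcongr)

/-- Pair the adjoint with χ_W and move T onto χ_W. On the support of f, which keeps distance ε from
W, T χ_W is given by the kernel. Separation also bounds K on the product, so Fubini applies. -/
theorem CZOperator.setIntegral_adjoint (hl : UpperDoubling μ lam C)
    (hT : CZOperator μ lam K A δ T)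
    (hm : AEStronglyMeasurable (fun p : X × X => K p.1 p.2) ((μ.prod μ).restrict {p | p.1 ≠ p.2}))
    {f : X → 𝕜} (hf : MemLp f 2 μ) (hb : Bornology.IsBounded (Function.support f))
    {W : Set X} (hW : MeasurableSet W) (hWb : Bornology.IsBounded W) {ε : ℝ} (hε : 0 < ε)
    (hWf : W ⊆ (thickening ε (tsupport f))ᶜ) :
    IntegrableOn (fun x => ∫ y, starRingEnd 𝕜 (K y x) * f y ∂μ) W μ ∧
    ∫ x in W, ContinuousLinearMap.adjoint T (hf.toLp f) x ∂μ =
      ∫ x in W, ∫ y, starRingEnd 𝕜 (K y x) * f y ∂μ ∂μ := by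
  have := hl.isLocallyFiniteMeasure
  set V := tsupport f with hV
  have hVm : MeasurableSet V := (isClosed_tsupport f).measurableSet
  have hVb : Bornology.IsBounded V := hb.closure
  have hμV : μ V < ∞ := hl.measure_lt_top_of_isBounded hVb
  have hμW : μ W < ∞ := hl.measure_lt_top_of_isBounded hWb
  have : IsFiniteMeasure (μ.restrict V) := ⟨by simpa using hμV⟩
  have : IsFiniteMeasure (μ.restrict W) := ⟨by simpa using hμW⟩
  have hfV : Integrable f (μ.restrict V) := (hf.restrict V).integrable one_le_two
  have hsep : ∀ x ∈ W, ∀ y ∈ V, ε ≤ dist y x := by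
    intro x hx y hy
    by_contra hlt
    rw [not_le, dist_comm] at hlt
    exact hWf hx (mem_thickening_iff.2 ⟨y, hy, hlt⟩)
  obtain ⟨M, hM⟩ := hT.kernel.exists_bound_of_separated hl hVb hε
  have hprod : Integrable (fun p : X × X => starRingEnd 𝕜 (K p.2 p.1) * f p.2)
      ((μ.restrict W).prod (μ.restrict V)) := by
    have hKm : AEStronglyMeasurable (fun p : X × X => K p.2 p.1)
        ((μ.restrict W).prod (μ.restrict V)) := by
      have h1 : AEStronglyMeasurable (fun p : X × X => K p.1 p.2)
          ((μ.restrict V).prod (μ.restrict W)) := by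
        rw [Measure.prod_restrict]
        -- Separation keeps the product off the diagonal, where joint measurability of K is
        -- available.
        refine hm.mono_measure (Measure.restrict_mono ?_ le_rfl)
        rintro ⟨y, x⟩ ⟨hy, hx⟩ (rfl : y = x)
        simpa using hε.trans_le (hsep _ hx _ hy)
      exact h1.prod_swap
    refine (hfV.comp_snd _).bdd_mul (c := M) ?_ ?_
    · exact RCLike.continuous_conj.comp_aestronglyMeasurable hKm
    · rw [Measure.prod_restrict]
      refine ae_restrict_of_forall_mem (hW.prod hVm) ?_
      rintro ⟨x, y⟩ ⟨hx, hy⟩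
      rw [RCLike.norm_conj]
      exact hM y hy x (hsep x hx y hy)
  have hk : ∀ x, ∫ y, starRingEnd 𝕜 (K y x) * f y ∂μ =
      ∫ y in V, starRingEnd 𝕜 (K y x) * f y ∂μ := fun x =>
    (setIntegral_eq_integral_of_forall_compl_eq_zero fun y hy => by
      rw [image_eq_zero_of_notMem_tsupport hy, mul_zero]).symm
  simp_rw [hk]
  refine ⟨hprod.integral_prod_left, ?_⟩
  have hχ : MemLp (W.indicator fun _ => (1 : 𝕜)) 2 μ := memLp_indicator_const 2 hW 1 (Or.inr hμW.ne)
  have hχtop : MemLp (W.indicator fun _ => (1 : 𝕜)) ∞ μ :=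
    memLp_indicator_const ∞ hW 1 (Or.inr hμW.ne)
  have hχsupp : Function.support (W.indicator fun _ => (1 : 𝕜)) ⊆ W := support_indicator_subset
  have hχt : tsupport (W.indicator fun _ => (1 : 𝕜)) ⊆ (thickening ε V)ᶜ :=
    closure_minimal (hχsupp.trans hWf) isOpen_thickening.isClosed_compl
  have hrepr := hT.repr_bounded _ hχ hχtop (hWb.subset hχsupp)
  calc ∫ x in W, ContinuousLinearMap.adjoint T (hf.toLp f) x ∂μ
      = inner 𝕜 (indicatorConstLp 2 hW hμW.ne (1 : 𝕜))
          (ContinuousLinearMap.adjoint T (hf.toLp f)) := by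
        rw [L2.inner_indicatorConstLp_one]
    _ = inner 𝕜 (T (hχ.toLp _)) (hf.toLp f) := by
        rw [ContinuousLinearMap.adjoint_inner_right]
        rfl
    _ = ∫ y, inner 𝕜 (T (hχ.toLp _) y) (hf.toLp f y) ∂μ := L2.inner_def _ _
    _ = ∫ y, ∫ x in W, starRingEnd 𝕜 (K y x) * f y ∂μ ∂μ := by
        refine integral_congr_ae ?_
        filter_upwards [hrepr, hf.coeFn_toLp] with y hy hfy
        rw [hfy]
        by_cases hyV : y ∈ V
        · have hy' : y ∉ tsupport (W.indicator fun _ => (1 : 𝕜)) := fun h' =>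
            hχt h' (self_subset_thickening hε V hyV)
          rw [hy hy', RCLike.inner_apply, integral_mul_const, mul_comm, integral_conj]
          congr 2
          rw [← integral_indicator hW]
          congr 1 with x
          by_cases hx : x ∈ W <;> simp [hx]
        · rw [image_eq_zero_of_notMem_tsupport hyV]
          simp
    _ = ∫ y in V, ∫ x in W, starRingEnd 𝕜 (K y x) * f y ∂μ ∂μ :=
        (setIntegral_eq_integral_of_forall_compl_eq_zero fun y hy => by
          simp [image_eq_zero_of_notMem_tsupport hy]).symm
    _ = ∫ x in W, ∫ y in V, starRingEnd 𝕜 (K y x) * f y ∂μ ∂μ :=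
        (integral_integral_swap hprod).symm

/-- The bounded sets W n exhaust the complement of the support of f, and on each of them both sides
have the same integral over every measurable subset. -/
theorem CZOperator.adjoint (hl : UpperDoubling μ lam C) (hT : CZOperator μ lam K A δ T)
    (hm : AEStronglyMeasurable (fun p : X × X => K p.1 p.2)
      ((μ.prod μ).restrict {p | p.1 ≠ p.2})) :
    CZOperator μ lam (fun x y => starRingEnd 𝕜 (K y x)) A δ (ContinuousLinearMap.adjoint T) := by
  refine ⟨hT.kernel.swap_star, fun f hf _ hb => ?_⟩
  rcases isEmpty_or_nonempty X with hX | ⟨⟨o⟩⟩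
  · exact ae_of_all _ fun x => isEmptyElim x
  set W : ℕ → Set X := fun n => ball o n ∩ (thickening (1 / ((n : ℝ) + 1)) (tsupport f))ᶜ
  have hWm : ∀ n, MeasurableSet (W n) := fun n =>
    measurableSet_ball.inter isOpen_thickening.measurableSet.compl
  have hWb : ∀ n, Bornology.IsBounded (W n) := fun n => isBounded_ball.subset inter_subset_left
  have hpos : ∀ n : ℕ, 0 < 1 / ((n : ℝ) + 1) := fun n => by positivity
  have key : ∀ n, ∀ᵐ x ∂μ, x ∈ W n → ContinuousLinearMap.adjoint T (hf.toLp f) x =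
      ∫ y, starRingEnd 𝕜 (K y x) * f y ∂μ := by
    intro n
    rw [← ae_restrict_iff' (hWm n)]
    have : IsFiniteMeasure (μ.restrict (W n)) :=
      ⟨by simpa using hl.measure_lt_top_of_isBounded (hWb n)⟩
    refine Integrable.ae_eq_of_forall_setIntegral_eq _ _
      (((Lp.memLp _).restrict _).integrable one_le_two)
      (hT.setIntegral_adjoint hl hm hf hb (hWm n) (hWb n) (hpos n) inter_subset_right).1
      fun s hs _ => ?_
    rw [Measure.restrict_restrict hs]
    exact (hT.setIntegral_adjoint hl hm hf hb (hs.inter (hWm n))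
      ((hWb n).subset inter_subset_right) (hpos n)
      (inter_subset_right.trans inter_subset_right)).2
  filter_upwards [ae_all_iff.2 key] with x hx hxf
  obtain ⟨r, hr, hball⟩ := Metric.isOpen_iff.1 (isClosed_tsupport f).isOpen_compl x hxf
  obtain ⟨n, hn⟩ := exists_nat_gt (max (dist x o) (1 / r))
  refine hx n ⟨(le_max_left _ _).trans_lt hn, fun hmem => ?_⟩
  obtain ⟨z, hz, hxz⟩ := mem_thickening_iff.1 hmem
  refine hball ?_ hz
  rw [mem_ball, dist_comm]
  refine hxz.trans ?_
  have h1 : 1 / r < (n : ℝ) + 1 := ((le_max_right _ _).trans_lt hn).trans (lt_add_one _)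
  rwa [one_div_lt hr (by positivity)] at h1

end Adjoint

end

section

variable {X 𝕜 : Type*} [MetricSpace X] [RCLike 𝕜] [MeasurableSpace X]
  {μ : Measure X} {lam : X → ℝ → ℝ} {C A δ a : ℝ} {K : X → X → 𝕜}

/-! ### Truncated kernels -/

theorem avgBound_of_memLp_top (hl : UpperDoubling μ lam C) {f : X → 𝕜} (hf : MemLp f ∞ μ) (x : X)
    {r : ℝ} (hr : 0 < r) : AvgBound μ lam f x r (eLpNorm f ∞ μ).toReal := by
  intro s hs
  have hne : eLpNorm f ∞ μ ≠ ∞ := hf.2.ne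
  calc ∫⁻ y in ball x s, ‖f y‖ₑ ∂μ ≤ ∫⁻ _y in ball x s, eLpNorm f ∞ μ ∂μ := by
        refine lintegral_mono_ae (ae_restrict_of_ae ?_)
        rw [eLpNorm_exponent_top]
        exact ae_le_eLpNormEssSup
    _ = eLpNorm f ∞ μ * μ (ball x s) := by rw [setLIntegral_const]
    _ ≤ ENNReal.ofReal (eLpNorm f ∞ μ).toReal * ENNReal.ofReal (lam x s) := by
        rw [ENNReal.ofReal_toReal hne]
        gcongr
        exact hl.measure_ball_le x (hr.trans_le hs)
    _ = _ := (ENNReal.ofReal_mul ENNReal.toReal_nonneg).symm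

/-- The function `y ↦ K x y * f y` cut off to the complement of the ball of radius `2 * r`. -/
def cutKernel (K : X → X → 𝕜) (f : X → 𝕜) (x : X) (r : ℝ) : X → 𝕜 :=
  (ball x (2 * r))ᶜ.indicator fun y => K x y * f y

section Cut

variable [BorelSpace X] {f : X → 𝕜} {x x' z : X} {r r' R S : ℝ}

theorem StandardKernel.aestronglyMeasurable_cutKernel (hK : StandardKernel lam K A δ)
    (hf : AEStronglyMeasurable f μ) (x : X) (hr : 0 < r) :
    AEStronglyMeasurable (cutKernel K f x r) μ := by
  rw [cutKernel, aestronglyMeasurable_indicator_iff measurableSet_ball.compl]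
  exact (hK.aestronglyMeasurable x measurableSet_ball.compl (by simpa using hr)).mul hf.restrict

theorem lintegral_ball_cutKernel_le_lintegral
    (hK : StandardKernel lam K A δ) (hr : 0 < r) :
    ∫⁻ y in ball x S, ‖cutKernel K f x r y‖ₑ ∂μ ≤ ENNReal.ofReal A *
      ∫⁻ y in {y | 2 * r ≤ dist x y ∧ dist x y < S},
        ENNReal.ofReal (1 / lam x (dist x y)) * ‖f y‖ₑ ∂μ := by
  have hm : MeasurableSet {y | 2 * r ≤ dist x y ∧ dist x y < S} :=
    (measurableSet_le measurable_const (continuous_const.dist continuous_id).measurable).inter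
      (measurableSet_lt (continuous_const.dist continuous_id).measurable measurable_const)
  rw [← lintegral_const_mul' _ _ ENNReal.ofReal_ne_top, ← lintegral_indicator measurableSet_ball,
    ← lintegral_indicator hm]
  refine lintegral_mono fun y => ?_
  by_cases hy : y ∈ ball x S
  · by_cases hy' : y ∈ (ball x (2 * r))ᶜ
    · rw [indicator_of_mem hy, cutKernel, indicator_of_mem hy', indicator_of_mem]
      · have hd : 0 < dist x y := by
          rw [mem_compl_ball_iff] at hy'
          linarith
        rw [enorm_mul, ← mul_assoc, ← ENNReal.ofReal_mul hK.nonneg, mul_one_div, ← ofReal_norm]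
        gcongr
        exact hK.size (dist_pos.1 hd)
      · rw [mem_ball, dist_comm] at hy
        exact ⟨mem_compl_ball_iff.1 hy', hy⟩
    · rw [indicator_of_mem hy, cutKernel, indicator_of_notMem hy', enorm_zero]
      exact zero_le
  · rw [indicator_of_notMem hy]
    exact zero_le

theorem lintegral_ball_cutKernel_le (hl : UpperDoubling μ lam C)
    (hK : StandardKernel lam K A δ) (hr : 0 < r) (ha : 0 ≤ a) (hf : AvgBound μ lam f x (2 * r) a)
    (n : ℕ) (hS : S ≤ 2 ^ n * (2 * r)) :
    ∫⁻ y in ball x S, ‖cutKernel K f x r y‖ₑ ∂μ ≤ ENNReal.ofReal (A * (a * C ^ n)) := by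
  rw [ENNReal.ofReal_mul hK.nonneg]
  exact (lintegral_ball_cutKernel_le_lintegral hK hr).trans
    (mul_le_mul_right (lintegral_annulus_le hl (by positivity) hf ha n hS) _)

omit [MeasurableSpace X] [BorelSpace X] in
theorem cutKernel_sub_cutKernel (hrR : r ≤ R) (y : X) :
    cutKernel K f x r y - cutKernel K f x R y =
      (ball x (2 * R)).indicator (cutKernel K f x r) y := by
  by_cases hy : y ∈ ball x (2 * R)
  · simp [cutKernel, hy]
  · have : y ∉ ball x (2 * r) := fun h => hy (ball_subset_ball (by linarith) h)
    simp [cutKernel, hy, this]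

theorem lintegral_cutKernel_sub_cutKernel (hrR : r ≤ R) :
    ∫⁻ y, ‖cutKernel K f x r y - cutKernel K f x R y‖ₑ ∂μ =
      ∫⁻ y in ball x (2 * R), ‖cutKernel K f x r y‖ₑ ∂μ := by
  rw [← lintegral_indicator measurableSet_ball]
  refine lintegral_congr fun y => ?_
  rw [cutKernel_sub_cutKernel hrR, enorm_indicator_eq_indicator_enorm]

/-- Off the ball of radius 2r one has d(x,z) ≤ r ≤ d(x,y)/2, so smoothness applies and its bound is
a tail integral. -/
theorem lintegral_kernel_sub_le (hl : UpperDoubling μ lam C) (hK : StandardKernel lam K A δ)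
    (hr : 0 < r) (ha : 0 ≤ a) (hf : AvgBound μ lam f x (2 * r) a) (hz : dist x z ≤ r) :
    ∫⁻ y in (ball x (2 * r))ᶜ, ‖(K z y - K x y) * f y‖ₑ ∂μ ≤
      ENNReal.ofReal (A * (a * tailConst C δ)) := by
  have hr2 : 0 < 2 * r := by positivity
  calc _ ≤ ∫⁻ y in (ball x (2 * r))ᶜ, ENNReal.ofReal A *
        (ENNReal.ofReal ((2 * r / dist x y) ^ δ / lam x (dist x y)) * ‖f y‖ₑ) ∂μ := by
        refine setLIntegral_mono' measurableSet_ball.compl fun y hy => ?_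
        rw [mem_compl_ball_iff] at hy
        have hd : 0 < dist x y := hr2.trans_le hy
        have hp := hl.pos x hd
        have hA := hK.nonneg
        rw [enorm_mul, ← mul_assoc, ← ENNReal.ofReal_mul hA, ← ofReal_norm, norm_sub_rev]
        gcongr
        refine (hK.smooth (dist_pos.1 hd) (by linarith)).trans ?_
        have := hK.exponent_pos.le
        gcongr
        linarith
    _ ≤ _ := by
        rw [lintegral_const_mul' _ _ ENNReal.ofReal_ne_top, ENNReal.ofReal_mul hK.nonneg]
        gcongr
        exact lintegral_tail_le hl hr2 hf ha hK.exponent_pos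

theorem integrableOn_kernel_sub (hl : UpperDoubling μ lam C) (hK : StandardKernel lam K A δ)
    (hr : 0 < r) (ha : 0 ≤ a) (hfm : AEStronglyMeasurable f μ) (hf : AvgBound μ lam f x (2 * r) a)
    (hz : dist x z ≤ r) :
    IntegrableOn (fun y => (K z y - K x y) * f y) (ball x (2 * r))ᶜ μ := by
  refine ⟨?_, (lintegral_kernel_sub_le hl hK hr ha hf hz).trans_lt ENNReal.ofReal_lt_top⟩
  refine AEStronglyMeasurable.mul (AEStronglyMeasurable.sub ?_ ?_) hfm.restrict
  · refine hK.aestronglyMeasurable z measurableSet_ball.compl ?_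
    rw [mem_compl_ball_iff]
    linarith
  · exact hK.aestronglyMeasurable x measurableSet_ball.compl (by simpa using hr)

/-- Beyond 4R smoothness applies. Within 4R the two kernels are bounded separately by size: the
annulus about x costs C, and the one about x', of outer radius 5R ≤ 8R, costs C². -/
theorem lintegral_cutKernel_sub_le_of_dist_le (hl : UpperDoubling μ lam C)
    (hK : StandardKernel lam K A δ) (hR : 0 < R) (ha : 0 ≤ a) (hfm : AEStronglyMeasurable f μ)
    (hf : AvgBound μ lam f x (2 * R) a) (hf' : AvgBound μ lam f x' (2 * R) a)
    (hd : dist x x' ≤ R) :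
    ∫⁻ y, ‖cutKernel K f x R y - cutKernel K f x' R y‖ₑ ∂μ ≤
      ENNReal.ofReal (A * a * (tailConst C δ + C + C ^ 2)) := by
  have hA := hK.nonneg
  have hC := hl.C_pos
  have htc := tailConst_nonneg hC.le hK.exponent_pos
  have hfar : ∫⁻ y in (ball x (2 * (2 * R)))ᶜ, ‖cutKernel K f x R y - cutKernel K f x' R y‖ₑ ∂μ ≤
      ENNReal.ofReal (A * (a * tailConst C δ)) := by
    refine le_trans ?_ (lintegral_kernel_sub_le (z := x') hl hK (by positivity : 0 < 2 * R) ha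
      (hf.of_le (by linarith)) (by linarith))
    refine setLIntegral_mono' measurableSet_ball.compl fun y hy => ?_
    rw [mem_compl_ball_iff] at hy
    have h1 : y ∈ (ball x (2 * R))ᶜ := mem_compl_ball_iff.2 (by linarith)
    have h2 : y ∈ (ball x' (2 * R))ᶜ :=
      mem_compl_ball_iff.2 (by linarith [dist_triangle x x' y])
    rw [cutKernel, cutKernel, indicator_of_mem h1, indicator_of_mem h2, ← sub_mul, enorm_mul,
      enorm_mul, enorm_sub_rev]
  have hnear : ∫⁻ y in ball x (2 * (2 * R)), ‖cutKernel K f x R y - cutKernel K f x' R y‖ₑ ∂μ ≤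
      ENNReal.ofReal (A * (a * C ^ 1)) + ENNReal.ofReal (A * (a * C ^ 2)) := by
    calc _ ≤ ∫⁻ y in ball x (2 * (2 * R)),
          (‖cutKernel K f x R y‖ₑ + ‖cutKernel K f x' R y‖ₑ) ∂μ :=
          lintegral_mono fun y => enorm_sub_le
      _ = ∫⁻ y in ball x (2 * (2 * R)), ‖cutKernel K f x R y‖ₑ ∂μ +
          ∫⁻ y in ball x (2 * (2 * R)), ‖cutKernel K f x' R y‖ₑ ∂μ :=
          lintegral_add_left' (hK.aestronglyMeasurable_cutKernel hfm x hR).restrict.enorm _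
      _ ≤ ∫⁻ y in ball x (2 * (2 * R)), ‖cutKernel K f x R y‖ₑ ∂μ +
          ∫⁻ y in ball x' (5 * R), ‖cutKernel K f x' R y‖ₑ ∂μ := by
          gcongr
          exact ball_subset_ball' (by linarith)
      _ ≤ _ := add_le_add
          (lintegral_ball_cutKernel_le hl hK hR ha hf 1 (by linarith))
          (lintegral_ball_cutKernel_le hl hK hR ha hf' 2 (by linarith))
  rw [← lintegral_add_compl _ (measurableSet_ball (x := x) (ε := 2 * (2 * R)))]
  refine (add_le_add hnear hfar).trans (le_of_eq ?_)
  rw [← ENNReal.ofReal_add (by positivity) (by positivity),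
    ← ENNReal.ofReal_add (by positivity) (by positivity)]
  congr 1
  ring

/-- The difference of the constants attached to two balls in the definition of `T f`. -/
def cutDiff (μ : Measure X) (K : X → X → 𝕜) (f : X → 𝕜) (x : X) (r : ℝ) (x' : X) (r' : ℝ) : 𝕜 :=
  ∫ y, (cutKernel K f x r y - cutKernel K f x' r' y) ∂μ

variable (hl : UpperDoubling μ lam C) (hK : StandardKernel lam K A δ)
  (ha : 0 ≤ a) (hfm : AEStronglyMeasurable f μ) (hf : ∀ x r, 0 < r → AvgBound μ lam f x r a)
include hl hK ha hfm hf

theorem integrable_cutKernel_sub_self (hr : 0 < r) (hr' : 0 < r') :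
    Integrable (fun y => cutKernel K f x r y - cutKernel K f x r' y) μ := by
  wlog hrr : r ≤ r' generalizing r r'
  · have := (this hr' hr (le_of_not_ge hrr)).neg
    refine this.congr (ae_of_all _ fun y => ?_)
    simp
  refine ⟨(hK.aestronglyMeasurable_cutKernel hfm x hr).sub
    (hK.aestronglyMeasurable_cutKernel hfm x hr'), ?_⟩
  rw [HasFiniteIntegral, lintegral_cutKernel_sub_cutKernel hrr]
  obtain ⟨n, hn⟩ := pow_unbounded_of_one_lt (r' / r) one_lt_two
  rw [div_lt_iff₀ hr] at hn
  exact (lintegral_ball_cutKernel_le hl hK hr ha (hf _ _ (by positivity)) n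
    (by linarith)).trans_lt ENNReal.ofReal_lt_top

/-- Neither cut-off kernel need be integrable by itself. The passage goes through a common radius
exceeding d(x,x'): change the radius, then the centre, then the radius again. -/
theorem integrable_cutKernel_sub (hr : 0 < r) (hr' : 0 < r') :
    Integrable (fun y => cutKernel K f x r y - cutKernel K f x' r' y) μ := by
  have hR : 0 < dist x x' + 1 := by positivity
  have h1 := integrable_cutKernel_sub_self (x := x) hl hK ha hfm hf hr hR
  have h2 := integrable_cutKernel_sub_self (x := x') hl hK ha hfm hf hR hr'
  have h3 : Integrable (fun y => cutKernel K f x (dist x x' + 1) y -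
      cutKernel K f x' (dist x x' + 1) y) μ :=
    ⟨(hK.aestronglyMeasurable_cutKernel hfm x hR).sub
      (hK.aestronglyMeasurable_cutKernel hfm x' hR),
      (lintegral_cutKernel_sub_le_of_dist_le hl hK hR ha hfm (hf _ _ (by positivity))
        (hf _ _ (by positivity)) (by linarith)).trans_lt ENNReal.ofReal_lt_top⟩
  refine ((h1.add h3).add h2).congr (ae_of_all _ fun y => ?_)
  simp

/-- The integrands telescope. This cocycle identity makes the constants attached to different balls
mutually consistent. -/
theorem cutDiff_add {x'' : X} {r'' : ℝ} (hr : 0 < r) (hr' : 0 < r') (hr'' : 0 < r'') :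
    cutDiff μ K f x r x' r' + cutDiff μ K f x' r' x'' r'' = cutDiff μ K f x r x'' r'' := by
  rw [cutDiff, cutDiff, ← integral_add (integrable_cutKernel_sub hl hK ha hfm hf hr hr')
    (integrable_cutKernel_sub hl hK ha hfm hf hr' hr''), cutDiff]
  simp

end Cut

/-! ### Control of the constants by K_{B,Q}. -/

section CoeffK

variable [BorelSpace X] {x : X} {r R : ℝ}

/-- The integrand is bounded by 1/λ(x,r) on a set of finite measure, so the Bochner integral in
`coeffK` is genuine and not the default value 0. -/
theorem lintegral_inv_lam_eq_coeffK (hl : UpperDoubling μ lam C) (hr : 0 < r) :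
    ∫⁻ y in {y | r ≤ dist y x ∧ dist y x ≤ R}, ENNReal.ofReal (1 / lam x (dist y x)) ∂μ =
      ENNReal.ofReal (coeffK μ lam x r R - 1) ∧ 1 ≤ coeffK μ lam x r R := by
  have hm : MeasurableSet {y | r ≤ dist y x ∧ dist y x ≤ R} :=
    (measurableSet_le measurable_const (continuous_id.dist continuous_const).measurable).inter
      (measurableSet_le (continuous_id.dist continuous_const).measurable measurable_const)
  have hpos : ∀ y ∈ {y | r ≤ dist y x ∧ dist y x ≤ R}, 0 ≤ 1 / lam x (dist y x) := fun y hy =>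
    one_div_nonneg.2 (hl.pos x (hr.trans_le hy.1)).le
  have hint : IntegrableOn (fun y => 1 / lam x (dist y x)) {y | r ≤ dist y x ∧ dist y x ≤ R} μ := by
    have h1 : IntegrableOn (fun y => 1 / lam x (max r (dist x y)))
        {y | r ≤ dist y x ∧ dist y x ≤ R} μ := by
      refine IntegrableOn.of_bound ?_
        (measurable_const.div (hl.measurable_lam_max x hr)).aestronglyMeasurable (1 / lam x r)
        (ae_of_all _ fun y => ?_)
      · exact hl.measure_lt_top_of_isBounded (isBounded_closedBall.subset fun y hy => hy.2)
      · have h0 := hl.pos x hr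
        have h2 := hl.lam_le_lam x hr (le_max_left r (dist x y))
        rw [Real.norm_of_nonneg (one_div_pos.2 (hl.pos x (lt_max_of_lt_left hr))).le]
        exact one_div_le_one_div_of_le h0 h2
    refine h1.congr_fun (fun y hy => ?_) hm
    simp only
    rw [dist_comm x y, max_eq_right hy.1]
  constructor
  · rw [coeffK, add_sub_cancel_left,
      ofReal_integral_eq_lintegral_ofReal hint (ae_restrict_of_forall_mem hm hpos)]
  · rw [coeffK, le_add_iff_nonneg_right]
    exact setIntegral_nonneg hm hpos

variable {f : X → 𝕜} {x' : X} {r' : ℝ}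

/-- First the radius changes from r to r' at the centre x: the size bound integrates to `coeffK`
minus 1 up to distance r', and to a multiple of C on the remaining annulus up to 2r'. Then the
centre moves to x' at radius r', at bounded cost. -/
theorem norm_cutDiff_le (hl : UpperDoubling μ lam C) (hK : StandardKernel lam K A δ)
    (hf : MemLp f ∞ μ) (hr : 0 < r) (hr' : 0 < r') (hsub : ball x r ⊆ ball x' r') :
    ‖cutDiff μ K f x r x' r'‖ ≤
      A * (1 + 2 * C + C ^ 2 + tailConst C δ) * (eLpNorm f ∞ μ).toReal * coeffK μ lam x r r' := by
  set a := (eLpNorm f ∞ μ).toReal with ha_def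
  have ha : 0 ≤ a := ENNReal.toReal_nonneg
  have hA := hK.nonneg
  have hC := hl.C_pos
  have htc := tailConst_nonneg hC.le hK.exponent_pos
  have hav : ∀ x r, 0 < r → AvgBound μ lam f x r a := fun x r hr => avgBound_of_memLp_top hl hf x hr
  obtain ⟨hco, hco1⟩ := lintegral_inv_lam_eq_coeffK (R := r') (x := x) hl hr
  have hd : dist x x' ≤ r' := (mem_ball.1 (hsub (mem_ball_self hr))).le
  have hsame : ‖cutDiff μ K f x r x r'‖ ≤ A * a * (coeffK μ lam x r r' + C) := by
    have henn : ∫⁻ y, ‖cutKernel K f x r y - cutKernel K f x r' y‖ₑ ∂μ ≤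
        ENNReal.ofReal (A * a * (coeffK μ lam x r r' + C)) := by
      rcases le_or_gt r r' with hrr | hrr
      · rw [lintegral_cutKernel_sub_cutKernel hrr]
        refine (lintegral_ball_cutKernel_le_lintegral hK hr).trans ?_
        have h1 : ∫⁻ y in {y | r ≤ dist y x ∧ dist y x ≤ r'},
            ENNReal.ofReal (1 / lam x (dist x y)) * ‖f y‖ₑ ∂μ ≤
            ENNReal.ofReal (coeffK μ lam x r r' - 1) * ENNReal.ofReal a := by
          rw [← hco, ← lintegral_mul_const' _ _ ENNReal.ofReal_ne_top]
          refine lintegral_mono_ae (ae_restrict_of_ae ?_)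
          filter_upwards [ae_le_eLpNormEssSup (f := f) (μ := μ)] with y hy
          rw [dist_comm x y, ha_def, ENNReal.ofReal_toReal hf.2.ne, eLpNorm_exponent_top]
          gcongr
        have h2 := lintegral_annulus_le hl hr' (hav x r' hr') ha 1 (R := 2 * r') (by simp)
        calc _ ≤ ENNReal.ofReal A * (∫⁻ y in {y | r ≤ dist y x ∧ dist y x ≤ r'} ∪
              {y | r' ≤ dist x y ∧ dist x y < 2 * r'},
              ENNReal.ofReal (1 / lam x (dist x y)) * ‖f y‖ₑ ∂μ) := by
              gcongr
              rintro y ⟨hy1, hy2⟩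
              rcases le_or_gt (dist x y) r' with h | h
              · exact Or.inl ⟨by rw [dist_comm]; linarith, by rwa [dist_comm]⟩
              · exact Or.inr ⟨h.le, hy2⟩
          _ ≤ ENNReal.ofReal A * (ENNReal.ofReal (coeffK μ lam x r r' - 1) * ENNReal.ofReal a +
              ENNReal.ofReal (a * C ^ 1)) := by
              gcongr
              exact (lintegral_union_le _ _ _).trans (add_le_add h1 h2)
          _ = ENNReal.ofReal (A * ((coeffK μ lam x r r' - 1) * a + a * C ^ 1)) := by
              have : 0 ≤ coeffK μ lam x r r' - 1 := by linarith
              rw [← ENNReal.ofReal_mul this, ← ENNReal.ofReal_add (by positivity) (by positivity),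
                ← ENNReal.ofReal_mul hA]
          _ ≤ _ := by
              refine ENNReal.ofReal_le_ofReal ?_
              rw [mul_assoc A a]
              gcongr
              rw [pow_one, mul_add, mul_comm _ a]
              gcongr
              linarith
      -- An inclusion of balls does not force r ≤ r'. When r' < r, a point of B(x,r) lies in
      -- B(x',r') and so within 2r' of x; only the annulus from r to 2r contributes.
      · simp_rw [enorm_sub_rev (cutKernel K f x r _)]
        rw [lintegral_cutKernel_sub_cutKernel hrr.le]
        refine (lintegral_ball_cutKernel_le_lintegral hK hr').trans ?_
        have h2 := lintegral_annulus_le hl hr (hav x r hr) ha 1 (R := 2 * r) (by simp)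
        calc _ ≤ ENNReal.ofReal A * ∫⁻ y in {y | r ≤ dist x y ∧ dist x y < 2 * r},
              ENNReal.ofReal (1 / lam x (dist x y)) * ‖f y‖ₑ ∂μ := by
              refine mul_le_mul_right (lintegral_mono_set ?_) _
              rintro y ⟨hy1, hy2⟩
              refine ⟨not_lt.1 fun hlt => ?_, hy2⟩
              have : y ∈ ball x' r' := hsub (by rwa [mem_ball, dist_comm])
              rw [mem_ball, dist_comm] at this
              have hd' : dist x x' < r' := mem_ball.1 (hsub (mem_ball_self hr))
              linarith [dist_triangle x x' y]
          _ ≤ ENNReal.ofReal A * ENNReal.ofReal (a * C ^ 1) := by gcongr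
          _ = ENNReal.ofReal (A * (a * C ^ 1)) := (ENNReal.ofReal_mul hA).symm
          _ ≤ _ := by
              refine ENNReal.ofReal_le_ofReal ?_
              rw [mul_assoc A a, pow_one]
              gcongr
              linarith
    refine (norm_integral_le_lintegral_norm _).trans ?_
    refine ENNReal.toReal_le_of_le_ofReal (by positivity) ?_
    simpa only [ofReal_norm] using henn
  have hother : ‖cutDiff μ K f x r' x' r'‖ ≤ A * a * (tailConst C δ + C + C ^ 2) := by
    refine (norm_integral_le_lintegral_norm _).trans ?_
    refine ENNReal.toReal_le_of_le_ofReal (by positivity) ?_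
    simpa only [ofReal_norm] using lintegral_cutKernel_sub_le_of_dist_le hl hK hr' ha hf.1
      (hav x _ (by positivity)) (hav x' _ (by positivity)) hd
  rw [← cutDiff_add hl hK ha hf.1 hav hr hr' hr']
  refine (norm_add_le _ _).trans ((add_le_add hsame hother).trans ?_)
  have h3 : C + (tailConst C δ + C + C ^ 2) ≤
      (2 * C + C ^ 2 + tailConst C δ) * coeffK μ lam x r r' := by
    calc _ = (2 * C + C ^ 2 + tailConst C δ) * 1 := by ring
      _ ≤ _ := by gcongr
  calc _ = A * a * (coeffK μ lam x r r' + (C + (tailConst C δ + C + C ^ 2))) := by ring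
    _ ≤ A * a * (coeffK μ lam x r r' +
        (2 * C + C ^ 2 + tailConst C δ) * coeffK μ lam x r r') := by gcongr
    _ = _ := by ring

end CoeffK

end

section

theorem eLpNorm_clm_le {α 𝕜 : Type*} [RCLike 𝕜] [MeasurableSpace α] {μ : Measure α}
    (T : Lp 𝕜 2 μ →L[𝕜] Lp 𝕜 2 μ) (u : Lp 𝕜 2 μ) :
    eLpNorm (T u) 2 μ ≤ ENNReal.ofReal ‖T‖ * eLpNorm u 2 μ := by
  have := ENNReal.ofReal_le_ofReal (T.le_opNorm u)
  rwa [ENNReal.ofReal_mul (norm_nonneg _), Lp.norm_def, Lp.norm_def,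
    ENNReal.ofReal_toReal (Lp.eLpNorm_ne_top _), ENNReal.ofReal_toReal (Lp.eLpNorm_ne_top _)]
    at this

variable {X 𝕜 : Type*} [MetricSpace X] [RCLike 𝕜] [MeasurableSpace X] [BorelSpace X]
  {μ : Measure X} {lam : X → ℝ → ℝ} {C A δ a : ℝ} {K : X → X → 𝕜}
  {T : Lp 𝕜 2 μ →L[𝕜] Lp 𝕜 2 μ} {f : X → 𝕜}

/-! ### Representatives of `T f` -/

theorem memLp_indicator_ball (hl : UpperDoubling μ lam C) (hf : MemLp f ∞ μ) (x : X) (r : ℝ) :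
    MemLp ((ball x r).indicator f) 2 μ := by
  have : IsFiniteMeasure (μ.restrict (ball x r)) := ⟨by simpa using hl.measure_ball_lt_top x r⟩
  exact (memLp_indicator_iff_restrict measurableSet_ball).2
    ((hf.restrict (ball x r)).mono_exponent le_top)

/-- The function representing `T f`, up to an additive constant, on the ball `ball x r`. -/
def localRepr (K : X → X → 𝕜) (T : Lp 𝕜 2 μ →L[𝕜] Lp 𝕜 2 μ) (hl : UpperDoubling μ lam C)
    (hf : MemLp f ∞ μ) (x : X) (r : ℝ) (z : X) : 𝕜 :=
  T ((memLp_indicator_ball hl hf x (2 * r)).toLp _) z +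
    ∫ y in (ball x (2 * r))ᶜ, (K z y - K x y) * f y ∂μ

/-- The two functions fed to T coincide with f near z, so their difference vanishes there and T of
it is a kernel integral at z. Its z-dependent part cancels the two tail integrals. -/
theorem CZOperator.localRepr_sub_localRepr (hl : UpperDoubling μ lam C)
    (hT : CZOperator μ lam K A δ T) (hf : MemLp f ∞ μ) {x x' : X} {r r' : ℝ} (hr : 0 < r)
    (hr' : 0 < r') :
    ∀ᵐ z ∂μ, z ∈ ball x r → z ∈ ball x' r' →
      localRepr K T hl hf x r z + cutDiff μ K f x r x' r' = localRepr K T hl hf x' r' z := by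
  have ha : 0 ≤ (eLpNorm f ∞ μ).toReal := ENNReal.toReal_nonneg
  have hav : ∀ x r, 0 < r → AvgBound μ lam f x r (eLpNorm f ∞ μ).toReal := fun x r hr =>
    avgBound_of_memLp_top hl hf x hr
  have hB := memLp_indicator_ball hl hf x (2 * r)
  have hQ := memLp_indicator_ball hl hf x' (2 * r')
  have hsub : T ((hQ.sub hB).toLp _) =ᵐ[μ] T (hQ.toLp _) - T (hB.toLp _) := by
    rw [MemLp.toLp_sub hQ hB, map_sub]
    exact Lp.coeFn_sub _ _
  filter_upwards [hT.repr hl (hQ.sub hB), hsub] with z hrepr hsub hz hz'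
  have hzt : z ∉ tsupport ((ball x' (2 * r')).indicator f - (ball x (2 * r)).indicator f) := by
    rw [notMem_tsupport_iff_eventuallyEq]
    filter_upwards [isOpen_ball.mem_nhds (ball_subset_ball (by linarith : r ≤ 2 * r) hz),
      isOpen_ball.mem_nhds (ball_subset_ball (by linarith : r' ≤ 2 * r') hz')] with w hw hw'
    simp [hw, hw']
  have e1 := hrepr hzt
  rw [hsub, Pi.sub_apply] at e1
  have hzx : dist x z ≤ r := by rw [dist_comm]; exact (mem_ball.1 hz).le
  have hzx' : dist x' z ≤ r' := by rw [dist_comm]; exact (mem_ball.1 hz').le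
  have i1 := (integrable_indicator_iff measurableSet_ball.compl).2 (integrableOn_kernel_sub hl
    hT.kernel hr ha hf.1 (hav x _ (by positivity)) hzx)
  have i2 := (integrable_indicator_iff measurableSet_ball.compl).2 (integrableOn_kernel_sub hl
    hT.kernel hr' ha hf.1 (hav x' _ (by positivity)) hzx')
  have i3 := integrable_cutKernel_sub (x := x) (x' := x') hl hT.kernel ha hf.1 hav hr hr'
  have e2 : ∫ y, K z y * ((ball x' (2 * r')).indicator f - (ball x (2 * r)).indicator f) y ∂μ =
      ∫ y in (ball x (2 * r))ᶜ, (K z y - K x y) * f y ∂μ -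
        ∫ y in (ball x' (2 * r'))ᶜ, (K z y - K x' y) * f y ∂μ + cutDiff μ K f x r x' r' := by
    rw [← integral_indicator measurableSet_ball.compl, ← integral_indicator measurableSet_ball.compl,
      cutDiff, ← integral_sub i1 i2]
    refine Eq.trans ?_ (integral_add (i1.sub i2) i3)
    refine integral_congr_ae (ae_of_all _ fun y => ?_)
    by_cases hy : y ∈ ball x (2 * r) <;> by_cases hy' : y ∈ ball x' (2 * r') <;>
      simp [cutKernel, hy, hy'] <;> ring
  rw [e2] at e1
  rw [localRepr, localRepr]
  linear_combination -e1

/-- The integrability clause is automatic for f in L^∞, and the element F of L² is determined by f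
and the ball. -/
theorem representsModConst_iff (hl : UpperDoubling μ lam C) (hK : StandardKernel lam K A δ)
    (hf : MemLp f ∞ μ) {g : X → 𝕜} :
    RepresentsModConst K T f g ↔ ∀ x r, 0 < r → ∃ c, ∀ᵐ z ∂μ, z ∈ ball x r →
      g z = localRepr K T hl hf x r z + c := by
  constructor
  · intro h x r hr
    obtain ⟨-, F, hF, c, hc⟩ := h x r hr
    have hF' : F = (memLp_indicator_ball hl hf x (2 * r)).toLp _ :=
      Lp.ext (hF.trans (MemLp.coeFn_toLp _).symm)
    rw [hF'] at hc
    exact ⟨c, hc⟩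
  · intro h x r hr
    obtain ⟨c, hc⟩ := h x r hr
    refine ⟨fun z hz => ?_, (memLp_indicator_ball hl hf x (2 * r)).toLp _, MemLp.coeFn_toLp _, c,
      hc⟩
    exact integrableOn_kernel_sub hl hK hr ENNReal.toReal_nonneg hf.1
      (avgBound_of_memLp_top hl hf x (by positivity)) (by rw [dist_comm]; exact (mem_ball.1 hz).le)

theorem CZOperator.exists_represents (hl : UpperDoubling μ lam C) (hT : CZOperator μ lam K A δ T)
    (hf : MemLp f ∞ μ) : ∃ g, RepresentsModConst K T f g := by
  simp_rw [representsModConst_iff hl hT.kernel hf]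
  rcases isEmpty_or_nonempty X with hX | ⟨⟨o⟩⟩
  · exact ⟨0, fun x => isEmptyElim x⟩
  have ha : 0 ≤ (eLpNorm f ∞ μ).toReal := ENNReal.toReal_nonneg
  have hav : ∀ x r, 0 < r → AvgBound μ lam f x r (eLpNorm f ∞ μ).toReal := fun x r hr =>
    avgBound_of_memLp_top hl hf x hr
  -- At z the smallest ball of positive integer radius about o containing z is used; adding
  -- `cutDiff` to the unit ball normalises all these choices consistently.
  refine ⟨fun z => localRepr K T hl hf o (⌊dist z o⌋₊ + 1) z +
    cutDiff μ K f o (⌊dist z o⌋₊ + 1) o 1, fun x r hr => ⟨cutDiff μ K f x r o 1, ?_⟩⟩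
  have hae : ∀ n : ℕ, _ := fun n => hT.localRepr_sub_localRepr hl hf (x := x) (x' := o) hr
    (r' := (n : ℝ) + 1) (by positivity)
  filter_upwards [ae_all_iff.2 hae] with z hz hzx
  have h1 := hz ⌊dist z o⌋₊ hzx (mem_ball.2 (Nat.lt_floor_add_one _))
  have h2 := cutDiff_add hl hT.kernel ha hf.1 hav (x := x) (x' := o) (x'' := o) hr
    (r' := (⌊dist z o⌋₊ : ℝ) + 1) (by positivity) one_pos
  rw [← h1, ← h2]
  ring

/-- On a null ball the constant of the definition is arbitrary. So one non-null ball is fixed and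
the constants of all others are defined from it by `cutDiff`; on non-null balls they agree with the
given ones, by comparison inside a larger ball. If no ball about o has positive measure, every ball
is null. -/
theorem CZOperator.exists_const_of_represents (hl : UpperDoubling μ lam C)
    (hT : CZOperator μ lam K A δ T) (hf : MemLp f ∞ μ) {g : X → 𝕜}
    (hg : RepresentsModConst K T f g) :
    ∃ m : X → ℝ → 𝕜, (∀ x r, 0 < r → ∀ᵐ z ∂μ, z ∈ ball x r →
      g z = localRepr K T hl hf x r z + m x r) ∧
      ∀ x r x' r', 0 < r → 0 < r' → m x r - m x' r' = cutDiff μ K f x r x' r' := by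
  rw [representsModConst_iff hl hT.kernel hf] at hg
  rcases isEmpty_or_nonempty X with hX | ⟨⟨o⟩⟩
  · exact ⟨0, fun x => isEmptyElim x, fun x => isEmptyElim x⟩
  have ha : 0 ≤ (eLpNorm f ∞ μ).toReal := ENNReal.toReal_nonneg
  have hav : ∀ x r, 0 < r → AvgBound μ lam f x r (eLpNorm f ∞ μ).toReal := fun x r hr =>
    avgBound_of_memLp_top hl hf x hr
  have hdiff : ∀ {b : 𝕜} {R : ℝ} x r x' r', 0 < r → 0 < r' → 0 < R →
      b + cutDiff μ K f x r o R - (b + cutDiff μ K f x' r' o R) = cutDiff μ K f x r x' r' := by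
    intro b R x r x' r' hr hr' hR
    have := cutDiff_add hl hT.kernel ha hf.1 hav (x := x) (x' := x') (x'' := o) hr hr' hR
    rw [← this]
    ring
  by_cases h0 : ∃ R, 0 < R ∧ μ (ball o R) ≠ 0
  · obtain ⟨R, hR, hμR⟩ := h0
    have hc : ∀ x r, ∃ c, 0 < r → ∀ᵐ z ∂μ, z ∈ ball x r →
        g z = localRepr K T hl hf x r z + c := fun x r => by
      by_cases hr : 0 < r
      · obtain ⟨c, hc⟩ := hg x r hr
        exact ⟨c, fun _ => hc⟩
      · exact ⟨0, fun h => absurd h hr⟩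
    choose c hc using hc
    have hcc : ∀ x r x' r', 0 < r → 0 < r' → ball x r ⊆ ball x' r' → μ (ball x r) ≠ 0 →
        c x r = c x' r' + cutDiff μ K f x r x' r' := by
      intro x r x' r' hr hr' hsub hne
      obtain ⟨z, hz, h1, h2, h3⟩ := ((frequently_ae_mem_iff.2 hne).and_eventually
        ((hc x r hr).and ((hc x' r' hr').and
          (hT.localRepr_sub_localRepr hl hf (x := x) (x' := x') hr hr')))).exists
      have h1 := h1 hz
      have h2 := h2 (hsub hz)
      have h3 := h3 hz (hsub hz)
      linear_combination h2 - h1 - h3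
    refine ⟨fun x r => c o R + cutDiff μ K f x r o R, fun x r hr => ?_,
      fun x r x' r' hr hr' => hdiff x r x' r' hr hr' hR⟩
    by_cases hne : μ (ball x r) = 0
    · filter_upwards [measure_eq_zero_iff_ae_notMem.1 hne] with z hz hz'
      exact absurd hz' hz
    have hR1 : 0 < R + r + dist x o := by positivity
    have e1 := hcc x r o (R + r + dist x o) hr hR1 (ball_subset_ball' (by linarith)) hne
    have e2 := hcc o R o (R + r + dist x o) hR hR1
      (ball_subset_ball (by linarith [dist_nonneg (x := x) (y := o)])) hμR
    have e3 := cutDiff_add hl hT.kernel ha hf.1 hav (x := x) (x' := o) (x'' := o) hr hR hR1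
    filter_upwards [hc x r hr] with z hz hzx
    rw [hz hzx, e1, e2, ← e3]
    ring
  · push Not at h0
    refine ⟨fun x r => 0 + cutDiff μ K f x r o 1, fun x r hr => ?_,
      fun x r x' r' hr hr' => hdiff x r x' r' hr hr' one_pos⟩
    have : μ (ball x r) = 0 := measure_mono_null (ball_subset_ball' le_rfl)
      (h0 (r + dist x o) (by positivity))
    filter_upwards [measure_eq_zero_iff_ae_notMem.1 this] with z hz hz'
    exact absurd hz' hz

/-- The part of f outside the larger ball has support away from the smaller one, so the kernel
formula applies to it. -/
theorem CZOperator.ae_eq_add_integral (hl : UpperDoubling μ lam C) (hT : CZOperator μ lam K A δ T)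
    (hf : MemLp f 2 μ) (x : X) {r R : ℝ} (hrR : r < R) :
    ∀ᵐ z ∂μ, z ∈ ball x r → T (hf.toLp f) z =
      T ((hf.indicator (measurableSet_ball (x := x) (ε := R))).toLp _) z +
        ∫ y in (ball x R)ᶜ, K z y * f y ∂μ := by
  have h1 : MemLp ((ball x R).indicator f) 2 μ := hf.indicator measurableSet_ball
  have h2 : MemLp ((ball x R)ᶜ.indicator f) 2 μ := hf.indicator measurableSet_ball.compl
  have hsum : hf.toLp f = h1.toLp _ + h2.toLp _ := by
    rw [← MemLp.toLp_add]
    congr 1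
    exact (indicator_self_add_compl _ _).symm
  have hadd : T (hf.toLp f) =ᵐ[μ] T (h1.toLp _) + T (h2.toLp _) := by
    rw [hsum, map_add]
    exact Lp.coeFn_add _ _
  filter_upwards [hadd, hT.repr hl h2] with z hz hrepr hzx
  rw [hz, Pi.add_apply, hrepr, ← integral_indicator measurableSet_ball.compl]
  · congr 2 with y
    by_cases hy : y ∈ ball x R <;> simp [hy]
  · rw [notMem_tsupport_iff_eventuallyEq]
    filter_upwards [isOpen_ball.mem_nhds (ball_subset_ball hrR.le hzx)] with w hw
    simp [hw]

/-- For f in L² the integral of K(x,·) f off 2B converges; it is the constant separating the kernel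
integral from its regularised form. -/
theorem CZOperator.represents_toLp (hl : UpperDoubling μ lam C) (hT : CZOperator μ lam K A δ T)
    (hf2 : MemLp f 2 μ) (hf : MemLp f ∞ μ) : RepresentsModConst K T f (T (hf2.toLp f)) := by
  rw [representsModConst_iff hl hT.kernel hf]
  intro x r hr
  refine ⟨∫ y in (ball x (2 * r))ᶜ, K x y * f y ∂μ, ?_⟩
  filter_upwards [hT.ae_eq_add_integral hl hf2 x (by linarith : r < 2 * r)] with z hz hzx
  have hzx' : dist x z ≤ r := by rw [dist_comm]; exact (mem_ball.1 hzx).le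
  rw [hz hzx, localRepr, add_assoc, ← integral_add
    (integrableOn_kernel_sub hl hT.kernel hr ENNReal.toReal_nonneg hf.1
      (avgBound_of_memLp_top hl hf x (by positivity)) hzx')
    (hT.kernel.integrableOn_mul hl hf2 x (by positivity))]
  congr 2 with y
  ring

/-! ### The `RBMO` bound -/

/-- Cauchy–Schwarz on the small ball and the L² bound of T each produce a square root of the measure
of the large ball. -/
theorem CZOperator.lintegral_ball_clm_indicator_le (hl : UpperDoubling μ lam C)
    (T : Lp 𝕜 2 μ →L[𝕜] Lp 𝕜 2 μ) (hf : MemLp f ∞ μ) (x : X) {r s : ℝ} (hrs : r ≤ s) :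
    ∫⁻ z in ball x r, ‖T ((memLp_indicator_ball hl hf x s).toLp _) z‖ₑ ∂μ ≤
      ENNReal.ofReal (‖T‖ * (eLpNorm f ∞ μ).toReal) * μ (ball x s) := by
  set a := (eLpNorm f ∞ μ).toReal with ha
  have hF := memLp_indicator_ball hl hf x s
  have h1 : eLpNorm ((ball x s).indicator f) 2 μ ≤ μ (ball x s) ^ (1 / 2 : ℝ) * ENNReal.ofReal a := by
    rw [eLpNorm_indicator_eq_eLpNorm_restrict measurableSet_ball]
    refine (eLpNorm_le_of_ae_bound (C := a) (ae_restrict_of_ae ?_)).trans (le_of_eq ?_)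
    · filter_upwards [ae_le_eLpNormEssSup (f := f) (μ := μ)] with y hy
      rw [← eLpNorm_exponent_top] at hy
      rw [ha, ← toReal_enorm]
      exact ENNReal.toReal_mono hf.2.ne hy
    · simp
  calc _ = eLpNorm (T (hF.toLp _)) 1 (μ.restrict (ball x r)) := eLpNorm_one_eq_lintegral_enorm.symm
    _ ≤ eLpNorm (T (hF.toLp _)) 2 (μ.restrict (ball x r)) *
        μ.restrict (ball x r) univ ^ (1 / (1 : ℝ≥0∞).toReal - 1 / (2 : ℝ≥0∞).toReal) :=
        eLpNorm_le_eLpNorm_mul_rpow_measure_univ one_le_two (Lp.aestronglyMeasurable _).restrict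
    _ ≤ (ENNReal.ofReal ‖T‖ * (μ (ball x s) ^ (1 / 2 : ℝ) * ENNReal.ofReal a)) *
        μ (ball x s) ^ (1 / 2 : ℝ) := by
        rw [Measure.restrict_apply_univ]
        have : (1 / (1 : ℝ≥0∞).toReal - 1 / (2 : ℝ≥0∞).toReal) = (1 / 2 : ℝ) := by norm_num
        rw [this]
        gcongr
        refine (eLpNorm_restrict_le _ _ _ _).trans ((eLpNorm_clm_le T _).trans ?_)
        gcongr
        exact (eLpNorm_congr_ae hF.coeFn_toLp).le.trans h1
    _ = _ := by
        have : μ (ball x s) = μ (ball x s) ^ (1 / 2 : ℝ) * μ (ball x s) ^ (1 / 2 : ℝ) := by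
          rw [← ENNReal.rpow_add_of_nonneg _ _ (by norm_num) (by norm_num)]
          norm_num
        rw [ENNReal.ofReal_mul (norm_nonneg _)]
        conv_rhs => rw [this]
        ring

/-- For z in B and y in 2B ∖ σB one has (σ-1)r ≤ d(z,y) < 3r: no singularity is met, and about n
doublings of the radius suffice. -/
theorem CZOperator.ae_norm_clm_indicator_annulus_le (hl : UpperDoubling μ lam C)
    (hT : CZOperator μ lam K A δ T) (hf : MemLp f ∞ μ) (x : X) {r σ : ℝ} (hr : 0 < r) (hσ : 1 < σ)
    {n : ℕ} (hn : 3 ≤ 2 ^ n * (σ - 1)) :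
    ∀ᵐ z ∂μ, z ∈ ball x r →
      ‖T ((((memLp_indicator_ball hl hf x (2 * r)).indicator
        (measurableSet_ball (x := x) (ε := σ * r)).compl)).toLp _) z‖ ≤
        A * ((eLpNorm f ∞ μ).toReal * C ^ n) := by
  have hh := (memLp_indicator_ball hl hf x (2 * r)).indicator
    (measurableSet_ball (x := x) (ε := σ * r)).compl
  have hA := hT.kernel.nonneg
  have hC := hl.C_pos
  filter_upwards [hT.repr hl hh] with z hz hzx
  have hσr : 0 < (σ - 1) * r := mul_pos (by linarith) hr
  rw [hz]
  · refine (norm_integral_le_lintegral_norm _).trans ?_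
    refine ENNReal.toReal_le_of_le_ofReal (by positivity) ?_
    simp_rw [ofReal_norm]
    have hm : MeasurableSet {y | (σ - 1) * r ≤ dist z y ∧ dist z y < 3 * r} :=
      (measurableSet_le measurable_const (continuous_const.dist continuous_id).measurable).inter
        (measurableSet_lt (continuous_const.dist continuous_id).measurable measurable_const)
    have hann := lintegral_annulus_le hl hσr (avgBound_of_memLp_top hl hf z hσr)
      ENNReal.toReal_nonneg n (R := 3 * r) (by nlinarith)
    rw [ENNReal.ofReal_mul hA]
    refine le_trans ?_ (mul_le_mul_right hann _)
    rw [← lintegral_const_mul' _ _ ENNReal.ofReal_ne_top, ← lintegral_indicator hm]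
    refine lintegral_mono fun y => ?_
    rw [enorm_mul]
    by_cases hy1 : y ∈ (ball x (σ * r))ᶜ
    · by_cases hy2 : y ∈ ball x (2 * r)
      · rw [indicator_of_mem hy1, indicator_of_mem hy2]
        rw [mem_compl_ball_iff] at hy1
        rw [mem_ball, dist_comm] at hy2
        have hzx' := mem_ball.1 hzx
        have t1 := dist_triangle x z y
        have t2 := dist_triangle z x y
        rw [dist_comm x z] at t1
        have hd : (σ - 1) * r ≤ dist z y := by linarith
        rw [indicator_of_mem (show y ∈ {y | (σ - 1) * r ≤ dist z y ∧ dist z y < 3 * r} from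
          ⟨hd, by linarith⟩), ← mul_assoc, ← ENNReal.ofReal_mul hA, mul_one_div, ← ofReal_norm (K z y)]
        gcongr
        exact hT.kernel.size (dist_pos.1 (hσr.trans_le hd))
      · rw [indicator_of_mem hy1, indicator_of_notMem hy2]
        simp
    · simp [indicator_of_notMem hy1]
  · rw [notMem_tsupport_iff_eventuallyEq]
    filter_upwards [isOpen_ball.mem_nhds
      (ball_subset_ball (by nlinarith : r ≤ σ * r) hzx)] with w hw
    simp [hw]

/-- Applying the L² bound to all of f χ_{2B} would give μ(2B), too large when ρ < 2. So it is used
only on σB; the annulus 2B ∖ σB and the tail are bounded pointwise on B. -/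
theorem CZOperator.lintegral_ball_localRepr_le (hl : UpperDoubling μ lam C)
    (hT : CZOperator μ lam K A δ T) (hf : MemLp f ∞ μ) (x : X) {r σ : ℝ} (hr : 0 < r) (hσ : 1 < σ)
    (hσ2 : σ ≤ 2) {n : ℕ} (hn : 3 ≤ 2 ^ n * (σ - 1)) :
    ∫⁻ z in ball x r, ‖localRepr K T hl hf x r z‖ₑ ∂μ ≤
      ENNReal.ofReal ((‖T‖ + A * C ^ n + A * tailConst C δ) * (eLpNorm f ∞ μ).toReal) *
        μ (ball x (σ * r)) := by
  set a := (eLpNorm f ∞ μ).toReal with ha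
  have ha0 : 0 ≤ a := ENNReal.toReal_nonneg
  have hA := hT.kernel.nonneg
  have hC := hl.C_pos
  have htc := tailConst_nonneg hC.le hT.kernel.exponent_pos
  have hB := memLp_indicator_ball hl hf x (2 * r)
  have h1 := memLp_indicator_ball hl hf x (σ * r)
  have h2 := hB.indicator (measurableSet_ball (x := x) (ε := σ * r)).compl
  have hsplit : T (hB.toLp _) =ᵐ[μ] T (h1.toLp _) + T (h2.toLp _) := by
    have : hB.toLp _ = h1.toLp _ + h2.toLp _ := by
      rw [← MemLp.toLp_add]
      congr 1
      have hss : ball x (σ * r) ⊆ ball x (2 * r) := ball_subset_ball (by nlinarith)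
      conv_lhs => rw [← indicator_self_add_compl (ball x (σ * r)) ((ball x (2 * r)).indicator f),
        indicator_indicator (ball x (σ * r)) (ball x (2 * r)), inter_eq_left.2 hss]
    rw [this, map_add]
    exact Lp.coeFn_add _ _
  have hpt : ∀ᵐ z ∂μ.restrict (ball x r), ‖localRepr K T hl hf x r z‖ₑ ≤
      ‖T (h1.toLp _) z‖ₑ + ENNReal.ofReal (A * (a * C ^ n) + A * (a * tailConst C δ)) := by
    rw [ae_restrict_iff' measurableSet_ball]
    filter_upwards [hsplit, hT.ae_norm_clm_indicator_annulus_le hl hf x hr hσ hn] with z hz hz2 hzx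
    rw [localRepr, hz, Pi.add_apply, add_assoc]
    refine (enorm_add_le _ _).trans (add_le_add le_rfl ((enorm_add_le _ _).trans ?_))
    rw [ENNReal.ofReal_add (by positivity) (by positivity)]
    refine add_le_add ?_ ?_
    · rw [← ofReal_norm]
      exact ENNReal.ofReal_le_ofReal (hz2 hzx)
    · exact (enorm_integral_le_lintegral_enorm _).trans (lintegral_kernel_sub_le hl hT.kernel hr ha0
        (avgBound_of_memLp_top hl hf x (by positivity))
        (by rw [dist_comm]; exact (mem_ball.1 hzx).le))
  calc _ ≤ ∫⁻ z in ball x r, (‖T (h1.toLp _) z‖ₑ +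
        ENNReal.ofReal (A * (a * C ^ n) + A * (a * tailConst C δ))) ∂μ := lintegral_mono_ae hpt
    _ = ∫⁻ z in ball x r, ‖T (h1.toLp _) z‖ₑ ∂μ +
        ENNReal.ofReal (A * (a * C ^ n) + A * (a * tailConst C δ)) * μ (ball x r) := by
        rw [lintegral_add_right _ measurable_const, setLIntegral_const]
    _ ≤ ENNReal.ofReal (‖T‖ * a) * μ (ball x (σ * r)) +
        ENNReal.ofReal (A * (a * C ^ n) + A * (a * tailConst C δ)) * μ (ball x (σ * r)) := by
        have hrs : r ≤ σ * r := by nlinarith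
        gcongr
        exact CZOperator.lintegral_ball_clm_indicator_le hl T hf x hrs
    _ = _ := by
        rw [← add_mul, ← ENNReal.ofReal_add (by positivity) (by positivity)]
        congr 2
        ring

variable [SecondCountableTopology X]

/-- Measurability of the tail in z comes from joint measurability of K on the product of B and the
complement of 2B, which misses the diagonal. -/
theorem CZOperator.aestronglyMeasurable_localRepr (hl : UpperDoubling μ lam C)
    (hK : StandardKernel lam K A δ)
    (hm : AEStronglyMeasurable (fun p : X × X => K p.1 p.2) ((μ.prod μ).restrict {p | p.1 ≠ p.2}))
    (hf : MemLp f ∞ μ) (x : X) {r : ℝ} (hr : 0 < r) :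
    AEStronglyMeasurable (localRepr K T hl hf x r) (μ.restrict (ball x r)) := by
  have := hl.isLocallyFiniteMeasure
  refine (Lp.aestronglyMeasurable _).restrict.add ?_
  have h1 : AEStronglyMeasurable (fun p : X × X => (K p.1 p.2 - K x p.2) * f p.2)
      ((μ.restrict (ball x r)).prod (μ.restrict (ball x (2 * r))ᶜ)) := by
    refine AEStronglyMeasurable.mul (AEStronglyMeasurable.sub ?_ ?_) hf.1.restrict.comp_snd
    · rw [Measure.prod_restrict]
      refine hm.mono_measure (Measure.restrict_mono ?_ le_rfl)
      rintro ⟨y, z⟩ ⟨hy, hz⟩ (rfl : y = z)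
      exact hz (ball_subset_ball (by linarith) hy)
    · exact (hK.aestronglyMeasurable x measurableSet_ball.compl (by simpa using hr)).comp_snd
  exact h1.integral_prod_right'

theorem CZOperator.memRBMO_and_rbmoNorm_le (hl : UpperDoubling μ lam C)
    (hT : CZOperator μ lam K A δ T)
    (hm : AEStronglyMeasurable (fun p : X × X => K p.1 p.2) ((μ.prod μ).restrict {p | p.1 ≠ p.2}))
    {ρ : ℝ} (hρ : 1 < ρ) :
    ∃ c, 0 ≤ c ∧ ∀ f : X → 𝕜, MemLp f ∞ μ → ∀ g, RepresentsModConst K T f g →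
      MemRBMO μ lam ρ g ∧ rbmoNorm μ lam ρ g ≤ c * (eLpNorm f ∞ μ).toReal := by
  have hA := hT.kernel.nonneg
  have hC := hl.C_pos
  have htc := tailConst_nonneg hC.le hT.kernel.exponent_pos
  -- σ ≤ ρ keeps the final bound within μ(ρB), and σ ≤ 2 keeps σB inside 2B.
  set σ := min ρ 2 with hσ_def
  have hσ : 1 < σ := lt_min hρ one_lt_two
  obtain ⟨n, hn⟩ := pow_unbounded_of_one_lt (3 / (σ - 1)) one_lt_two
  rw [div_lt_iff₀ (by linarith)] at hn
  set c₁ := ‖T‖ + A * C ^ n + A * tailConst C δ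
  set c₂ := A * (1 + 2 * C + C ^ 2 + tailConst C δ)
  have hc₁ : 0 ≤ c₁ := by positivity
  have hc₂ : 0 ≤ c₂ := by positivity
  refine ⟨c₁ + c₂, by positivity, fun f hf g hg => ?_⟩
  set a := (eLpNorm f ∞ μ).toReal
  obtain ⟨m, hgm, hmd⟩ := hT.exists_const_of_represents hl hf hg
  have hsub : ∀ x r, 0 < r → (fun z => g z - m x r) =ᵐ[μ.restrict (ball x r)]
      localRepr K T hl hf x r := fun x r hr => by
    rw [EventuallyEq, ae_restrict_iff' measurableSet_ball]
    filter_upwards [hgm x r hr] with z hz hzx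
    rw [hz hzx, add_sub_cancel_right]
  have hlint : ∀ x r, 0 < r → ∫⁻ z in ball x r, ‖g z - m x r‖ₑ ∂μ ≤
      ENNReal.ofReal (c₁ * a) * μ (ball x (σ * r)) := fun x r hr => by
    refine le_trans (le_of_eq ?_) (hT.lintegral_ball_localRepr_le hl hf x hr hσ (min_le_right _ _)
      hn.le)
    exact lintegral_congr_ae ((hsub x r hr).mono fun z hz => by simp only [hz])
  have hint : ∀ x r, 0 < r → IntegrableOn (fun z => g z - m x r) (ball x r) μ := fun x r hr =>
    ⟨(CZOperator.aestronglyMeasurable_localRepr hl hT.kernel hm hf x hr).congr (hsub x r hr).symm,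
      (hlint x r hr).trans_lt (ENNReal.mul_lt_top ENNReal.ofReal_lt_top
        (hl.measure_ball_lt_top x _))⟩
  have hbound : RBMOBound μ lam ρ g ((c₁ + c₂) * a) := by
    refine ⟨m, fun x r hr => ?_, fun x r x' r' hr hr' hss => ?_⟩
    · rw [integral_norm_eq_lintegral_enorm (hint x r hr).1]
      have hle : σ * r ≤ ρ * r := by
        have := min_le_left ρ 2
        gcongr
      have h1 := ENNReal.toReal_mono (ENNReal.mul_ne_top ENNReal.ofReal_ne_top
        (hl.measure_ball_lt_top x (ρ * r)).ne) ((hlint x r hr).trans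
          (mul_le_mul_right (measure_mono (ball_subset_ball hle)) _))
      rw [ENNReal.toReal_mul, ENNReal.toReal_ofReal (by positivity)] at h1
      refine h1.trans ?_
      rw [measureReal_def]
      gcongr
      linarith
    · rw [hmd x r x' r' hr hr']
      refine (norm_cutDiff_le hl hT.kernel hf hr hr' hss).trans ?_
      have := (lintegral_inv_lam_eq_coeffK (R := r') (x := x) hl hr).2
      gcongr
      linarith
  refine ⟨⟨fun x r => ?_, _, by positivity, hbound⟩, ?_⟩
  · rcases le_or_gt r 0 with hr | hr
    · simp [ball_eq_empty.2 hr]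
    · have h1 : IntegrableOn (fun _ => m x r) (ball x r) μ :=
        integrableOn_const (hl.measure_ball_lt_top x r).ne
      refine ((hint x r hr).add h1).congr (ae_of_all _ fun z => ?_)
      simp
  · exact csInf_le ⟨0, fun A hA => hA.1⟩ ⟨by positivity, hbound⟩

end

section

variable {X : Type*} [MetricSpace X]

/-! ### A maximal set -/

/-- Vitali's lemma enlarges closed balls by 5, and 8 leaves room for open balls. The same 8 occurs
in `maxSet`, and the scale ratio 128 equals 8 · 16. -/
theorem exists_disjoint_subfamily_ball [SecondCountableTopology X] (t : Set (X × ℝ)) {R : ℝ}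
    (ht : ∀ p ∈ t, 0 < p.2 ∧ p.2 ≤ R) :
    ∃ u ⊆ t, u.Countable ∧ (u.PairwiseDisjoint fun p => ball p.1 p.2) ∧
      ⋃ p ∈ t, ball p.1 p.2 ⊆ ⋃ p ∈ u, ball p.1 (8 * p.2) := by
  obtain ⟨u, hut, hdisj, hcov⟩ := Vitali.exists_disjoint_subfamily_covering_enlargement_closedBall
    t Prod.fst Prod.snd R (fun p hp => (ht p hp).2) 5 (by norm_num)
  have hd : u.PairwiseDisjoint fun p : X × ℝ => ball p.1 p.2 :=
    hdisj.mono fun p => ball_subset_closedBall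
  refine ⟨u, hut, hd.countable_of_isOpen (fun _ _ => isOpen_ball) fun p hp =>
    ⟨p.1, mem_ball_self (ht p (hut hp)).1⟩, hd, iUnion₂_subset fun p hp => ?_⟩
  obtain ⟨q, hq, hpq⟩ := hcov p hp
  refine (ball_subset_closedBall.trans hpq).trans
    ((closedBall_subset_ball ?_).trans (subset_biUnion_of_mem (u := fun p => ball p.1 (8 * p.2)) hq))
  linarith [(ht q (hut hq)).1]

variable [MeasurableSpace X] {μ : Measure X}

/-- The set where the maximal function `sup_{B ∋ x} (∫_B f) / μ(8 B)` exceeds `s`. -/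
def maxSet (μ : Measure X) (f : X → ℝ≥0∞) (s : ℝ≥0∞) : Set X :=
  ⋃ p ∈ {p : X × ℝ | 0 < p.2 ∧ s * μ (ball p.1 (8 * p.2)) < ∫⁻ y in ball p.1 p.2, f y ∂μ},
    ball p.1 p.2

theorem lintegral_ball_le_of_notMem_maxSet {f : X → ℝ≥0∞} {s : ℝ≥0∞} {x : X}
    (hx : x ∉ maxSet μ f s) {r : ℝ} (hr : 0 < r) :
    ∫⁻ y in ball x r, f y ∂μ ≤ s * μ (ball x (8 * r)) := by
  by_contra h
  exact hx (mem_biUnion (show (x, r) ∈ {p : X × ℝ | 0 < p.2 ∧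
    s * μ (ball p.1 (8 * p.2)) < ∫⁻ y in ball p.1 p.2, f y ∂μ} from ⟨hr, not_le.1 h⟩)
    (mem_ball_self hr))

/-- With μ(8B) as the denominator, the enlarged Vitali balls are exactly those controlled by the
integrals over disjoint balls, so no doubling of μ is needed. Radii are first capped by n, as
Vitali's lemma requires. -/
theorem mul_measure_maxSet_le [SecondCountableTopology X] [OpensMeasurableSpace X]
    (f : X → ℝ≥0∞) (s : ℝ≥0∞) : s * μ (maxSet μ f s) ≤ ∫⁻ y, f y ∂μ := by
  set t : ℕ → Set (X × ℝ) := fun n => {p | (0 < p.2 ∧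
    s * μ (ball p.1 (8 * p.2)) < ∫⁻ y in ball p.1 p.2, f y ∂μ) ∧ p.2 ≤ n}
  have hmono : Monotone fun n => ⋃ p ∈ t n, ball p.1 p.2 := fun n m hnm =>
    biUnion_subset_biUnion_left fun p hp => ⟨hp.1, hp.2.trans (by exact_mod_cast hnm)⟩
  have hU : maxSet μ f s = ⋃ n, ⋃ p ∈ t n, ball p.1 p.2 := by
    refine subset_antisymm (iUnion₂_subset fun p hp => ?_)
      (iUnion_subset fun n => biUnion_subset_biUnion_left fun p hp => hp.1)
    obtain ⟨n, hn⟩ := exists_nat_ge p.2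
    exact subset_iUnion_of_subset n
      (subset_biUnion_of_mem (u := fun p : X × ℝ => ball p.1 p.2) ⟨hp, hn⟩)
  rw [hU, hmono.measure_iUnion, ENNReal.mul_iSup]
  refine iSup_le fun n => ?_
  obtain ⟨u, hut, huc, hd, hcov⟩ := exists_disjoint_subfamily_ball (t n) (R := n)
    fun p hp => ⟨hp.1.1, hp.2⟩
  have := huc.to_subtype
  calc s * μ (⋃ p ∈ t n, ball p.1 p.2) ≤ s * ∑' p : u, μ (ball p.1.1 (8 * p.1.2)) := by
        gcongr
        exact (measure_mono hcov).trans (measure_biUnion_le μ huc _)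
    _ = ∑' p : u, s * μ (ball p.1.1 (8 * p.1.2)) := ENNReal.tsum_mul_left.symm
    _ ≤ ∑' p : u, ∫⁻ y in ball p.1.1 p.1.2, f y ∂μ :=
        ENNReal.tsum_le_tsum fun p => (hut p.2).1.2.le
    _ = ∫⁻ y in ⋃ p ∈ u, ball p.1 p.2, f y ∂μ :=
        (lintegral_biUnion huc (fun _ _ => measurableSet_ball) hd f).symm
    _ ≤ ∫⁻ y, f y ∂μ := setLIntegral_le_lintegral _ _

/-- Where f ≤ s it contributes at most s μ(B) ≤ s μ(8B) to the integral over B, so at level 2s the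
part of f above s must supply the rest. -/
theorem mul_measure_maxSet_two_mul_le [SecondCountableTopology X] [OpensMeasurableSpace X]
    (f : X → ℝ≥0∞) (s : ℝ≥0∞) :
    s * μ (maxSet μ f (2 * s)) ≤ ∫⁻ y, {y | s < f y}.indicator f y ∂μ := by
  refine le_trans ?_ (mul_measure_maxSet_le ({y | s < f y}.indicator f) s)
  gcongr
  refine biUnion_subset_biUnion_left ?_
  rintro ⟨x, r⟩ ⟨hr, h⟩
  refine ⟨hr, ?_⟩
  simp only at hr h ⊢
  have hle : ∫⁻ y in ball x r, f y ∂μ ≤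
      s * μ (ball x (8 * r)) + ∫⁻ y in ball x r, {y | s < f y}.indicator f y ∂μ := by
    calc _ ≤ ∫⁻ y in ball x r, (s + {y | s < f y}.indicator f y) ∂μ := by
          refine lintegral_mono fun y => ?_
          by_cases hy : s < f y
          · rw [indicator_of_mem (show y ∈ {y | s < f y} from hy)]
            exact le_add_self
          · exact (not_lt.1 hy).trans le_self_add
      _ = s * μ (ball x r) + ∫⁻ y in ball x r, {y | s < f y}.indicator f y ∂μ := by
          rw [lintegral_add_left measurable_const, setLIntegral_const]
      _ ≤ _ := by
          gcongr
          linarith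
  have := h.trans_le hle
  rw [mul_assoc, two_mul] at this
  exact lt_of_add_lt_add_left this

/-! ### Doubling balls -/

theorem measureReal_ball_lt_of_not_doubling {β : ℝ} (hβ : 0 ≤ β) {x : X} {j : ℤ} {n : ℕ}
    (h : ∀ i : ℕ, i < n → β * μ.real (ball x (128 ^ (j + i))) < μ.real (ball x (128 ^ (j + i + 1)))) :
    β ^ n * μ.real (ball x (128 ^ j)) ≤ μ.real (ball x (128 ^ (j + n))) := by
  induction n with
  | zero => simp
  | succ n ih =>
    calc β ^ (n + 1) * μ.real (ball x (128 ^ j)) = β * (β ^ n * μ.real (ball x (128 ^ j))) := by ring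
      _ ≤ β * μ.real (ball x (128 ^ (j + n))) :=
        mul_le_mul_of_nonneg_left (ih fun i hi => h i (hi.trans n.lt_succ_self)) hβ
      _ ≤ μ.real (ball x (128 ^ (j + n + 1))) := (h n n.lt_succ_self).le
      _ = _ := by
        push_cast
        rw [add_assoc]

theorem UpperDoubling.lam_zpow_le {lam : X → ℝ → ℝ} {C : ℝ} (hl : UpperDoubling μ lam C) (x : X)
    (j : ℤ) (n : ℕ) : lam x (128 ^ (j + n)) ≤ C ^ (7 * n) * lam x (128 ^ j) := by
  refine hl.lam_le_pow_mul _ x (by positivity) (by positivity) (le_of_eq ?_)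
  rw [zpow_add₀ (by norm_num), zpow_natCast, pow_mul, mul_comm]
  norm_num

theorem UpperDoubling.measureReal_ball_le {lam : X → ℝ → ℝ} {C : ℝ} (hl : UpperDoubling μ lam C)
    (x : X) {r : ℝ} (hr : 0 < r) : μ.real (ball x r) ≤ lam x r :=
  ENNReal.toReal_le_of_le_ofReal (hl.pos x hr).le (hl.measure_ball_le x hr)

/-- If doubling failed at every scale, the measures would grow at least like (2C^7)^n, while λ grows
at most like C^{7n} because 128 = 2^7. -/
theorem UpperDoubling.exists_first_doubling {lam : X → ℝ → ℝ} {C β : ℝ}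
    (hl : UpperDoubling μ lam C) (hβ : 2 * C ^ 7 ≤ β) {x : X} {j : ℤ}
    (hj : 0 < μ.real (ball x (128 ^ j))) :
    ∃ n : ℕ, μ.real (ball x (128 ^ (j + n + 1))) ≤ β * μ.real (ball x (128 ^ (j + n))) ∧
      ∀ i : ℕ, i < n →
        β * μ.real (ball x (128 ^ (j + i))) < μ.real (ball x (128 ^ (j + i + 1))) := by
  classical
  have hC := hl.C_pos
  have hex : ∃ n : ℕ, μ.real (ball x (128 ^ (j + n + 1))) ≤ β * μ.real (ball x (128 ^ (j + n))) := by
    by_contra! hcon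
    obtain ⟨n, hn⟩ := pow_unbounded_of_one_lt (lam x (128 ^ j) / μ.real (ball x (128 ^ j)))
      one_lt_two
    rw [div_lt_iff₀ hj] at hn
    have h1 := measureReal_ball_lt_of_not_doubling (β := β) (n := n)
      ((by positivity : 0 ≤ 2 * C ^ 7).trans hβ) fun i _ => hcon i
    have h2 := (hl.measureReal_ball_le x (by positivity)).trans (hl.lam_zpow_le x j n)
    have h3 : (2 * C ^ 7) ^ n * μ.real (ball x (128 ^ j)) ≤ C ^ (7 * n) * lam x (128 ^ j) :=
      (mul_le_mul_of_nonneg_right (pow_le_pow_left₀ (by positivity) hβ n) hj.le).trans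
        (h1.trans h2)
    rw [mul_pow, ← pow_mul, mul_comm (2 ^ n), mul_assoc] at h3
    exact absurd (le_of_mul_le_mul_left h3 (by positivity)) (not_le.2 hn)
  exact ⟨Nat.find hex, Nat.find_spec hex, fun i hi => not_le.1 (Nat.find_min hex hi)⟩

/-- At a bad point the measure of the ball of radius 128^{j₀-k} is at most β^{-k} V. A bounded set
is covered by N^{M+7k} balls of comparable size, so the bad set has measure at most N^M V (N^7/β)^k
≤ N^M V 2^{-k} for every k. -/
theorem UpperDoubling.ae_exists_small_doubling {lam : X → ℝ → ℝ} {C β : ℝ}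
    (hl : UpperDoubling μ lam C) {N : ℕ} (hN : 0 < N)
    (h : ∀ (x : X) (r : ℝ), 0 < r →
      ∃ s : Finset X, s.card ≤ N ∧ ball x r ⊆ ⋃ y ∈ s, ball y (r / 2))
    (hβ : 2 * (N : ℝ) ^ 7 ≤ β) :
    ∀ᵐ x ∂μ, ∀ j₀ : ℤ, ∃ j ≤ j₀,
      μ.real (ball x (128 ^ (j + 1))) ≤ β * μ.real (ball x (128 ^ j)) := by
  rcases isEmpty_or_nonempty X with hX | ⟨⟨o⟩⟩
  · exact ae_of_all _ fun x => isEmptyElim x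
  rw [ae_all_iff]
  intro j₀
  have hβ0 : 0 ≤ β := le_trans (by positivity) hβ
  suffices hball : ∀ n : ℕ, ∀ᵐ x ∂μ, x ∈ ball o ((n : ℝ) + 1) → ∃ j ≤ j₀,
      μ.real (ball x (128 ^ (j + 1))) ≤ β * μ.real (ball x (128 ^ j)) by
    filter_upwards [ae_all_iff.2 hball] with x hx
    obtain ⟨n, hn⟩ := exists_nat_gt (dist x o)
    exact hx n (mem_ball.2 (by linarith))
  intro n
  -- The bad set is not shown to be measurable; monotonicity and subadditivity of outer measure
  -- suffice.
  set bad := {x | x ∈ ball o ((n : ℝ) + 1) ∧ ∀ j ≤ j₀,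
    β * μ.real (ball x (128 ^ j)) < μ.real (ball x (128 ^ (j + 1)))} with hbad
  suffices hnull : μ bad = 0 by
    filter_upwards [measure_eq_zero_iff_ae_notMem.1 hnull] with x hx hxo
    by_contra! hcon
    exact hx ⟨hxo, hcon⟩
  set V := μ.real (ball o (n + 1 + 128 ^ j₀)) with hV
  have hbadtop : μ bad ≠ ∞ :=
    ((measure_mono fun x hx => hx.1).trans_lt (hl.measure_ball_lt_top o _)).ne
  -- M halvings bring twice the radius n+1 below 128^{j₀}; each further factor 128 takes 7 more.
  obtain ⟨M, hM⟩ := pow_unbounded_of_one_lt (2 * ((n : ℝ) + 1) / 128 ^ j₀) one_lt_two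
  rw [div_lt_iff₀ (by positivity)] at hM
  have key : ∀ k : ℕ, 2 ^ k * μ.real bad ≤ (N : ℝ) ^ M * V := by
    intro k
    obtain ⟨s, hs, hcov⟩ := exists_cover_of_halving h (M + 7 * k) o
      (r := (n : ℝ) + 1) (by positivity)
    have hrad : 2 * (((n : ℝ) + 1) / 2 ^ (M + 7 * k)) ≤ 128 ^ (j₀ - k) := by
      rw [zpow_sub₀ (by norm_num), zpow_natCast, pow_add, pow_mul, ← mul_div_assoc,
        div_le_div_iff₀ (by positivity) (by positivity)]
      norm_num
      nlinarith [show (0 : ℝ) < 128 ^ k by positivity]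
    have hpiece : ∀ y ∈ s, β ^ k * μ.real (bad ∩ ball y (((n : ℝ) + 1) / 2 ^ (M + 7 * k))) ≤ V := by
      intro y _
      rcases (bad ∩ ball y (((n : ℝ) + 1) / 2 ^ (M + 7 * k))).eq_empty_or_nonempty with he | ⟨x, hx⟩
      · rw [he]
        simp [hV, measureReal_nonneg]
      · have hsub : bad ∩ ball y (((n : ℝ) + 1) / 2 ^ (M + 7 * k)) ⊆ ball x (128 ^ (j₀ - k)) := by
          intro w hw
          have h1 := mem_ball.1 hw.2
          have h2 := mem_ball.1 hx.2
          rw [mem_ball]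
          linarith [dist_triangle_right w x y]
        have h1 : β ^ k * μ.real (ball x (128 ^ (j₀ - k))) ≤ μ.real (ball x (128 ^ j₀)) := by
          have := measureReal_ball_lt_of_not_doubling (μ := μ) hβ0 (x := x) (j := j₀ - k) (n := k)
            fun i hi => hx.1.2 _ (by omega)
          simpa using this
        calc _ ≤ β ^ k * μ.real (ball x (128 ^ (j₀ - k))) := by
              gcongr
              exact (hl.measure_ball_lt_top _ _).ne
          _ ≤ μ.real (ball x (128 ^ j₀)) := h1
          _ ≤ V := by
              refine measureReal_mono (ball_subset_ball' ?_) (hl.measure_ball_lt_top _ _).ne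
              have := mem_ball.1 hx.1.1
              linarith
    have hsum : β ^ k * μ.real bad ≤ (N : ℝ) ^ (M + 7 * k) * V := by
      have hle : μ.real bad ≤ ∑ y ∈ s, μ.real (bad ∩ ball y (((n : ℝ) + 1) / 2 ^ (M + 7 * k))) := by
        refine le_trans (measureReal_mono (fun x hx => ?_) ?_) (measureReal_biUnion_finset_le s _)
        · obtain ⟨y, hy, hxy⟩ := mem_iUnion₂.1 (hcov hx.1)
          exact mem_iUnion₂.2 ⟨y, hy, hx, hxy⟩
        · exact ((measure_mono (iUnion₂_subset fun y _ => inter_subset_left)).trans_lt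
            hbadtop.lt_top).ne
      calc _ ≤ β ^ k * ∑ y ∈ s, μ.real (bad ∩ ball y (((n : ℝ) + 1) / 2 ^ (M + 7 * k))) := by gcongr
        _ = ∑ y ∈ s, β ^ k * μ.real (bad ∩ ball y (((n : ℝ) + 1) / 2 ^ (M + 7 * k))) :=
          Finset.mul_sum _ _ _
        _ ≤ ∑ _y ∈ s, V := Finset.sum_le_sum hpiece
        _ = s.card * V := by simp
        _ ≤ _ := by
          gcongr
          exact_mod_cast hs
    have h2 : (2 * (N : ℝ) ^ 7) ^ k * μ.real bad ≤ (N : ℝ) ^ (M + 7 * k) * V :=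
      (mul_le_mul_of_nonneg_right (pow_le_pow_left₀ (by positivity) hβ k)
        measureReal_nonneg).trans hsum
    rw [mul_pow, ← pow_mul, pow_add] at h2
    refine le_of_mul_le_mul_left (a := (N : ℝ) ^ (7 * k)) ?_ (by positivity)
    linarith
  have hzero : μ.real bad = 0 := by
    by_contra hne
    have hpos : 0 < μ.real bad := lt_of_le_of_ne measureReal_nonneg (Ne.symm hne)
    obtain ⟨k, hk⟩ := pow_unbounded_of_one_lt ((N : ℝ) ^ M * V / μ.real bad) one_lt_two
    rw [div_lt_iff₀ hpos] at hk
    exact absurd (key k) (not_le.2 hk)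
  exact (measureReal_eq_zero_iff hbadtop).1 hzero

end

section

/-! ### Bounds for `L²` functions -/

section General

variable {α 𝕜 : Type*} [MeasurableSpace α] {μ : Measure α} [RCLike 𝕜]

theorem lintegral_sq_clm_le (T : Lp 𝕜 2 μ →L[𝕜] Lp 𝕜 2 μ) {f : α → 𝕜} (hf : MemLp f 2 μ) :
    ∫⁻ z, ‖T (hf.toLp f) z‖ₑ ^ (2 : ℝ) ∂μ ≤
      ENNReal.ofReal (‖T‖ ^ 2) * ∫⁻ z, ‖f z‖ₑ ^ (2 : ℝ) ∂μ := by
  have h := eLpNorm_clm_le T (hf.toLp f)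
  rw [eLpNorm_congr_ae hf.coeFn_toLp,
    eLpNorm_eq_lintegral_rpow_enorm_toReal two_ne_zero ENNReal.ofNat_ne_top,
    eLpNorm_eq_lintegral_rpow_enorm_toReal two_ne_zero ENNReal.ofNat_ne_top,
    ENNReal.toReal_ofNat] at h
  have h2 := ENNReal.rpow_le_rpow h (zero_le_two (α := ℝ))
  rw [ENNReal.mul_rpow_of_nonneg _ _ zero_le_two, ← ENNReal.rpow_mul, ← ENNReal.rpow_mul,
    ENNReal.ofReal_rpow_of_nonneg (norm_nonneg _) zero_le_two] at h2
  norm_num at h2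
  rw [ENNReal.ofReal_pow (norm_nonneg _), ofReal_norm]
  exact_mod_cast h2

theorem measure_le_norm_clm_le (T : Lp 𝕜 2 μ →L[𝕜] Lp 𝕜 2 μ) {f : α → 𝕜} (hf : MemLp f 2 μ) {s : ℝ}
    (hs : 0 < s) : μ {z | s ≤ ‖T (hf.toLp f) z‖} ≤
      ENNReal.ofReal ((‖T‖ / s) ^ 2) * ∫⁻ z, ‖f z‖ₑ ^ (2 : ℝ) ∂μ := by
  have hε0 : ENNReal.ofReal (s ^ 2) ≠ 0 := by
    rw [ne_eq, ENNReal.ofReal_eq_zero, not_le]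
    positivity
  calc μ {z | s ≤ ‖T (hf.toLp f) z‖}
      ≤ μ {z | ENNReal.ofReal (s ^ 2) ≤ ‖T (hf.toLp f) z‖ₑ ^ (2 : ℝ)} := by
        refine measure_mono fun z hz => ?_
        have hz : s ≤ ‖T (hf.toLp f) z‖ := hz
        change ENNReal.ofReal (s ^ 2) ≤ ‖T (hf.toLp f) z‖ₑ ^ (2 : ℝ)
        rw [← ofReal_norm, ENNReal.ofReal_rpow_of_nonneg (norm_nonneg _) zero_le_two]
        refine ENNReal.ofReal_le_ofReal ?_
        rw [Real.rpow_two]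
        gcongr
    _ ≤ (∫⁻ z, ‖T (hf.toLp f) z‖ₑ ^ (2 : ℝ) ∂μ) / ENNReal.ofReal (s ^ 2) :=
        meas_ge_le_lintegral_div ((Lp.aestronglyMeasurable _).enorm.pow_const _) hε0
          ENNReal.ofReal_ne_top
    _ ≤ (ENNReal.ofReal (‖T‖ ^ 2) * ∫⁻ z, ‖f z‖ₑ ^ (2 : ℝ) ∂μ) / ENNReal.ofReal (s ^ 2) := by
        gcongr
        exact lintegral_sq_clm_le T hf
    _ = _ := by
        rw [div_pow, ENNReal.ofReal_div_of_pos (by positivity), ENNReal.mul_div_right_comm]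

theorem setLIntegral_enorm_le_of_sq {f : α → 𝕜} (hf : AEStronglyMeasurable f μ) {s : Set α} {b : ℝ}
    (hb : 0 ≤ b) {V : ℝ≥0∞} (hs : μ s ≤ V)
    (h : ∫⁻ y in s, ‖f y‖ₑ ^ (2 : ℝ) ∂μ ≤ ENNReal.ofReal (b ^ 2) * V) :
    ∫⁻ y in s, ‖f y‖ₑ ∂μ ≤ ENNReal.ofReal b * V := by
  have h1 := ENNReal.lintegral_mul_le_Lp_mul_Lq (μ.restrict s) Real.HolderConjugate.two_two
    hf.restrict.enorm (aemeasurable_const (b := (1 : ℝ≥0∞)))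
  simp only [Pi.mul_apply, mul_one, ENNReal.one_rpow, lintegral_const, one_mul,
    Measure.restrict_apply_univ] at h1
  refine h1.trans ?_
  calc _ ≤ (ENNReal.ofReal (b ^ 2) * V) ^ (1 / 2 : ℝ) * V ^ (1 / 2 : ℝ) := by gcongr
    _ = ENNReal.ofReal b * (V ^ (1 / 2 : ℝ) * V ^ (1 / 2 : ℝ)) := by
        rw [ENNReal.mul_rpow_of_nonneg _ _ (by norm_num),
          ENNReal.ofReal_rpow_of_nonneg (by positivity) (by norm_num), ← Real.sqrt_eq_rpow,
          Real.sqrt_sq hb, mul_assoc]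
    _ = _ := by
        rw [← ENNReal.rpow_add_of_nonneg _ _ (by norm_num) (by norm_num)]
        norm_num

end General

variable {X 𝕜 : Type*} [MetricSpace X] [RCLike 𝕜] [MeasurableSpace X] [BorelSpace X]
  {μ : Measure X} {lam : X → ℝ → ℝ} {C A δ β b t : ℝ} {K : X → X → 𝕜}
  {T : Lp 𝕜 2 μ →L[𝕜] Lp 𝕜 2 μ} {f : X → 𝕜} {x : X}

omit [BorelSpace X] in
theorem avgBound_of_lintegral_ball_le (hl : UpperDoubling μ lam C) (hb : 0 ≤ b)
    (hmass : ∀ r, 0 < r → ∫⁻ y in ball x r, ‖f y‖ₑ ∂μ ≤ ENNReal.ofReal b * μ (ball x (8 * r)))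
    {r : ℝ} (hr : 0 < r) : AvgBound μ lam f x r (b * C ^ 3) := by
  intro s hs
  have hs0 := hr.trans_le hs
  refine (hmass s hs0).trans ?_
  rw [mul_assoc, ENNReal.ofReal_mul hb]
  gcongr
  refine (hl.measure_ball_le x (by positivity)).trans (ENNReal.ofReal_le_ofReal ?_)
  exact hl.lam_le_pow_mul 3 x (by positivity) hs0 (by norm_num)

/-- Summing the scales crudely would cost a factor n. Without doubling, the measure grows by at
least 2C^7 per scale and λ by at most C^7, so, read downwards from the top scale, the ratio of
measure to λ decays like 2^{-i} and the annuli form a geometric series. The innermost and outermost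
annuli are bounded directly. -/
theorem lintegral_annulus_chain_le (hl : UpperDoubling μ lam C) (hβ : 2 * C ^ 7 ≤ β) (hb : 0 ≤ b)
    (hmass : ∀ r, 0 < r → ∫⁻ y in ball x r, ‖f y‖ₑ ∂μ ≤ ENNReal.ofReal b * μ (ball x (8 * r)))
    {j : ℤ} {n : ℕ} (hnd : ∀ i : ℕ, i < n →
      β * μ.real (ball x (128 ^ (j + i))) < μ.real (ball x (128 ^ (j + i + 1)))) {s : ℝ}
    (hs : 128 ^ j ≤ 8 * s) :
    ∫⁻ y in {y | s ≤ dist x y ∧ dist x y < 2 * 128 ^ (j + n)},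
      ENNReal.ofReal (1 / lam x (dist x y)) * ‖f y‖ₑ ∂μ ≤ ENNReal.ofReal (4 * C ^ 14 * b) := by
  have hC1 := hl.one_le
  have hj : (0 : ℝ) < 128 ^ j := by positivity
  have hs0 : 0 < s := by linarith
  set a := b * C ^ 3 with ha
  have ha0 : 0 ≤ a := by positivity
  have hav : ∀ r, 0 < r → AvgBound μ lam f x r a := fun r hr =>
    avgBound_of_lintegral_ball_le hl hb hmass hr
  set φ : X → ℝ≥0∞ := fun y => ENNReal.ofReal (1 / lam x (dist x y)) * ‖f y‖ₑ
  -- The index counts down from the top. With l = j+n-2-i, the factor 8 in the mass bound fits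
  -- between 128^{l+1} and 128^{l+2}, and i non-doubling steps lead from l+2 up to j+n; C^14 pays
  -- for the two scales between l and l+2.
  set E : ℕ → Set X := fun i => {y | 128 ^ j ≤ dist x y ∧ (128 : ℝ) ^ (j + n - 2 - i) ≤ dist x y ∧
    dist x y < 128 ^ (j + n - 1 - i)} with hE
  have hcover : {y | s ≤ dist x y ∧ dist x y < 2 * 128 ^ (j + n)} ⊆
      ({y | s ≤ dist x y ∧ dist x y < 128 ^ j} ∪
        {y | 128 ^ (j + n - 1) ≤ dist x y ∧ dist x y < 2 * 128 ^ (j + n)}) ∪ ⋃ i, E i := by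
    rintro y ⟨h1, h2⟩
    by_cases h3 : dist x y < 128 ^ j
    · exact Or.inl (Or.inl ⟨h1, h3⟩)
    by_cases h4 : (128 : ℝ) ^ (j + n - 1) ≤ dist x y
    · exact Or.inl (Or.inr ⟨h4, h2⟩)
    · rw [not_lt] at h3
      rw [not_le] at h4
      obtain ⟨q, hq1, hq2⟩ := exists_mem_Ico_zpow (y := (128 : ℝ)) (hs0.trans_le h1) (by norm_num)
      have hq : q < j + n - 1 :=
        (zpow_lt_zpow_iff_right₀ (by norm_num : (1 : ℝ) < 128)).1 (hq1.trans_lt h4)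
      refine Or.inr (mem_iUnion.2 ⟨(j + n - 2 - q).toNat, h3, ?_, ?_⟩)
      · rw [Int.toNat_of_nonneg (by omega), sub_sub_cancel]
        exact hq1
      · rw [Int.toNat_of_nonneg (by omega), show j + n - 1 - (j + n - 2 - q) = q + 1 by ring]
        exact hq2
  have h1 : ∫⁻ y in {y | s ≤ dist x y ∧ dist x y < 128 ^ j}, φ y ∂μ ≤ ENNReal.ofReal (a * C ^ 3) :=
    lintegral_annulus_le hl hs0 (hav s hs0) ha0 3 (by linarith)
  have h2 : ∫⁻ y in {y | 128 ^ (j + n - 1) ≤ dist x y ∧ dist x y < 2 * 128 ^ (j + n)}, φ y ∂μ ≤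
      ENNReal.ofReal (a * C ^ 8) := by
    refine lintegral_annulus_le hl (by positivity) (hav _ (by positivity)) ha0 8 (le_of_eq ?_)
    have : (128 : ℝ) ^ (j + n) = 128 ^ (j + n - 1) * 128 := by
      rw [← zpow_add_one₀ (by norm_num)]
      congr 1
      ring
    rw [this]
    ring
  have hEi : ∀ i, ∫⁻ y in E i, φ y ∂μ ≤ ENNReal.ofReal (b * C ^ 14 * (1 / 2) ^ i) := by
    intro i
    by_cases hi : i + 2 ≤ n
    · set l : ℤ := j + n - 2 - i with hl_def
      have hl0 : (0 : ℝ) < 128 ^ l := by positivity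
      have hlam := hl.pos x hl0
      have hm : MeasurableSet (E i) :=
        (measurableSet_le measurable_const (continuous_const.dist continuous_id).measurable).inter
          ((measurableSet_le measurable_const
            (continuous_const.dist continuous_id).measurable).inter
            (measurableSet_lt (continuous_const.dist continuous_id).measurable measurable_const))
      have hmeas : μ.real (ball x (128 ^ (l + 2))) ≤ C ^ 14 * (1 / 2) ^ i * lam x (128 ^ l) := by
        have e1 := measureReal_ball_lt_of_not_doubling (μ := μ) (x := x) (j := l + 2) (n := i)
          ((by positivity : 0 ≤ 2 * C ^ 7).trans hβ) fun i' hi' => by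
            have := hnd (n - i + i') (by omega)
            convert this using 4
            · congr 1
              push_cast [Nat.cast_sub (show i ≤ n by omega)]
              ring
            · push_cast [Nat.cast_sub (show i ≤ n by omega)]
              ring
        have e2 := (hl.measureReal_ball_le x (r := 128 ^ (l + 2 + i)) (by positivity))
        have e3 := hl.lam_zpow_le x l (2 + i)
        push_cast at e3
        rw [← add_assoc] at e3
        have e4 : (2 * C ^ 7) ^ i * μ.real (ball x (128 ^ (l + 2))) ≤
            C ^ (7 * (2 + i)) * lam x (128 ^ l) :=
          (mul_le_mul_of_nonneg_right (pow_le_pow_left₀ (by positivity) hβ i)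
            measureReal_nonneg).trans (e1.trans (e2.trans e3))
        refine le_of_mul_le_mul_left (a := (2 * C ^ 7) ^ i) (e4.trans (le_of_eq ?_)) (by positivity)
        have e5 : (2 * C ^ 7) ^ i * (1 / 2) ^ i = C ^ (7 * i) := by
          rw [← mul_pow, pow_mul]
          congr 1
          ring
        calc _ = C ^ 14 * C ^ (7 * i) * lam x (128 ^ l) := by
              rw [← pow_add]
              congr 2
              ring
          _ = _ := by
              rw [← e5]
              ring
      calc ∫⁻ y in E i, φ y ∂μ ≤ ∫⁻ y in E i, ENNReal.ofReal (1 / lam x (128 ^ l)) * ‖f y‖ₑ ∂μ := by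
            refine setLIntegral_mono' hm fun y hy => ?_
            simp only [φ]
            gcongr
            exact hl.lam_le_lam x hl0 hy.2.1
        _ = ENNReal.ofReal (1 / lam x (128 ^ l)) * ∫⁻ y in E i, ‖f y‖ₑ ∂μ :=
            lintegral_const_mul' _ _ ENNReal.ofReal_ne_top
        _ ≤ ENNReal.ofReal (1 / lam x (128 ^ l)) *
            (ENNReal.ofReal b * ENNReal.ofReal (C ^ 14 * (1 / 2) ^ i * lam x (128 ^ l))) := by
            gcongr
            calc _ ≤ ∫⁻ y in ball x (128 ^ (l + 1)), ‖f y‖ₑ ∂μ := by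
                  refine lintegral_mono_set fun y hy => ?_
                  rw [mem_ball, dist_comm]
                  refine hy.2.2.trans_le (le_of_eq ?_)
                  congr 1
                  rw [hl_def]
                  ring
              _ ≤ ENNReal.ofReal b * μ (ball x (8 * 128 ^ (l + 1))) := hmass _ (by positivity)
              _ ≤ ENNReal.ofReal b * μ (ball x (128 ^ (l + 2))) := by
                  gcongr
                  rw [show l + 2 = l + 1 + 1 by ring, zpow_add_one₀ (by norm_num) (l + 1)]
                  have : (0 : ℝ) < 128 ^ (l + 1) := by positivity
                  linarith
              _ ≤ _ := by
                  gcongr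
                  rw [← ofReal_measureReal (hl.measure_ball_lt_top _ _).ne]
                  exact ENNReal.ofReal_le_ofReal hmeas
        _ = _ := by
            rw [← ENNReal.ofReal_mul hb, ← ENNReal.ofReal_mul (by positivity)]
            congr 1
            field_simp
    · have : E i = ∅ := by
        refine eq_empty_of_forall_notMem fun y hy => ?_
        have h5 : (128 : ℝ) ^ j < 128 ^ (j + n - 1 - i) := hy.1.trans_lt hy.2.2
        rw [zpow_lt_zpow_iff_right₀ (by norm_num)] at h5
        omega
      simp [this]
  have h3 : ∫⁻ y in ⋃ i, E i, φ y ∂μ ≤ ENNReal.ofReal (b * C ^ 14 * 2) := by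
    calc _ ≤ ∑' i, ∫⁻ y in E i, φ y ∂μ := lintegral_iUnion_le _ _
      _ ≤ ∑' i : ℕ, ENNReal.ofReal (b * C ^ 14 * (1 / 2) ^ i) := ENNReal.tsum_le_tsum hEi
      _ = ENNReal.ofReal (∑' i : ℕ, b * C ^ 14 * (1 / 2) ^ i) :=
          (ENNReal.ofReal_tsum_of_nonneg (fun i => by positivity)
            (summable_geometric_two.mul_left _)).symm
      _ = _ := by rw [tsum_mul_left, tsum_geometric_two]
  calc _ ≤ _ := lintegral_mono_set hcover
    _ ≤ ENNReal.ofReal (a * C ^ 3) + ENNReal.ofReal (a * C ^ 8) + ENNReal.ofReal (b * C ^ 14 * 2) :=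
        (lintegral_union_le _ _ _).trans
          (add_le_add ((lintegral_union_le _ _ _).trans (add_le_add h1 h2)) h3)
    _ ≤ _ := by
        rw [← ENNReal.ofReal_add (by positivity) (by positivity),
          ← ENNReal.ofReal_add (by positivity) (by positivity)]
        refine ENNReal.ofReal_le_ofReal ?_
        have e1 : C ^ 6 ≤ C ^ 14 := pow_le_pow_right₀ hC1 (by norm_num)
        have e2 : C ^ 11 ≤ C ^ 14 := pow_le_pow_right₀ hC1 (by norm_num)
        calc _ = b * (C ^ 6 + C ^ 11 + 2 * C ^ 14) := by rw [ha]; ring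
          _ ≤ b * (C ^ 14 + C ^ 14 + 2 * C ^ 14) := by gcongr
          _ = _ := by ring

/-! ### The good-`λ` inequality -/

theorem StandardKernel.norm_integral_sub_integral_le (hl : UpperDoubling μ lam C)
    (hK : StandardKernel lam K A δ) (hf : MemLp f 2 μ) {r a : ℝ} (hr : 0 < r) (ha : 0 ≤ a)
    (hav : AvgBound μ lam f x (2 * r) a) {z : X} (hz : dist x z ≤ r) :
    ‖∫ y in (ball x (2 * r))ᶜ, K z y * f y ∂μ - ∫ y in (ball x (2 * r))ᶜ, K x y * f y ∂μ‖ ≤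
      A * (a * tailConst C δ) := by
  have hA := hK.nonneg
  have htc := tailConst_nonneg hl.C_pos.le hK.exponent_pos
  have h1 := integrableOn_kernel_sub hl hK hr ha hf.1 hav hz
  have h2 := hK.integrableOn_mul hl hf x (r := 2 * r) (by positivity)
  have h3 : ∫ y in (ball x (2 * r))ᶜ, K z y * f y ∂μ =
      ∫ y in (ball x (2 * r))ᶜ, (K z y - K x y) * f y ∂μ +
        ∫ y in (ball x (2 * r))ᶜ, K x y * f y ∂μ := by
    rw [← integral_add h1 h2]
    congr 1 with y
    ring
  rw [h3, add_sub_cancel_right]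
  refine (norm_integral_le_lintegral_norm _).trans
    (ENNReal.toReal_le_of_le_ofReal (by positivity) ?_)
  simpa only [ofReal_norm] using lintegral_kernel_sub_le hl hK hr ha hav hz

/-- The far part of T f on the ball of radius r = 8 · 128^k is almost the constant `cr`. It is close
to `cR`, attached to the doubling ball of radius R, since no doubling occurs in between; and `cR` is
at most about t, as seen at a point of that ball outside U where the local part is small. -/
theorem CZOperator.ae_norm_le_of_stopping (hl : UpperDoubling μ lam C)
    (hT : CZOperator μ lam K A δ T) (hβ : 2 * C ^ 7 ≤ β) (hf : MemLp f 2 μ) (hb : 0 ≤ b)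
    (ht : 0 < t) (hsq : ∀ r, 0 < r →
      ∫⁻ y in ball x r, ‖f y‖ₑ ^ (2 : ℝ) ∂μ ≤ ENNReal.ofReal (b ^ 2) * μ (ball x (8 * r)))
    {U : Set X} (hU : ∀ᵐ z ∂μ, z ∉ U → ‖T (hf.toLp f) z‖ ≤ t) {k : ℤ} {n : ℕ}
    (hnd : ∀ i : ℕ, i < n →
      β * μ.real (ball x (128 ^ (k + 1 + i))) < μ.real (ball x (128 ^ (k + 1 + i + 1))))
    (hd : μ.real (ball x (128 ^ (k + 1 + n + 1))) ≤ β * μ.real (ball x (128 ^ (k + 1 + n))))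
    (hdens : 2 * μ.real (ball x (128 ^ (k + 1 + n)) ∩ U) < μ.real (ball x (128 ^ (k + 1 + n))))
    (hs1 : A * (2 * C ^ 3 * tailConst C δ + 4 * C ^ 14) * b ≤ t / 4)
    (hs2 : 32 * ‖T‖ ^ 2 * β * b ^ 2 ≤ t ^ 2) :
    ∀ᵐ z ∂μ, z ∈ ball x (8 * 128 ^ k) → ‖T (hf.toLp f) z‖ ≤ 3 / 2 * t +
      ‖T ((hf.indicator (measurableSet_ball (x := x) (ε := 2 * (8 * 128 ^ k)))).toLp _) z‖ := by
  have hC := hl.C_pos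
  have hA := hT.kernel.nonneg
  have hmass : ∀ r, 0 < r → ∫⁻ y in ball x r, ‖f y‖ₑ ∂μ ≤ ENNReal.ofReal b * μ (ball x (8 * r)) :=
    fun r hr => setLIntegral_enorm_le_of_sq hf.1 hb
      (measure_mono (ball_subset_ball (by linarith))) (hsq r hr)
  set a := b * C ^ 3 with ha
  have ha0 : 0 ≤ a := by positivity
  have hav : ∀ r, 0 < r → AvgBound μ lam f x r a := fun r hr =>
    avgBound_of_lintegral_ball_le hl hb hmass hr
  set R : ℝ := 128 ^ (k + 1 + n) with hR_def
  have hR : 0 < R := by positivity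
  set r : ℝ := 8 * 128 ^ k with hr_def
  have hr : 0 < r := by positivity
  set cR := ∫ y in (ball x (2 * R))ᶜ, K x y * f y ∂μ
  set cr := ∫ y in (ball x (2 * r))ᶜ, K x y * f y ∂μ
  set η := A * (a * tailConst C δ) with hη
  -- the constant attached to the doubling ball is controlled
  have hcR : ‖cR‖ ≤ t + t / 4 + η := by
    set E := {z | t / 4 ≤
      ‖T ((hf.indicator (measurableSet_ball (x := x) (ε := 2 * R))).toLp _) z‖} with hE
    have hμE : μ E ≤ ENNReal.ofReal (μ.real (ball x R) / 2) := by
      calc μ E ≤ ENNReal.ofReal ((‖T‖ / (t / 4)) ^ 2) *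
            ∫⁻ z, ‖(ball x (2 * R)).indicator f z‖ₑ ^ (2 : ℝ) ∂μ :=
            measure_le_norm_clm_le T _ (by positivity)
        _ = ENNReal.ofReal ((‖T‖ / (t / 4)) ^ 2) *
            ∫⁻ z in ball x (2 * R), ‖f z‖ₑ ^ (2 : ℝ) ∂μ := by
            rw [← lintegral_indicator measurableSet_ball]
            congr 2 with z
            by_cases hz : z ∈ ball x (2 * R) <;> simp [hz]
        _ ≤ ENNReal.ofReal ((‖T‖ / (t / 4)) ^ 2) * (ENNReal.ofReal (b ^ 2) *
            ENNReal.ofReal (β * μ.real (ball x R))) := by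
            gcongr
            refine (hsq (2 * R) (by positivity)).trans ?_
            gcongr
            refine le_trans ?_ (ENNReal.ofReal_le_ofReal hd)
            rw [ofReal_measureReal (hl.measure_ball_lt_top _ _).ne]
            refine measure_mono (ball_subset_ball ?_)
            rw [zpow_add_one₀ (by norm_num)]
            linarith
        _ = ENNReal.ofReal ((‖T‖ / (t / 4)) ^ 2 * (b ^ 2 * (β * μ.real (ball x R)))) := by
            rw [← ENNReal.ofReal_mul (by positivity), ← ENNReal.ofReal_mul (by positivity)]
        _ ≤ _ := by
            refine ENNReal.ofReal_le_ofReal ?_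
            have e : (‖T‖ / (t / 4)) ^ 2 * (b ^ 2 * (β * μ.real (ball x R))) =
                32 * ‖T‖ ^ 2 * β * b ^ 2 / t ^ 2 * (μ.real (ball x R) / 2) := by
              field_simp
              ring
            rw [e]
            refine mul_le_of_le_one_left (by positivity) ?_
            rwa [div_le_one (by positivity)]
    -- U takes strictly less than half of the ball and the exceptional set E at most half.
    have hne : μ (ball x R \ (U ∪ E)) ≠ 0 := by
      intro h0
      have hsub : ball x R ⊆ (ball x R \ (U ∪ E)) ∪ ((ball x R ∩ U) ∪ E) := by
        intro z hz
        by_cases h1 : z ∈ U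
        · exact Or.inr (Or.inl ⟨hz, h1⟩)
        by_cases h2 : z ∈ E
        · exact Or.inr (Or.inr h2)
        · exact Or.inl ⟨hz, fun h => h.elim h1 h2⟩
      have h1 : μ (ball x R) ≤ μ (ball x R ∩ U) + μ E := by
        calc _ ≤ _ := measure_mono hsub
          _ ≤ _ := measure_union_le _ _
          _ ≤ μ (ball x R \ (U ∪ E)) + (μ (ball x R ∩ U) + μ E) := by
            gcongr
            exact measure_union_le _ _
          _ = _ := by rw [h0, zero_add]
      have htop : μ (ball x R ∩ U) ≠ ∞ :=
        ((measure_mono inter_subset_left).trans_lt (hl.measure_ball_lt_top x R)).ne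
      have h2 := h1.trans (add_le_add le_rfl hμE)
      rw [← ofReal_measureReal htop, ← ENNReal.ofReal_add measureReal_nonneg (by positivity),
        ← ofReal_measureReal (hl.measure_ball_lt_top x R).ne] at h2
      have h3 := (ENNReal.ofReal_le_ofReal_iff (by positivity)).1 h2
      linarith
    obtain ⟨z, ⟨hzR, hzUE⟩, hzU, hrepr⟩ := ((frequently_ae_mem_iff.2 hne).and_eventually
      (hU.and (hT.ae_eq_add_integral hl hf x (by linarith : R < 2 * R)))).exists
    have e1 := hrepr hzR
    have e2 := hzU fun h => hzUE (Or.inl h)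
    have e3 : ‖T ((hf.indicator (measurableSet_ball (x := x) (ε := 2 * R))).toLp _) z‖ < t / 4 :=
      not_le.1 fun h => hzUE (Or.inr h)
    have e4 := hT.kernel.norm_integral_sub_integral_le hl hf hR ha0 (hav _ (by positivity))
      (z := z) (by rw [dist_comm]; exact (mem_ball.1 hzR).le)
    have e5 : cR = T (hf.toLp f) z -
        T ((hf.indicator (measurableSet_ball (x := x) (ε := 2 * R))).toLp _) z -
        (∫ y in (ball x (2 * R))ᶜ, K z y * f y ∂μ - cR) := by
      rw [e1]
      ring
    rw [e5]
    refine (norm_sub_le _ _).trans (add_le_add ((norm_sub_le _ _).trans ?_) e4)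
    exact add_le_add e2 e3.le
  have hrR : r ≤ R := by
    have : (128 : ℝ) ^ (k + 1) ≤ R := zpow_le_zpow_right₀ (by norm_num) (by omega)
    rw [zpow_add_one₀ (by norm_num)] at this
    linarith
  -- The annuli start at 2r = 16 · 128^k, and 8 · 16 = 128 meets the first non-doubling scale
  -- 128^{k+1}.
  have hcr : ‖cr - cR‖ ≤ A * (4 * C ^ 14 * b) := by
    have e1 : cr - cR = ∫ y, (cutKernel K f x r y - cutKernel K f x R y) ∂μ := by
      rw [integral_sub, cutKernel, cutKernel, integral_indicator measurableSet_ball.compl,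
        integral_indicator measurableSet_ball.compl]
      · exact (integrable_indicator_iff measurableSet_ball.compl).2
          (hT.kernel.integrableOn_mul hl hf x (by positivity))
      · exact (integrable_indicator_iff measurableSet_ball.compl).2
          (hT.kernel.integrableOn_mul hl hf x (by positivity))
    rw [e1]
    refine (norm_integral_le_lintegral_norm _).trans
      (ENNReal.toReal_le_of_le_ofReal (by positivity) ?_)
    simp_rw [ofReal_norm]
    rw [lintegral_cutKernel_sub_cutKernel hrR, ENNReal.ofReal_mul hA]
    refine (lintegral_ball_cutKernel_le_lintegral hT.kernel hr).trans (mul_le_mul_right ?_ _)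
    refine lintegral_annulus_chain_le hl hβ hb hmass hnd ?_
    rw [zpow_add_one₀ (by norm_num)]
    linarith
  filter_upwards [hT.ae_eq_add_integral hl hf x (by linarith : r < 2 * r)] with z hz hzr
  have e4 := hT.kernel.norm_integral_sub_integral_le hl hf hr ha0 (hav _ (by positivity))
    (z := z) (by rw [dist_comm]; exact (mem_ball.1 hzr).le)
  have e5 : T (hf.toLp f) z =
      T ((hf.indicator (measurableSet_ball (x := x) (ε := 2 * r))).toLp _) z +
      ((∫ y in (ball x (2 * r))ᶜ, K z y * f y ∂μ - cr) + ((cr - cR) + cR)) := by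
    rw [hz hzr]
    ring
  have e6 : ‖T (hf.toLp f) z‖ ≤
      ‖T ((hf.indicator (measurableSet_ball (x := x) (ε := 2 * r))).toLp _) z‖ +
      (η + (A * (4 * C ^ 14 * b) + (t + t / 4 + η))) := by
    rw [e5]
    refine (norm_add_le _ _).trans (add_le_add le_rfl ((norm_add_le _ _).trans (add_le_add e4 ?_)))
    exact (norm_add_le _ _).trans (add_le_add hcr hcR)
  refine e6.trans ?_
  have e7 : η + (A * (4 * C ^ 14 * b) + (t + t / 4 + η)) =
      t + t / 4 + A * (2 * C ^ 3 * tailConst C δ + 4 * C ^ 14) * b := by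
    rw [hη, ha]
    ring
  rw [e7]
  linarith

end

section

/-! ### Stopping balls and the covering argument. -/

section GoodLambda

variable {X 𝕜 : Type*} [MetricSpace X] [RCLike 𝕜] [MeasurableSpace X] [BorelSpace X]
  {μ : Measure X} {lam : X → ℝ → ℝ} {C A δ β b t : ℝ} {K : X → X → 𝕜}
  {T : Lp 𝕜 2 μ →L[𝕜] Lp 𝕜 2 μ} {f : X → 𝕜} {x : X}

omit [BorelSpace X] in
/-- A stopping radius `128 ^ k` at a point `x` of an open set `U` of small measure. -/
theorem UpperDoubling.exists_stopping (hl : UpperDoubling μ lam C) (hβ : 2 * C ^ 7 ≤ β)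
    {U : Set X} (hUo : IsOpen U) (hxU : x ∈ U) (hpos : ∀ r, 0 < r → 0 < μ.real (ball x r))
    (hsmall : ∀ j₀ : ℤ, ∃ j ≤ j₀,
      μ.real (ball x (128 ^ (j + 1))) ≤ β * μ.real (ball x (128 ^ j)))
    {L : ℝ} (hL : ∀ r, L ≤ r → 2 * β * μ.real (ball x r ∩ U) < μ.real (ball x r)) :
    ∃ (k : ℤ) (n : ℕ), (128 : ℝ) ^ k ≤ L ∧
      μ.real (ball x (128 ^ (k + 1))) ≤ 2 * β * μ.real (ball x (128 ^ k) ∩ U) ∧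
      (∀ i : ℕ, i < n →
        β * μ.real (ball x (128 ^ (k + 1 + i))) < μ.real (ball x (128 ^ (k + 1 + i + 1)))) ∧
      μ.real (ball x (128 ^ (k + 1 + n + 1))) ≤ β * μ.real (ball x (128 ^ (k + 1 + n))) ∧
      2 * μ.real (ball x (128 ^ (k + 1 + n)) ∩ U) < μ.real (ball x (128 ^ (k + 1 + n))) := by
  have hC := hl.C_pos
  have hβ0 : 0 < β := lt_of_lt_of_le (by positivity) hβ
  set P : ℤ → Prop := fun k =>
    μ.real (ball x (128 ^ (k + 1))) ≤ 2 * β * μ.real (ball x (128 ^ k) ∩ U) with hP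
  have hPL : ∀ k, P k → (128 : ℝ) ^ k ≤ L := by
    intro k hk
    by_contra! hlt
    have h1 := hL _ hlt.le
    have h2 : μ.real (ball x (128 ^ k)) ≤ μ.real (ball x (128 ^ (k + 1))) :=
      measureReal_mono (ball_subset_ball (zpow_le_zpow_right₀ (by norm_num) (by omega)))
        (hl.measure_ball_lt_top _ _).ne
    exact absurd (h2.trans hk) (not_le.2 h1)
  have hbdd : ∃ m, ∀ k, P k → k ≤ m := by
    refine ⟨⌈L⌉, fun k hk => ?_⟩
    rcases le_or_gt k 0 with h0 | h0
    · have hLpos : 0 < L := lt_of_lt_of_le (by positivity) (hPL k hk)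
      exact h0.trans (Int.ceil_nonneg hLpos.le)
    · have h1 := hPL k hk
      lift k to ℕ using h0.le
      rw [zpow_natCast] at h1
      have h2 : (k : ℝ) ≤ 128 ^ k := by exact_mod_cast (Nat.lt_pow_self (by norm_num)).le
      have h3 : ((k : ℤ) : ℝ) ≤ ⌈L⌉ := by
        push_cast
        exact h2.trans (h1.trans (Int.le_ceil L))
      exact_mod_cast h3
  -- A doubling ball so small that it lies in U satisfies the condition, with β to spare.
  have hne : ∃ k, P k := by
    obtain ⟨ε, hε, hball⟩ := Metric.isOpen_iff.1 hUo x hxU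
    obtain ⟨m, hm⟩ := pow_unbounded_of_one_lt (1 / ε) (by norm_num : (1 : ℝ) < 128)
    obtain ⟨j, hj, hdj⟩ := hsmall (-(m : ℤ))
    refine ⟨j, hdj.trans ?_⟩
    have hsub : ball x (128 ^ j) ⊆ U := by
      refine (ball_subset_ball ?_).trans hball
      calc (128 : ℝ) ^ j ≤ 128 ^ (-(m : ℤ)) := zpow_le_zpow_right₀ (by norm_num) hj
        _ ≤ ε := by
          rw [zpow_neg, zpow_natCast]
          rw [one_div] at hm
          exact (inv_lt_of_inv_lt₀ hε hm).le
    rw [inter_eq_left.2 hsub]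
    have := measureReal_nonneg (μ := μ) (s := ball x (128 ^ j))
    nlinarith
  obtain ⟨k, hk, hmax⟩ := Int.exists_greatest_of_bdd hbdd hne
  obtain ⟨n, hn, hnd⟩ := hl.exists_first_doubling hβ (j := k + 1) (hpos _ (by positivity))
  refine ⟨k, n, hPL k hk, hk, hnd, hn, ?_⟩
  -- Maximality of k excludes the later scale k+1+n; combined with doubling there, U has density
  -- below one half.
  have hnot : ¬ P (k + 1 + n) := fun h => by
    have := hmax _ h
    omega
  have h1 := (not_le.1 hnot).trans_le hn
  rw [mul_comm 2 β, mul_assoc] at h1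
  exact lt_of_mul_lt_mul_left h1 hβ0.le

/-- Where |T f| exceeds 2t, the local part exceeds t/2, which the weak L² bound controls by the
integral of |f|² over the ball of radius 16 · 128^k. The maximal bound turns this into the measure
of the ball of radius 128^{k+1}, and the stopping condition into that of B ∩ U. -/
theorem CZOperator.measure_stopping_ball_le (hl : UpperDoubling μ lam C)
    (hT : CZOperator μ lam K A δ T) (hβ : 2 * C ^ 7 ≤ β) (hf : MemLp f 2 μ) {γ : ℝ} (hγ : 0 ≤ γ)
    (ht : 0 < t) (hsq : ∀ r, 0 < r → ∫⁻ y in ball x r, ‖f y‖ₑ ^ (2 : ℝ) ∂μ ≤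
      ENNReal.ofReal ((γ * t) ^ 2) * μ (ball x (8 * r)))
    {U : Set X} (hU : ∀ᵐ z ∂μ, z ∉ U → ‖T (hf.toLp f) z‖ ≤ t) {k : ℤ} {n : ℕ}
    (hk : μ.real (ball x (128 ^ (k + 1))) ≤ 2 * β * μ.real (ball x (128 ^ k) ∩ U))
    (hnd : ∀ i : ℕ, i < n →
      β * μ.real (ball x (128 ^ (k + 1 + i))) < μ.real (ball x (128 ^ (k + 1 + i + 1))))
    (hd : μ.real (ball x (128 ^ (k + 1 + n + 1))) ≤ β * μ.real (ball x (128 ^ (k + 1 + n))))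
    (hdens : 2 * μ.real (ball x (128 ^ (k + 1 + n)) ∩ U) < μ.real (ball x (128 ^ (k + 1 + n))))
    (hs1 : A * (2 * C ^ 3 * tailConst C δ + 4 * C ^ 14) * γ ≤ 1 / 4)
    (hs2 : 32 * ‖T‖ ^ 2 * β * γ ^ 2 ≤ 1) :
    μ ({z | 2 * t < ‖T (hf.toLp f) z‖} ∩ ball x (8 * 128 ^ k)) ≤
      ENNReal.ofReal (8 * ‖T‖ ^ 2 * β * γ ^ 2) * μ (ball x (128 ^ k) ∩ U) := by
  have hC := hl.C_pos
  have hβ0 : 0 < β := lt_of_lt_of_le (by positivity) hβ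
  have hae := hT.ae_norm_le_of_stopping hl hβ hf (mul_nonneg hγ ht.le) ht hsq hU hnd hd hdens
    (by nlinarith) (by nlinarith [sq_nonneg t])
  have htop : μ (ball x (128 ^ k) ∩ U) ≠ ∞ :=
    ((measure_mono inter_subset_left).trans_lt (hl.measure_ball_lt_top x _)).ne
  calc _ ≤ μ {z | t / 2 ≤
        ‖T ((hf.indicator (measurableSet_ball (x := x) (ε := 2 * (8 * 128 ^ k)))).toLp _) z‖} := by
        refine measure_mono_ae ?_
        filter_upwards [hae] with z hz hzS
        have h1 := hz hzS.2
        have h2 : 2 * t < ‖T (hf.toLp f) z‖ := hzS.1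
        change t / 2 ≤ _
        linarith
    _ ≤ ENNReal.ofReal ((‖T‖ / (t / 2)) ^ 2) *
        ∫⁻ z, ‖(ball x (2 * (8 * 128 ^ k))).indicator f z‖ₑ ^ (2 : ℝ) ∂μ :=
        measure_le_norm_clm_le T _ (by positivity)
    _ = ENNReal.ofReal ((‖T‖ / (t / 2)) ^ 2) *
        ∫⁻ z in ball x (2 * (8 * 128 ^ k)), ‖f z‖ₑ ^ (2 : ℝ) ∂μ := by
        rw [← lintegral_indicator measurableSet_ball]
        congr 2 with z
        by_cases hz : z ∈ ball x (2 * (8 * 128 ^ k)) <;> simp [hz]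
    _ ≤ ENNReal.ofReal ((‖T‖ / (t / 2)) ^ 2) * (ENNReal.ofReal ((γ * t) ^ 2) *
        ENNReal.ofReal (2 * β * μ.real (ball x (128 ^ k) ∩ U))) := by
        gcongr
        refine (hsq _ (by positivity)).trans ?_
        gcongr
        refine le_trans ?_ (ENNReal.ofReal_le_ofReal hk)
        rw [ofReal_measureReal (hl.measure_ball_lt_top _ _).ne]
        refine measure_mono (ball_subset_ball (le_of_eq ?_))
        rw [zpow_add_one₀ (by norm_num)]
        ring
    _ = _ := by
        conv_rhs => rw [← ofReal_measureReal htop]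
        rw [← ENNReal.ofReal_mul (by positivity), ← ENNReal.ofReal_mul (by positivity),
          ← ENNReal.ofReal_mul (by positivity)]
        congr 1
        field_simp
        ring

variable [SecondCountableTopology X]

omit [BorelSpace X] in
theorem UpperDoubling.ae_measureReal_ball_pos (hl : UpperDoubling μ lam C) :
    ∀ᵐ x ∂μ, ∀ r, 0 < r → 0 < μ.real (ball x r) := by
  filter_upwards [Measure.support_mem_ae (μ := μ)] with x hx r hr
  rw [measureReal_def]
  exact ENNReal.toReal_pos ((Measure.mem_support_iff_forall x).1 hx _ (ball_mem_nhds x hr)).ne'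
    (hl.measure_ball_lt_top x r).ne

/-- Each point of {|T f| > 2t} outside the maximal set, up to a null set, has a stopping ball. A
Vitali subfamily of disjoint stopping balls B, with the 8B covering, sums the local estimates to a
small multiple of μ(U) ≤ 2 μ{|T f| > t}. -/
theorem CZOperator.good_lambda (hX : GeometricallyDoubling X) (hl : UpperDoubling μ lam C)
    (hT : CZOperator μ lam K A δ T) {θ : ℝ} (hθ : 0 < θ) :
    ∃ γ : ℝ, 0 < γ ∧ ∀ (f : X → 𝕜) (hf : MemLp f 2 μ) (t : ℝ), 0 < t →
      μ {z | 2 * t < ‖T (hf.toLp f) z‖} ≤ ENNReal.ofReal θ * μ {z | t < ‖T (hf.toLp f) z‖} +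
        μ (maxSet μ (fun y => ‖f y‖ₑ ^ (2 : ℝ)) (ENNReal.ofReal ((γ * t) ^ 2))) := by
  have := hl.isLocallyFiniteMeasure
  rcases isEmpty_or_nonempty X with hX' | ⟨⟨o⟩⟩
  · exact ⟨1, one_pos, fun f hf t _ => by simp [Measure.eq_zero_of_isEmpty]⟩
  obtain ⟨N₀, hN₀⟩ := hX
  set N := N₀ + 1
  have hN : ∀ (x : X) (r : ℝ), 0 < r →
      ∃ s : Finset X, s.card ≤ N ∧ ball x r ⊆ ⋃ y ∈ s, ball y (r / 2) := fun x r hr => by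
    obtain ⟨s, hs, h⟩ := hN₀ x r hr
    exact ⟨s, hs.trans (Nat.le_succ _), h⟩
  have hC := hl.C_pos
  have hA := hT.kernel.nonneg
  have htc := tailConst_nonneg hC.le hT.kernel.exponent_pos
  set β := max (2 * C ^ 7) (2 * (N : ℝ) ^ 7) with hβ_def
  have hβ : 2 * C ^ 7 ≤ β := le_max_left _ _
  have hβN : 2 * (N : ℝ) ^ 7 ≤ β := le_max_right _ _
  have hβ1 : 1 ≤ β := by
    have : 1 ≤ C ^ 7 := one_le_pow₀ hl.one_le
    linarith
  set D := A * (2 * C ^ 3 * tailConst C δ + 4 * C ^ 14)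
  have hD : 0 ≤ D := by positivity
  set M := ‖T‖ + 1
  have hM : 1 ≤ M := by simp [M]
  have hTM : ‖T‖ ^ 2 ≤ M ^ 2 := by
    gcongr
    simp [M]
  -- Q ≥ 1 forces γ ≤ 1, hence γ² ≤ γ; the two summands then give Dγ ≤ 1/4 and 32 M² β γ² ≤ min(1,
  -- θ).
  set Q := 4 * D + 32 * M ^ 2 * β with hQ_def
  have hMβ : 1 ≤ M ^ 2 * β := one_le_mul_of_one_le_of_one_le (one_le_pow₀ hM) hβ1
  have hQ : 1 ≤ Q := by linarith
  set γ := min 1 θ / Q with hγ_def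
  have hγ : 0 < γ := by positivity
  have hγQ : γ * Q = min 1 θ := div_mul_cancel₀ _ (by positivity)
  have hγ1 : γ ≤ 1 := by
    have : γ * 1 ≤ γ * Q := by gcongr
    linarith [min_le_left 1 θ]
  have hγ2 : γ ^ 2 ≤ γ := by nlinarith
  have hs1 : D * γ ≤ 1 / 4 := by
    have : 0 ≤ γ * (32 * M ^ 2 * β) := by positivity
    have h1 := min_le_left 1 θ
    rw [← hγQ, hQ_def] at h1
    linarith
  have hsM : 32 * M ^ 2 * β * γ ^ 2 ≤ min 1 θ := by
    have h0 : 0 ≤ γ * (4 * D) := by positivity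
    have h1 : 32 * M ^ 2 * β * γ ^ 2 ≤ 32 * M ^ 2 * β * γ := by gcongr
    rw [← hγQ, hQ_def]
    linarith
  have hsT : 32 * ‖T‖ ^ 2 * β * γ ^ 2 ≤ min 1 θ := by
    refine le_trans ?_ hsM
    gcongr
  refine ⟨γ, hγ, fun f hf t ht => ?_⟩
  set u := T (hf.toLp f)
  set F := {z | t < ‖u z‖} with hF
  set G := {z | 2 * t < ‖u z‖} with hG
  set W := maxSet μ (fun y => ‖f y‖ₑ ^ (2 : ℝ)) (ENNReal.ofReal ((γ * t) ^ 2)) with hW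
  have hGF : G ⊆ F := fun z hz => by
    have hz : 2 * t < ‖u z‖ := hz
    change t < ‖u z‖
    linarith
  have hFle : μ F ≤ ENNReal.ofReal ((M / t) ^ 2) * ∫⁻ z, ‖f z‖ₑ ^ (2 : ℝ) ∂μ := by
    calc μ F ≤ μ {z | t ≤ ‖u z‖} := measure_mono fun z (hz : t < ‖u z‖) => hz.le
      _ ≤ _ := measure_le_norm_clm_le T hf ht
      _ ≤ _ := by
        gcongr
        simp [M]
  have hfin : ∫⁻ z, ‖f z‖ₑ ^ (2 : ℝ) ∂μ < ∞ := by
    have := (eLpNorm_lt_top_iff_lintegral_rpow_enorm_lt_top two_ne_zero ENNReal.ofNat_ne_top).1 hf.2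
    rwa [ENNReal.toReal_ofNat] at this
  have hFtop : μ F ≠ ∞ := (hFle.trans_lt (ENNReal.mul_lt_top ENNReal.ofReal_lt_top hfin)).ne
  rcases eq_or_ne (μ F) 0 with hF0 | hF0
  · rw [measure_mono_null hGF hF0]
    exact zero_le
  obtain ⟨U, hFU, hUo, hμU⟩ := F.exists_isOpen_lt_of_lt (2 * μ F) (by
    rw [two_mul]
    exact ENNReal.lt_add_right hFtop hF0)
  have hu : ∀ᵐ z ∂μ, z ∉ U → ‖u z‖ ≤ t := ae_of_all _ fun z hz => not_lt.1 fun h => hz (hFU h)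
  set S := {x | x ∈ G ∧ x ∉ W ∧ (∀ r, 0 < r → 0 < μ.real (ball x r)) ∧ ∀ j₀ : ℤ, ∃ j ≤ j₀,
    μ.real (ball x (128 ^ (j + 1))) ≤ β * μ.real (ball x (128 ^ j))} with hS
  have hGS : μ G ≤ μ S + μ W := by
    refine (measure_mono_ae ?_).trans (measure_union_le S W)
    filter_upwards [hl.ae_measureReal_ball_pos,
      hl.ae_exists_small_doubling (Nat.succ_pos N₀) hN hβN] with x h1 h2 hx
    by_cases hxW : x ∈ W
    · exact Or.inr hxW
    · exact Or.inl ⟨hx, hxW, h1, h2⟩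
  refine hGS.trans (add_le_add ?_ le_rfl)
  -- S is exhausted by bounded pieces, on each of which the stopping radii have a common bound, as
  -- the Vitali lemma needs.
  have hSU : μ S ≤ ENNReal.ofReal (8 * ‖T‖ ^ 2 * β * γ ^ 2) * μ U := by
    have hSun : S = ⋃ n : ℕ, S ∩ ball o n := by
      rw [← inter_iUnion, iUnion_ball_nat, inter_univ]
    have hmono : Monotone fun n : ℕ => S ∩ ball o n := fun n m hnm =>
      inter_subset_inter_right _ (ball_subset_ball (by exact_mod_cast hnm))
    rw [hSun, hmono.measure_iUnion]
    refine iSup_le fun n => ?_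
    rcases S.eq_empty_or_nonempty with hSe | ⟨x₀, hx₀⟩
    · simp [hSe]
    have hsq : ∀ x ∈ S, ∀ r, 0 < r → ∫⁻ y in ball x r, ‖f y‖ₑ ^ (2 : ℝ) ∂μ ≤
        ENNReal.ofReal ((γ * t) ^ 2) * μ (ball x (8 * r)) := fun x hx r hr =>
      lintegral_ball_le_of_notMem_maxSet hx.2.1 hr
    -- Letting the radius tend to infinity at one point outside the maximal set bounds the whole L²
    -- norm of f by the total mass.
    have hglob : ∫⁻ y, ‖f y‖ₑ ^ (2 : ℝ) ∂μ ≤ ENNReal.ofReal ((γ * t) ^ 2) * μ univ := by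
      have hmono' : Monotone fun n : ℕ => ball x₀ (n : ℝ) := fun n m hnm =>
        ball_subset_ball (by exact_mod_cast hnm)
      rw [← setLIntegral_univ, ← iUnion_ball_nat x₀,
        setLIntegral_iUnion_of_directed _ hmono'.directed_le]
      refine iSup_le fun n => ?_
      rcases n.eq_zero_or_pos with rfl | hn
      · simp
      · refine (hsq x₀ hx₀ n (by exact_mod_cast hn)).trans ?_
        rw [iUnion_ball_nat]
        gcongr
        exact subset_univ _
    -- Hence U is small compared with the whole space, finite or infinite, and no arbitrarily large
    -- ball satisfies the stopping condition.
    have hUuniv : ENNReal.ofReal (2 * β) * μ U < μ univ := by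
      calc ENNReal.ofReal (2 * β) * μ U < ENNReal.ofReal (2 * β) * (2 * μ F) := by
            refine ENNReal.mul_lt_mul_right ?_ ENNReal.ofReal_ne_top hμU
            rw [ne_eq, ENNReal.ofReal_eq_zero, not_le]
            positivity
        _ ≤ ENNReal.ofReal (2 * β) * (2 * (ENNReal.ofReal ((M / t) ^ 2) *
            (ENNReal.ofReal ((γ * t) ^ 2) * μ univ))) := by
            gcongr
            exact hFle.trans (by gcongr)
        _ = ENNReal.ofReal (4 * M ^ 2 * β * γ ^ 2) * μ univ := by
            have : (2 : ℝ≥0∞) = ENNReal.ofReal 2 := by simp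
            rw [this, ← mul_assoc (ENNReal.ofReal ((M / t) ^ 2)), ← mul_assoc (ENNReal.ofReal 2),
              ← mul_assoc, ← ENNReal.ofReal_mul (by positivity), ← ENNReal.ofReal_mul (by positivity),
              ← ENNReal.ofReal_mul (by positivity)]
            congr 2
            field_simp
            ring
        _ ≤ 1 * μ univ := by
            gcongr
            rw [ENNReal.ofReal_le_one]
            have h1 := min_le_left 1 θ
            have h2 : 0 ≤ M ^ 2 * β * γ ^ 2 := by positivity
            linarith
        _ = μ univ := one_mul _
    obtain ⟨L, hL⟩ : ∃ L : ℕ, ENNReal.ofReal (2 * β) * μ U < μ (ball o L) := by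
      have hmono' : Monotone fun n : ℕ => ball o (n : ℝ) := fun n m hnm =>
        ball_subset_ball (by exact_mod_cast hnm)
      rw [← iUnion_ball_nat o, hmono'.measure_iUnion] at hUuniv
      exact lt_iSup_iff.1 hUuniv
    have hradius : ∀ x ∈ S ∩ ball o n, ∃ k : ℤ, (128 : ℝ) ^ k ≤ L + n ∧
        μ (G ∩ ball x (8 * 128 ^ k)) ≤
          ENNReal.ofReal (8 * ‖T‖ ^ 2 * β * γ ^ 2) * μ (ball x (128 ^ k) ∩ U) := by
      rintro x ⟨hxS, hxn⟩
      obtain ⟨k, m, h1, h2, h3, h4, h5⟩ := hl.exists_stopping hβ hUo (hFU (hGF hxS.1)) hxS.2.2.1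
        hxS.2.2.2 (L := L + n) fun r hr => by
          have e1 : μ (ball o L) ≤ μ (ball x r) := measure_mono (ball_subset_ball' (by
            rw [dist_comm]
            linarith [mem_ball.1 hxn]))
          have e2 : ENNReal.ofReal (2 * β) * μ (ball x r ∩ U) < μ (ball x r) :=
            ((mul_le_mul_right (measure_mono inter_subset_right) _).trans_lt hL).trans_le e1
          have e3 := ENNReal.toReal_strict_mono (hl.measure_ball_lt_top x r).ne e2
          rwa [ENNReal.toReal_mul, ENNReal.toReal_ofReal (by positivity)] at e3
      exact ⟨k, h1, hT.measure_stopping_ball_le hl hβ hf hγ.le ht (hsq x hxS) hu h2 h3 h4 h5 hs1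
        (hsT.trans (min_le_left _ _))⟩
    choose! k hk1 hk2 using hradius
    obtain ⟨v, hv, hvc, hvd, hcov⟩ := exists_disjoint_subfamily_ball
      ((fun x => (x, (128 : ℝ) ^ k x)) '' (S ∩ ball o n)) (R := L + n) (by
        rintro _ ⟨x, hx, rfl⟩
        exact ⟨by positivity, hk1 x hx⟩)
    have := hvc.to_subtype
    have hsub : S ∩ ball o n ⊆ ⋃ p ∈ v, G ∩ ball p.1 (8 * p.2) := by
      intro x hx
      have h1 : x ∈ ⋃ p ∈ (fun x => (x, (128 : ℝ) ^ k x)) '' (S ∩ ball o n), ball p.1 p.2 :=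
        mem_biUnion (mem_image_of_mem _ hx) (mem_ball_self (by positivity))
      obtain ⟨p, hp, hxp⟩ := mem_iUnion₂.1 (hcov h1)
      exact mem_iUnion₂.2 ⟨p, hp, hx.1.1, hxp⟩
    calc μ (S ∩ ball o n) ≤ μ (⋃ p ∈ v, G ∩ ball p.1 (8 * p.2)) := measure_mono hsub
      _ ≤ ∑' p : v, μ (G ∩ ball p.1.1 (8 * p.1.2)) := measure_biUnion_le μ hvc _
      _ ≤ ∑' p : v, ENNReal.ofReal (8 * ‖T‖ ^ 2 * β * γ ^ 2) * μ (ball p.1.1 p.1.2 ∩ U) := by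
          refine ENNReal.tsum_le_tsum fun p => ?_
          obtain ⟨x, hx, hxp⟩ := hv p.2
          rw [← hxp]
          exact hk2 x hx
      _ = ENNReal.ofReal (8 * ‖T‖ ^ 2 * β * γ ^ 2) * μ (⋃ p ∈ v, ball p.1 p.2 ∩ U) := by
          rw [ENNReal.tsum_mul_left, measure_biUnion hvc
            (hvd.mono fun p => inter_subset_left)
            fun p _ => measurableSet_ball.inter hUo.measurableSet]
      _ ≤ _ := by
          gcongr
          exact iUnion₂_subset fun p _ => inter_subset_right
  calc μ S ≤ ENNReal.ofReal (8 * ‖T‖ ^ 2 * β * γ ^ 2) * (2 * μ F) := hSU.trans (by gcongr)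
    _ = ENNReal.ofReal (16 * ‖T‖ ^ 2 * β * γ ^ 2) * μ F := by
        have : 2 * μ F = ENNReal.ofReal 2 * μ F := by simp
        rw [this, ← mul_assoc, ← ENNReal.ofReal_mul (by positivity)]
        congr 2
        ring
    _ ≤ _ := by
        gcongr
        have h1 := hsT.trans (min_le_right _ _)
        linarith

end GoodLambda

end

section

/-! ### `L^p` bounds for `p > 2` -/

section LargeExponent

variable {X 𝕜 : Type*} [MetricSpace X] [RCLike 𝕜] [MeasurableSpace X] [BorelSpace X]
  [SecondCountableTopology X] {μ : Measure X} {T : Lp 𝕜 2 μ →L[𝕜] Lp 𝕜 2 μ} {γ p : ℝ}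

/-- The weak bound leaves only the part of |f|² above (γt)²/2, that is, where t < (√2/γ)|f|. With
respect to the measure |f|² dμ the integral is then a layer-cake integral of exponent p - 2,
positive since p > 2. -/
theorem lintegral_measure_maxSet_le (hp : 2 < p) (hγ : 0 < γ) {f : X → 𝕜} (hf : Measurable f) :
    ∫⁻ t in Ioi (0 : ℝ), μ (maxSet μ (fun y => ‖f y‖ₑ ^ (2 : ℝ)) (ENNReal.ofReal ((γ * t) ^ 2))) *
        ENNReal.ofReal (t ^ (p - 1)) ≤
      ENNReal.ofReal (2 / γ ^ 2 * ((√2 / γ) ^ (p - 2) / (p - 2))) * ∫⁻ y, ‖f y‖ₑ ^ p ∂μ := by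
  set ν := μ.withDensity fun y => ‖f y‖ₑ ^ (2 : ℝ) with hν
  set c := √2 / γ with hc_def
  have hc : 0 < c := by positivity
  have hfm : Measurable fun y => ‖f y‖ₑ ^ (2 : ℝ) := hf.enorm.pow_const _
  have hlayer := lintegral_rpow_eq_lintegral_meas_lt_mul ν (f := fun y => c * ‖f y‖)
    (ae_of_all _ fun y => by positivity) (hf.norm.const_mul c).aemeasurable
    (by linarith : 0 < p - 2)
  have hint : ∫⁻ y, ENNReal.ofReal ((c * ‖f y‖) ^ (p - 2)) ∂ν =
      ENNReal.ofReal (c ^ (p - 2)) * ∫⁻ y, ‖f y‖ₑ ^ p ∂μ := by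
    rw [hν, lintegral_withDensity_eq_lintegral_mul _ hfm
      (((hf.norm.const_mul c).pow_const _).ennreal_ofReal),
      ← lintegral_const_mul' _ _ ENNReal.ofReal_ne_top]
    refine lintegral_congr fun y => ?_
    rw [Pi.mul_apply, Real.mul_rpow hc.le (norm_nonneg _), ENNReal.ofReal_mul (by positivity),
      ← ENNReal.ofReal_rpow_of_nonneg (norm_nonneg _) (by linarith), ofReal_norm, mul_left_comm,
      ← ENNReal.rpow_add_of_nonneg _ _ (by norm_num) (by linarith)]
    congr 2
    ring
  have hpt : ∀ t ∈ Ioi (0 : ℝ),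
      μ (maxSet μ (fun y => ‖f y‖ₑ ^ (2 : ℝ)) (ENNReal.ofReal ((γ * t) ^ 2))) *
        ENNReal.ofReal (t ^ (p - 1)) ≤
      ENNReal.ofReal (2 / γ ^ 2) * (ν {y | t < c * ‖f y‖} * ENNReal.ofReal (t ^ (p - 2 - 1))) := by
    intro t ht
    have ht : 0 < t := ht
    have h1 := mul_measure_maxSet_two_mul_le (μ := μ) (fun y => ‖f y‖ₑ ^ (2 : ℝ))
      (ENNReal.ofReal ((γ * t) ^ 2 / 2))
    have e1 : 2 * ENNReal.ofReal ((γ * t) ^ 2 / 2) = ENNReal.ofReal ((γ * t) ^ 2) := by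
      rw [← ENNReal.ofReal_ofNat 2, ← ENNReal.ofReal_mul zero_le_two]
      congr 1
      ring
    have e2 : {y | ENNReal.ofReal ((γ * t) ^ 2 / 2) < ‖f y‖ₑ ^ (2 : ℝ)} = {y | t < c * ‖f y‖} := by
      ext y
      change ENNReal.ofReal ((γ * t) ^ 2 / 2) < ‖f y‖ₑ ^ (2 : ℝ) ↔ t < c * ‖f y‖
      rw [← ofReal_norm, ENNReal.ofReal_rpow_of_nonneg (norm_nonneg _) zero_le_two,
        ENNReal.ofReal_lt_ofReal_iff_of_nonneg (by positivity), Real.rpow_two,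
        ← pow_lt_pow_iff_left₀ ht.le (by positivity) two_ne_zero, mul_pow, mul_pow, hc_def, div_pow,
        Real.sq_sqrt zero_le_two, div_lt_iff₀ two_pos, div_mul_eq_mul_div, lt_div_iff₀ (by positivity)]
      constructor <;> intro h <;> linarith
    have hms : MeasurableSet {y | t < c * ‖f y‖} :=
      measurableSet_lt measurable_const (hf.norm.const_mul c)
    rw [e1, e2, lintegral_indicator hms, ← withDensity_apply _ hms, ← hν] at h1
    have e3 : ENNReal.ofReal (t ^ (p - 1)) = ENNReal.ofReal (2 / γ ^ 2) *
        (ENNReal.ofReal ((γ * t) ^ 2 / 2) * ENNReal.ofReal (t ^ (p - 2 - 1))) := by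
      rw [← ENNReal.ofReal_mul (by positivity), ← ENNReal.ofReal_mul (by positivity)]
      congr 1
      have : t ^ (p - 1) = t ^ 2 * t ^ (p - 2 - 1) := by
        rw [← Real.rpow_two, ← Real.rpow_add ht]
        congr 1
        ring
      rw [this]
      field_simp
    calc _ = ENNReal.ofReal (2 / γ ^ 2) * (ENNReal.ofReal ((γ * t) ^ 2 / 2) *
          μ (maxSet μ (fun y => ‖f y‖ₑ ^ (2 : ℝ)) (ENNReal.ofReal ((γ * t) ^ 2))) *
            ENNReal.ofReal (t ^ (p - 2 - 1))) := by
          rw [e3]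
          ring
      _ ≤ _ := by gcongr
  have hfinal : ∫⁻ t in Ioi (0 : ℝ), ν {y | t < c * ‖f y‖} * ENNReal.ofReal (t ^ (p - 2 - 1)) =
      ENNReal.ofReal (c ^ (p - 2) / (p - 2)) * ∫⁻ y, ‖f y‖ₑ ^ p ∂μ := by
    have hp2 : 0 < p - 2 := by linarith
    rw [hint] at hlayer
    have h2 := congr_arg (fun v => ENNReal.ofReal (1 / (p - 2)) * v) hlayer
    simp only [← mul_assoc] at h2
    rw [← ENNReal.ofReal_mul (by positivity), ← ENNReal.ofReal_mul (by positivity),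
      one_div_mul_cancel hp2.ne', ENNReal.ofReal_one, one_mul] at h2
    rw [← h2]
    congr 2
    ring
  calc _ ≤ ∫⁻ t in Ioi (0 : ℝ), ENNReal.ofReal (2 / γ ^ 2) *
        (ν {y | t < c * ‖f y‖} * ENNReal.ofReal (t ^ (p - 2 - 1))) :=
        setLIntegral_mono' measurableSet_Ioi hpt
    _ = _ := by
        rw [lintegral_const_mul' _ _ ENNReal.ofReal_ne_top, hfinal, ← mul_assoc,
          ← ENNReal.ofReal_mul (by positivity)]

/-- Truncation at N makes J finite, since v^p ≤ N^{p-2} u². With θ = 2^{-p}/2 the layer-cake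
integral of v/2 is exactly 2θJ, while the good-λ bound gives θJ plus the error, so one θJ can be
subtracted. -/
theorem lintegral_min_rpow_le_of_good_lambda {α : Type*} [MeasurableSpace α] {μ : Measure α}
    (hp : 2 < p) {u : α → ℝ} (hu : Measurable u) (hu0 : ∀ x, 0 ≤ u x)
    (hu2 : ∫⁻ x, ENNReal.ofReal (u x ^ 2) ∂μ < ∞) {m : ℝ → ℝ≥0∞}
    (h : ∀ t, 0 < t → μ {x | 2 * t < u x} ≤
      ENNReal.ofReal (2 ^ (-p) / 2) * μ {x | t < u x} + m t) (N : ℕ) :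
    ENNReal.ofReal (2 ^ (-p) / 2) * ∫⁻ x, ENNReal.ofReal (min (u x) N ^ p) ∂μ ≤
      ENNReal.ofReal p * ∫⁻ t in Ioi (0 : ℝ), m t * ENNReal.ofReal (t ^ (p - 1)) := by
  have hp0 : 0 < p := by linarith
  set v : α → ℝ := fun x => min (u x) N with hv
  have hvm : Measurable v := hu.min measurable_const
  have hv0 : ∀ x, 0 ≤ v x := fun x => le_min (hu0 x) (Nat.cast_nonneg N)
  set J := ∫⁻ x, ENNReal.ofReal (v x ^ p) ∂μ with hJ
  set θ := ENNReal.ofReal (2 ^ (-p) / 2) with hθ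
  have hJtop : J ≠ ∞ := by
    refine (lt_of_le_of_lt ?_ (ENNReal.mul_lt_top (ENNReal.ofReal_lt_top (r := (N : ℝ) ^ (p - 2)))
      hu2)).ne
    rw [← lintegral_const_mul' _ _ ENNReal.ofReal_ne_top]
    refine lintegral_mono fun x => ?_
    rw [← ENNReal.ofReal_mul (by positivity)]
    refine ENNReal.ofReal_le_ofReal ?_
    have e : v x ^ p = v x ^ (p - 2) * v x ^ (2 : ℝ) := by
      rw [← Real.rpow_add_of_nonneg (hv0 x) (by linarith) (by norm_num)]
      congr 1
      ring
    rw [e, Real.rpow_two]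
    refine mul_le_mul (Real.rpow_le_rpow (hv0 x) (min_le_right _ _) (by linarith))
      (pow_le_pow_left₀ (hv0 x) (min_le_left _ _) 2) (by positivity) (by positivity)
  -- The inequality survives truncation: for t ≥ N the left-hand set is empty, and for t < N
  -- truncation does not affect {u > t}.
  have hgl : ∀ t, 0 < t → μ {x | t < v x / 2} ≤ θ * μ {x | t < v x} + m t := by
    intro t ht
    rcases lt_or_ge t (N : ℝ) with htN | htN
    · have e1 : {x | t < v x / 2} ⊆ {x | 2 * t < u x} := fun x (hx : t < v x / 2) => by
        have := min_le_left (u x) (N : ℝ)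
        change 2 * t < u x
        simp only [hv] at hx
        linarith
      have e2 : {x | t < u x} ⊆ {x | t < v x} := fun x (hx : t < u x) => lt_min hx htN
      refine (measure_mono e1).trans ((h t ht).trans ?_)
      gcongr
    · have : {x | t < v x / 2} = ∅ := eq_empty_of_forall_notMem fun x (hx : t < v x / 2) => by
        have := min_le_right (u x) (N : ℝ)
        simp only [hv] at hx
        linarith
      rw [this, measure_empty]
      exact zero_le
  have hlayer1 := lintegral_rpow_eq_lintegral_meas_lt_mul μ (ae_of_all _ hv0) hvm.aemeasurable hp0
  have hlayer2 := lintegral_rpow_eq_lintegral_meas_lt_mul μ (f := fun x => v x / 2)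
    (ae_of_all _ fun x => div_nonneg (hv0 x) zero_le_two) (hvm.div_const 2).aemeasurable hp0
  have hhalf : ∫⁻ x, ENNReal.ofReal ((v x / 2) ^ p) ∂μ = θ * J + θ * J := by
    rw [← add_mul, hθ, ← ENNReal.ofReal_add (by positivity) (by positivity), add_halves, hJ,
      ← lintegral_const_mul' _ _ ENNReal.ofReal_ne_top]
    refine lintegral_congr fun x => ?_
    rw [← ENNReal.ofReal_mul (by positivity), Real.div_rpow (hv0 x) zero_le_two,
      Real.rpow_neg zero_le_two, div_eq_inv_mul]
  have hanti : Antitone fun t => μ {x | t < v x} := fun s t hst =>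
    measure_mono fun x hx => lt_of_le_of_lt hst hx
  have hmain : θ * J + θ * J ≤ θ * J +
      ENNReal.ofReal p * ∫⁻ t in Ioi (0 : ℝ), m t * ENNReal.ofReal (t ^ (p - 1)) := by
    calc θ * J + θ * J = ENNReal.ofReal p *
          ∫⁻ t in Ioi (0 : ℝ), μ {x | t < v x / 2} * ENNReal.ofReal (t ^ (p - 1)) := by
          rw [← hhalf, hlayer2]
      _ ≤ ENNReal.ofReal p * ∫⁻ t in Ioi (0 : ℝ),
          (θ * (μ {x | t < v x} * ENNReal.ofReal (t ^ (p - 1))) +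
            m t * ENNReal.ofReal (t ^ (p - 1))) := by
          refine mul_le_mul_right (setLIntegral_mono' measurableSet_Ioi fun t ht => ?_) _
          rw [← mul_assoc, ← add_mul]
          exact mul_le_mul_left (hgl t ht) _
      _ = _ := by
          rw [lintegral_add_left, lintegral_const_mul' _ _ ENNReal.ofReal_ne_top, mul_add, hJ,
            hlayer1, mul_left_comm]
          exact (hanti.measurable.mul
            (measurable_id.pow_const (p - 1)).ennreal_ofReal).const_mul _
  exact (ENNReal.add_le_add_iff_left (ENNReal.mul_ne_top ENNReal.ofReal_ne_top hJtop)).1 hmain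

theorem lintegral_rpow_le_of_good_lambda (hp : 2 < p) (hγ : 0 < γ)
    (h : ∀ (f : X → 𝕜) (hf : MemLp f 2 μ) (t : ℝ), 0 < t →
      μ {z | 2 * t < ‖T (hf.toLp f) z‖} ≤
        ENNReal.ofReal (2 ^ (-p) / 2) * μ {z | t < ‖T (hf.toLp f) z‖} +
        μ (maxSet μ (fun y => ‖f y‖ₑ ^ (2 : ℝ)) (ENNReal.ofReal ((γ * t) ^ 2)))) :
    ∃ c : ℝ, ∀ (f : X → 𝕜) (hf : MemLp f 2 μ),
      ∫⁻ z, ‖T (hf.toLp f) z‖ₑ ^ p ∂μ ≤ ENNReal.ofReal c * ∫⁻ z, ‖f z‖ₑ ^ p ∂μ := by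
  have hp0 : 0 < p := by linarith
  set c₁ := 2 / γ ^ 2 * ((√2 / γ) ^ (p - 2) / (p - 2))
  set θ : ℝ := 2 ^ (-p) / 2
  have hθ : 0 < θ := by positivity
  refine ⟨1 / θ * (p * c₁), fun f hf => ?_⟩
  set g := hf.1.mk f
  have hfg : f =ᵐ[μ] g := hf.1.ae_eq_mk
  have hg : MemLp g 2 μ := hf.ae_eq hfg
  have hgm : Measurable g := hf.1.stronglyMeasurable_mk.measurable
  have hTfg : hf.toLp f = hg.toLp g := (MemLp.toLp_eq_toLp_iff hf hg).2 hfg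
  have hrhs : ∫⁻ z, ‖f z‖ₑ ^ p ∂μ = ∫⁻ z, ‖g z‖ₑ ^ p ∂μ :=
    lintegral_congr_ae (hfg.mono fun z hz => by simp only [hz])
  rw [hTfg, hrhs]
  set u : X → ℝ := fun z => ‖T (hg.toLp g) z‖ with hu
  have hum : Measurable u := (Lp.stronglyMeasurable _).norm.measurable
  have hu2 : ∫⁻ z, ENNReal.ofReal (u z ^ 2) ∂μ < ∞ := by
    have := (eLpNorm_lt_top_iff_lintegral_rpow_enorm_lt_top two_ne_zero ENNReal.ofNat_ne_top).1
      (Lp.memLp (T (hg.toLp g))).2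
    refine lt_of_le_of_lt (lintegral_mono fun z => ?_) this
    rw [ENNReal.toReal_ofNat, ← ofReal_norm, ENNReal.ofReal_rpow_of_nonneg (norm_nonneg _)
      zero_le_two, Real.rpow_two]
  have hN : ∀ N : ℕ, ∫⁻ z, ENNReal.ofReal (min (u z) N ^ p) ∂μ ≤
      ENNReal.ofReal (1 / θ * (p * c₁)) * ∫⁻ z, ‖g z‖ₑ ^ p ∂μ := by
    intro N
    have h1 := (lintegral_min_rpow_le_of_good_lambda hp hum (fun z => norm_nonneg _) hu2
      (h g hg) N).trans (mul_le_mul_right (lintegral_measure_maxSet_le hp hγ hgm) _)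
    have h2 := mul_le_mul_right h1 (ENNReal.ofReal (1 / θ))
    rw [← mul_assoc, ← ENNReal.ofReal_mul (by positivity), one_div_mul_cancel hθ.ne',
      ENNReal.ofReal_one, one_mul] at h2
    refine h2.trans (le_of_eq ?_)
    rw [← mul_assoc, ← mul_assoc, ← ENNReal.ofReal_mul (by positivity),
      ← ENNReal.ofReal_mul (by positivity), mul_assoc (1 / θ)]
  have hlim : Tendsto (fun N : ℕ => ∫⁻ z, ENNReal.ofReal (min (u z) N ^ p) ∂μ) atTop
      (𝓝 (∫⁻ z, ‖T (hg.toLp g) z‖ₑ ^ p ∂μ)) := by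
    refine lintegral_tendsto_of_tendsto_of_monotone (fun N =>
      ((hum.min measurable_const).pow_const p).ennreal_ofReal.aemeasurable)
      (ae_of_all _ fun z N M hNM => ?_) (ae_of_all _ fun z => ?_)
    · refine ENNReal.ofReal_le_ofReal (Real.rpow_le_rpow (le_min (norm_nonneg _)
        (Nat.cast_nonneg N)) (min_le_min_left _ (by exact_mod_cast hNM)) hp0.le)
    · refine tendsto_const_nhds.congr' ?_
      obtain ⟨N, hN⟩ := exists_nat_ge (u z)
      filter_upwards [eventually_ge_atTop N] with M hM
      rw [min_eq_left (hN.trans (by exact_mod_cast hM)), ← ENNReal.ofReal_rpow_of_nonneg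
        (norm_nonneg _) hp0.le, ofReal_norm]
  exact le_of_tendsto' hlim hN

end LargeExponent

/-! ### `L^p` boundedness, duality and extension -/

section Duality

variable {α 𝕜 : Type*} [MeasurableSpace α] {μ : Measure α} [RCLike 𝕜]

/-- `T` is bounded in the `L^p` norm on `L² ∩ L^p`. -/
def BoundedOnLp (T : Lp 𝕜 2 μ →L[𝕜] Lp 𝕜 2 μ) (p : ℝ) : Prop :=
  ∃ c : ℝ, 0 ≤ c ∧ ∀ (f : α → 𝕜) (hf : MemLp f 2 μ),
    (∫⁻ z, ‖T (hf.toLp f) z‖ₑ ^ p ∂μ) ^ (1 / p) ≤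
      ENNReal.ofReal c * (∫⁻ z, ‖f z‖ₑ ^ p ∂μ) ^ (1 / p)

/-- Test u = T f against h = |u|^{p-2} u on S n. The pairing equals J, and moving T to the other
side with Hölder gives J ≤ c J^{1/q} ‖f‖_p. Finiteness of J permits division, and n tends to
infinity. -/
theorem BoundedOnLp.of_adjoint {T : Lp 𝕜 2 μ →L[𝕜] Lp 𝕜 2 μ} {p q : ℝ} (hpq : p.HolderConjugate q)
    (h : BoundedOnLp (ContinuousLinearMap.adjoint T) q) : BoundedOnLp T p := by
  obtain ⟨c, hc, hT⟩ := h
  refine ⟨c, hc, fun f hf => ?_⟩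
  have hp0 := hpq.pos
  have hq0 := hpq.symm.pos
  have hp1 := hpq.lt
  set u : α → 𝕜 := ⇑(T (hf.toLp f)) with hu_def
  have hum : StronglyMeasurable u := Lp.stronglyMeasurable _
  have hu2 : MemLp u 2 μ := Lp.memLp _
  -- The lower bound on |u| makes S n of finite measure, the upper bound makes the test function
  -- bounded, so J is finite and h lies in L².
  set S : ℕ → Set α := fun n => {z | 1 / ((n : ℝ) + 1) ≤ ‖u z‖ ∧ ‖u z‖ ≤ n} with hS
  have hSm : ∀ n, MeasurableSet (S n) := fun n =>
    (measurableSet_le measurable_const hum.norm.measurable).inter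
      (measurableSet_le hum.norm.measurable measurable_const)
  have hSfin : ∀ n, μ (S n) < ∞ := fun n => by
    have h1 : 0 < 1 / ((n : ℝ) + 1) := by positivity
    refine lt_of_le_of_lt (measure_mono fun z hz => ?_) (hu2.meas_ge_lt_top two_ne_zero
      ENNReal.ofNat_ne_top (ε := (1 / ((n : ℝ) + 1)).toNNReal) (by simpa using h1))
    change _ ≤ ‖u z‖₊
    rw [Real.toNNReal_le_iff_le_coe]
    exact hz.1
  have key : ∀ n, (∫⁻ z in S n, ‖u z‖ₑ ^ p ∂μ) ^ (1 / p) ≤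
      ENNReal.ofReal c * (∫⁻ z, ‖f z‖ₑ ^ p ∂μ) ^ (1 / p) := by
    intro n
    have : IsFiniteMeasure (μ.restrict (S n)) := ⟨by simpa using hSfin n⟩
    set J := ∫⁻ z in S n, ‖u z‖ₑ ^ p ∂μ with hJ
    have hJtop : J ≠ ∞ := by
      refine (lt_of_le_of_lt (setLIntegral_mono' (hSm n) (g := fun _ => ENNReal.ofReal ((n : ℝ) ^ p))
        fun z hz => ?_) ?_).ne
      · rw [← ofReal_norm, ENNReal.ofReal_rpow_of_nonneg (norm_nonneg _) hp0.le]
        exact ENNReal.ofReal_le_ofReal (Real.rpow_le_rpow (norm_nonneg _) hz.2 hp0.le)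
      · rw [setLIntegral_const]
        exact ENNReal.mul_lt_top ENNReal.ofReal_lt_top (hSfin n)
    set h : α → 𝕜 := (S n).indicator fun z => ((‖u z‖ ^ (p - 2) : ℝ) : 𝕜) * u z with hh
    have hupos : ∀ z ∈ S n, 0 < ‖u z‖ := fun z hz =>
      lt_of_lt_of_le (by positivity) hz.1
    have hnorm : ∀ z ∈ S n, ‖h z‖ = ‖u z‖ ^ (p - 1) := fun z hz => by
      rw [hh, indicator_of_mem hz, norm_mul, RCLike.norm_ofReal, abs_of_nonneg (by positivity),
        ← Real.rpow_add_one (hupos z hz).ne']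
      congr 1
      ring
    have hhm : AEStronglyMeasurable h μ :=
      (((RCLike.continuous_ofReal.measurable.comp (hum.norm.measurable.pow_const _)).mul
        hum.measurable).indicator (hSm n)).aestronglyMeasurable
    have hh2 : MemLp h 2 μ := by
      have h1 : MemLp h 2 (μ.restrict (S n)) := by
        refine MemLp.of_bound hhm.restrict ((n : ℝ) ^ (p - 1)) (ae_restrict_of_forall_mem (hSm n) ?_)
        intro z hz
        rw [hnorm z hz]
        exact Real.rpow_le_rpow (norm_nonneg _) hz.2 (by linarith)
      have h2 : h = (S n).indicator h := by rw [hh, indicator_indicator, inter_self]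
      rw [h2]
      exact (memLp_indicator_iff_restrict (hSm n)).2 h1
    have hhq : ∫⁻ z, ‖h z‖ₑ ^ q ∂μ = J := by
      rw [hJ, ← lintegral_indicator (hSm n)]
      refine lintegral_congr fun z => ?_
      by_cases hz : z ∈ S n
      · rw [indicator_of_mem hz, ← ofReal_norm, hnorm z hz, ENNReal.ofReal_rpow_of_nonneg
          (by positivity) hq0.le, ← Real.rpow_mul (norm_nonneg _), hpq.sub_one_mul_conj,
          ← ENNReal.ofReal_rpow_of_nonneg (norm_nonneg _) hp0.le, ofReal_norm]
      · rw [hh, indicator_of_notMem hz, indicator_of_notMem hz, enorm_zero,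
          ENNReal.zero_rpow_of_pos hq0]
    have hinner : ‖inner 𝕜 (hh2.toLp h) (T (hf.toLp f))‖ₑ = J := by
      have e1 : inner 𝕜 (hh2.toLp h) (T (hf.toLp f)) =
          ∫ z, (((S n).indicator (fun z => ‖u z‖ ^ p) z : ℝ) : 𝕜) ∂μ := by
        rw [L2.inner_def]
        refine integral_congr_ae ?_
        filter_upwards [hh2.coeFn_toLp] with z hz
        rw [hz]
        by_cases hzS : z ∈ S n
        · rw [hh, indicator_of_mem hzS, indicator_of_mem hzS, RCLike.inner_apply, map_mul,
            RCLike.conj_ofReal, mul_left_comm, RCLike.mul_conj, ← RCLike.ofReal_pow,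
            ← RCLike.ofReal_mul]
          congr 1
          rw [← Real.rpow_two, ← Real.rpow_add (hupos z hzS)]
          congr 1
          ring
        · rw [hh, indicator_of_notMem hzS, indicator_of_notMem hzS, inner_zero_left,
            RCLike.ofReal_zero]
      rw [e1, integral_ofReal, ← ofReal_norm, RCLike.norm_ofReal, integral_indicator (hSm n),
        abs_of_nonneg (integral_nonneg fun z => by positivity), integral_eq_lintegral_of_nonneg_ae
        (ae_of_all _ fun z => by positivity)
        (hum.norm.measurable.pow_const _).aestronglyMeasurable]
      have e2 : ∫⁻ z in S n, ENNReal.ofReal (‖u z‖ ^ p) ∂μ = J := by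
        refine lintegral_congr fun z => ?_
        rw [← ENNReal.ofReal_rpow_of_nonneg (norm_nonneg _) hp0.le, ofReal_norm]
      rw [e2, ENNReal.ofReal_toReal hJtop]
    have hJle : J ≤ ENNReal.ofReal c * J ^ (1 / q) * (∫⁻ z, ‖f z‖ₑ ^ p ∂μ) ^ (1 / p) := by
      calc J = ‖inner 𝕜 (ContinuousLinearMap.adjoint T (hh2.toLp h)) (hf.toLp f)‖ₑ := by
            rw [ContinuousLinearMap.adjoint_inner_left, hinner]
        _ ≤ ∫⁻ z, ‖inner 𝕜 (ContinuousLinearMap.adjoint T (hh2.toLp h) z) (hf.toLp f z)‖ₑ ∂μ := by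
            rw [L2.inner_def]
            exact enorm_integral_le_lintegral_enorm _
        _ ≤ ∫⁻ z, ((fun z => ‖ContinuousLinearMap.adjoint T (hh2.toLp h) z‖ₑ) *
            fun z => ‖f z‖ₑ) z ∂μ := by
            refine lintegral_mono_ae ?_
            filter_upwards [hf.coeFn_toLp] with z hz
            rw [hz, Pi.mul_apply, RCLike.inner_apply, enorm_mul, mul_comm, ← ofReal_norm
              (starRingEnd 𝕜 _), RCLike.norm_conj, ofReal_norm]
        _ ≤ _ := ENNReal.lintegral_mul_le_Lp_mul_Lq μ hpq.symm
            (Lp.aestronglyMeasurable _).enorm hf.1.enorm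
        _ ≤ (ENNReal.ofReal c * (∫⁻ z, ‖h z‖ₑ ^ q ∂μ) ^ (1 / q)) *
            (∫⁻ z, ‖f z‖ₑ ^ p ∂μ) ^ (1 / p) := by
            gcongr
            exact hT h hh2
        _ = _ := by rw [hhq]
    rcases eq_or_ne J 0 with hJ0 | hJ0
    · rw [hJ0, ENNReal.zero_rpow_of_pos (by positivity)]
      exact zero_le
    have hJq0 : J ^ (1 / q) ≠ 0 := fun h0 => hJ0 ((ENNReal.rpow_eq_zero_iff_of_pos
      (by positivity)).1 h0)
    have hJqtop : J ^ (1 / q) ≠ ∞ := ENNReal.rpow_ne_top_of_nonneg (by positivity) hJtop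
    have hsplit : J = J ^ (1 / q) * J ^ (1 / p) := by
      rw [← ENNReal.rpow_add_of_nonneg _ _ (by positivity) (by positivity), one_div, one_div,
        add_comm, hpq.inv_add_inv_eq_one, ENNReal.rpow_one]
    refine (ENNReal.mul_le_mul_iff_right hJq0 hJqtop).1 ?_
    rw [← hsplit]
    refine hJle.trans (le_of_eq ?_)
    ring
  have hmono : Monotone S := fun n m hnm z hz => by
    refine ⟨le_trans ?_ hz.1, hz.2.trans (by exact_mod_cast hnm)⟩
    gcongr
  have hUn : ∫⁻ z, ‖u z‖ₑ ^ p ∂μ = ⨆ n, ∫⁻ z in S n, ‖u z‖ₑ ^ p ∂μ := by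
    rw [← setLIntegral_iUnion_of_directed _ hmono.directed_le,
      ← lintegral_indicator (MeasurableSet.iUnion hSm)]
    refine lintegral_congr fun z => ?_
    by_cases hz : u z = 0
    · by_cases hz' : z ∈ ⋃ n, S n
      · rw [indicator_of_mem hz']
      · rw [indicator_of_notMem hz', hz, enorm_zero, ENNReal.zero_rpow_of_pos hp0]
    · rw [indicator_of_mem]
      have hpos := norm_pos_iff.2 hz
      obtain ⟨n, hn⟩ := exists_nat_ge (max (1 / ‖u z‖) ‖u z‖)
      refine mem_iUnion.2 ⟨n, ?_, (le_max_right _ _).trans hn⟩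
      rw [one_div_le (by positivity) hpos]
      exact ((le_max_left _ _).trans hn).trans (by linarith)
  rw [hUn]
  refine le_of_tendsto' (((tendsto_atTop_iSup fun n m hnm => ?_).ennrpow_const (1 / p))) key
  exact lintegral_mono_set (hmono hnm)

/-- T is extended from the subspace L² ∩ L^p, which is dense because it contains the integrable
simple functions. -/
theorem BoundedOnLp.exists_extension {T : Lp 𝕜 2 μ →L[𝕜] Lp 𝕜 2 μ} {p : ℝ≥0∞} [hp1 : Fact (1 ≤ p)]
    (hp : p ≠ ∞) (h : BoundedOnLp T p.toReal) :
    ∃ Tp : Lp 𝕜 p μ →L[𝕜] Lp 𝕜 p μ, ∀ (f : α → 𝕜) (hf2 : MemLp f 2 μ) (hfp : MemLp f p μ),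
      Tp (hfp.toLp f) =ᵐ[μ] T (hf2.toLp f) := by
  obtain ⟨c, hc, hT⟩ := h
  have hp0 : p ≠ 0 := (zero_lt_one.trans_le hp1.out).ne'
  have hbound : ∀ (f : α → 𝕜) (hf : MemLp f 2 μ),
      eLpNorm (T (hf.toLp f)) p μ ≤ ENNReal.ofReal c * eLpNorm f p μ := fun f hf => by
    rw [eLpNorm_eq_lintegral_rpow_enorm_toReal hp0 hp, eLpNorm_eq_lintegral_rpow_enorm_toReal hp0 hp]
    exact hT f hf
  let D : Submodule 𝕜 (Lp 𝕜 p μ) :=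
    { carrier := {u | MemLp u 2 μ}
      add_mem' := fun {u v} hu hv => (MemLp.add hu hv).ae_eq (Lp.coeFn_add u v).symm
      zero_mem' := (MemLp.zero (ε := 𝕜)).ae_eq (Lp.coeFn_zero 𝕜 p μ).symm
      smul_mem' := fun a u hu => (MemLp.const_smul hu a).ae_eq (Lp.coeFn_smul a u).symm }
  have hmem : ∀ u : D, MemLp (T (MemLp.toLp u.1 u.2)) p μ := fun u =>
    ⟨Lp.aestronglyMeasurable _, (hbound _ u.2).trans_lt
      (ENNReal.mul_lt_top ENNReal.ofReal_lt_top (Lp.memLp u.1).2)⟩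
  let L : D →ₗ[𝕜] Lp 𝕜 p μ :=
    { toFun := fun u => (hmem u).toLp _
      map_add' := fun u v => by
        have e : MemLp.toLp (u + v).1 (u + v).2 = MemLp.toLp u.1 u.2 + MemLp.toLp v.1 v.2 := by
          rw [← MemLp.toLp_add]
          exact (MemLp.toLp_eq_toLp_iff _ _).2 (Lp.coeFn_add u.1 v.1)
        rw [← MemLp.toLp_add]
        refine (MemLp.toLp_eq_toLp_iff _ _).2 ?_
        rw [e, map_add]
        exact Lp.coeFn_add _ _
      map_smul' := fun a u => by
        have e : MemLp.toLp (a • u).1 (a • u).2 = a • MemLp.toLp u.1 u.2 := by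
          rw [← MemLp.toLp_const_smul]
          exact (MemLp.toLp_eq_toLp_iff _ _).2 (Lp.coeFn_smul a u.1)
        rw [RingHom.id_apply, ← MemLp.toLp_const_smul]
        refine (MemLp.toLp_eq_toLp_iff _ _).2 ?_
        rw [e, map_smul]
        exact Lp.coeFn_smul _ _ }
  have hLbound : ∀ u : D, ‖L u‖ ≤ c * ‖u‖ := fun u => by
    change ‖(hmem u).toLp _‖ ≤ c * ‖u.1‖
    have h1 := ENNReal.toReal_mono (ENNReal.mul_ne_top ENNReal.ofReal_ne_top
      (Lp.eLpNorm_ne_top u.1)) (hbound _ u.2)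
    rw [ENNReal.toReal_mul, ENNReal.toReal_ofReal hc] at h1
    rwa [Lp.norm_toLp, Lp.norm_def]
  have hdense : DenseRange (D.subtypeL : D → Lp 𝕜 p μ) := by
    refine (Lp.simpleFunc.denseRange (E := 𝕜) (μ := μ) hp).mono ?_
    rintro _ ⟨s, rfl⟩
    have h1 := (SimpleFunc.memLp_iff (E := 𝕜) hp0 hp).1 (Lp.simpleFunc.memLp s)
    have h2 : MemLp (Lp.simpleFunc.toSimpleFunc s) 2 μ :=
      (SimpleFunc.memLp_iff two_ne_zero ENNReal.ofNat_ne_top).2 h1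
    exact ⟨⟨s.1, h2.ae_eq (Lp.simpleFunc.toSimpleFunc_eq_toFun s)⟩, rfl⟩
  refine ⟨(L.mkContinuous c hLbound).extend D.subtypeL, fun f hf2 hfp => ?_⟩
  have hfD : MemLp (hfp.toLp f) 2 μ := hf2.ae_eq hfp.coeFn_toLp.symm
  have hext := (L.mkContinuous c hLbound).extend_eq hdense isUniformEmbedding_subtype_val.1
    (⟨hfp.toLp f, hfD⟩ : D)
  have e : MemLp.toLp (hfp.toLp f) hfD = hf2.toLp f :=
    (MemLp.toLp_eq_toLp_iff _ _).2 hfp.coeFn_toLp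
  have hL : (L.mkContinuous c hLbound) ⟨hfp.toLp f, hfD⟩ =ᵐ[μ] T (hf2.toLp f) := by
    rw [← e]
    exact (hmem ⟨hfp.toLp f, hfD⟩).coeFn_toLp
  rw [← hext] at hL
  exact hL

end Duality

end

/-! ### Boundedness for all exponents 1 < p < ∞. -/

section

theorem boundedOnLp_of_lintegral_rpow_le {α 𝕜 : Type*} [MeasurableSpace α] {μ : Measure α}
    [RCLike 𝕜] {T : Lp 𝕜 2 μ →L[𝕜] Lp 𝕜 2 μ} {p c : ℝ} (hp : 0 < p)
    (h : ∀ (f : α → 𝕜) (hf : MemLp f 2 μ),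
      ∫⁻ z, ‖T (hf.toLp f) z‖ₑ ^ p ∂μ ≤ ENNReal.ofReal c * ∫⁻ z, ‖f z‖ₑ ^ p ∂μ) :
    BoundedOnLp T p := by
  refine ⟨max c 0 ^ (1 / p), by positivity, fun f hf => ?_⟩
  rw [← ENNReal.ofReal_rpow_of_nonneg (le_max_right _ _) (by positivity),
    ← ENNReal.mul_rpow_of_nonneg _ _ (by positivity)]
  refine ENNReal.rpow_le_rpow ((h f hf).trans ?_) (by positivity)
  gcongr
  exact le_max_left _ _

variable {X 𝕜 : Type*} [MetricSpace X] [RCLike 𝕜] [MeasurableSpace X] [BorelSpace X]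
  [SecondCountableTopology X] {μ : Measure X} {lam : X → ℝ → ℝ} {K : X → X → 𝕜}
  {T : Lp 𝕜 2 μ →L[𝕜] Lp 𝕜 2 μ} {A C δ p : ℝ}

theorem CZOperator.boundedOnLp_of_two_lt (hX : GeometricallyDoubling X)
    (hl : UpperDoubling μ lam C) (hT : CZOperator μ lam K A δ T) (hp : 2 < p) :
    BoundedOnLp T p := by
  have := hl.isLocallyFiniteMeasure
  obtain ⟨γ, hγ, h⟩ := hT.good_lambda hX hl (θ := 2 ^ (-p) / 2) (by positivity)
  obtain ⟨c, hc⟩ := lintegral_rpow_le_of_good_lambda hp hγ h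
  exact boundedOnLp_of_lintegral_rpow_le (by linarith) hc

/-- For p < 2 the conjugate exponent exceeds 2, so the good-λ result applied to the adjoint and
duality give the bound. -/
theorem CZOperator.boundedOnLp (hX : GeometricallyDoubling X) (hl : UpperDoubling μ lam C)
    (hT : CZOperator μ lam K A δ T)
    (hm : AEStronglyMeasurable (fun q : X × X => K q.1 q.2)
      ((μ.prod μ).restrict {q | q.1 ≠ q.2})) (hp : 1 < p) : BoundedOnLp T p := by
  rcases lt_trichotomy p 2 with h2 | rfl | h2
  · have hpq := Real.HolderConjugate.conjExponent hp
    refine BoundedOnLp.of_adjoint hpq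
      ((hT.adjoint hl hm).boundedOnLp_of_two_lt hX hl ?_)
    rw [Real.conjExponent, lt_div_iff₀ (by linarith)]
    linarith
  · exact boundedOnLp_of_lintegral_rpow_le two_pos fun f hf => lintegral_sq_clm_le T hf
  · exact hT.boundedOnLp_of_two_lt hX hl h2

end

end NonHomogeneous

end

theorem mainTheorem1 {X 𝕜 : Type*} [MetricSpace X] [MeasurableSpace X] [BorelSpace X] [RCLike 𝕜]
    (hX : NonHomogeneous.GeometricallyDoubling X)
    (μ : Measure X) (lam : X → ℝ → ℝ) (hlam : NonHomogeneous.IsDominating μ lam)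
    (K : X → X → 𝕜) (T : Lp 𝕜 2 μ →L[𝕜] Lp 𝕜 2 μ)
    (hT : NonHomogeneous.IsCZOperator μ lam K T) :
    (∀ ρ : ℝ, 1 < ρ → ∃ C : ℝ, 0 ≤ C ∧
      (∀ f : X → 𝕜, MemLp f ∞ μ →
        (∃ g : X → 𝕜, NonHomogeneous.RepresentsModConst K T f g) ∧
        ∀ g : X → 𝕜, NonHomogeneous.RepresentsModConst K T f g →
          NonHomogeneous.MemRBMO μ lam ρ g ∧
          NonHomogeneous.rbmoNorm μ lam ρ g ≤ C * (eLpNorm f ∞ μ).toReal) ∧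
      (∀ (f : X → 𝕜) (hf : MemLp f 2 μ), MemLp f ∞ μ →
        NonHomogeneous.MemRBMO μ lam ρ (T (hf.toLp f)) ∧
        NonHomogeneous.rbmoNorm μ lam ρ (T (hf.toLp f)) ≤ C * (eLpNorm f ∞ μ).toReal)) ∧
    (∀ (p : ℝ≥0∞) [Fact (1 ≤ p)], 1 < p → p < ∞ →
      ∃ Tp : Lp 𝕜 p μ →L[𝕜] Lp 𝕜 p μ,
        ∀ (f : X → 𝕜) (hf2 : MemLp f 2 μ) (hfp : MemLp f p μ),
          Tp (hfp.toLp f) =ᵐ[μ] T (hf2.toLp f)) := by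
  have := hX.secondCountableTopology
  obtain ⟨C, hl⟩ := hlam.exists_upperDoubling
  have := hl.isLocallyFiniteMeasure
  obtain ⟨A, δ, hK⟩ := hT.kernel.exists_standardKernel hl
  -- Local integrability of K enters only through this joint measurability off the diagonal.
  have hm := hT.kernel.locallyIntegrableOn.aestronglyMeasurable
  have hTK : NonHomogeneous.CZOperator μ lam K A δ T := ⟨hK, hT.repr⟩
  refine ⟨fun ρ hρ => ?_, fun p _ hp1 hp => ?_⟩
  · obtain ⟨c, hc, h⟩ := hTK.memRBMO_and_rbmoNorm_le hl hm hρ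
    exact ⟨c, hc, fun f hf => ⟨hTK.exists_represents hl hf, h f hf⟩,
      fun f hf2 hf => h f hf _ (hTK.represents_toLp hl hf2 hf)⟩
  · have hp' : 1 < p.toReal := by
      rw [← ENNReal.toReal_one]
      exact (ENNReal.toReal_lt_toReal ENNReal.one_ne_top hp.ne).2 hp1
    exact (hTK.boundedOnLp hX hl hm hp').exists_extension hp.ne
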